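/- Let $\mathbb K=\mathbb Q(t,q)$, $\mathscr P_k^+=\mathbb K[x_1,\dots,x_k]$, let $\mathscr P_\infty^+$ be the graded inverse limit of the rings $\mathscr P_k^+$ along $x_k\mapsto 0$, with canonical maps $\Pi_k:\mathscr P_\infty^+\to\mathscr P_k^+$, and let $\mathscr P_{\rm as}^+\subset\mathscr P_\infty^+$ be the subspace of elements that are fixed by all but finitely many of the transpositions $s_i=(x_i\ x_{i+1})$. A sequence $f_k\in\mathscr P_k^+$ converges to $F\in\mathscr P_\infty^+$ if $f_k=\Pi_k h+\sum_{i=1}^N a_{i,k}\Pi_k g_i$ and $F=h+\sum_i a_ig_i$ for some $N$, $h\in\mathscr P_\infty^+$, $g_i\in\mathscr P_{\rm as}^+$ and $a_{i,k},a_i\in\mathbb K$ such that the order of vanishing of $a_{i,k}-a_i$ at $t=0$ tends to $+\infty$ as $k\to\infty$. The stable limit DAHA $\mathscr H^+$ is the $\mathbb K$-algebra with generators $T_i,X_i,Y_i$ ($i\ge1$) and relations: $T_iT_j=T_jT_i$ for $|i-j|>1$; $T_iT_{i+1}T_i=T_{i+1}T_iT_{i+1}$; $(T_i-1)(T_i+t)=0$;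 $tT_i^{-1}X_iT_i^{-1}=X_{i+1}$; $t^{-1}T_iY_iT_i=Y_{i+1}$; $T_iX_j=X_jT_i$ and $T_iY_j=Y_jT_i$ for $j\ne i,i+1$; $X_iX_j=X_jX_i$; $Y_iY_j=Y_jY_i$; $Y_1T_1X_1=X_2Y_1T_1$. For $k\ge1$ let $\mathscr H(k)^+\subset\mathscr H^+$ be the subalgebra generated by $T_i$ ($i\le k-1$) and $X_i,Y_i$ ($i\le k$). The DAHA $\mathscr H_k$ of type $GL_k$ is the $\mathbb K$-algebra with generators $T_i$ ($1\le i\le k-1$), $X_i^{\pm1},Y_i^{\pm1}$ ($1\le i\le k$), subject to those of the above relations that involve only these generators and to $Y_1X_1\cdots X_k=q\,X_1\cdots X_kY_1$; $\mathscr H_k^+$ is its subalgebra generated by all $T_i,X_i,Y_i$. On $\mathscr P_k^+$ put $T_i^{(k)}f=s_if+(1-t)x_i\frac{f-s_if}{x_i-x_{i+1}}$, $X_i^{(k)}f=x_if$ and $$\widetilde Y_i^{(k)}=t^{k+1-i}\,T_{i-1}^{(k)}\cdots T_1^{(k)}\,\varpi_k\,(T_{k-1}^{(k)})^{-1}\cdots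 (T_i^{(k)})^{-1},\qquad \varpi_kf=\mathrm{pr}_1 f(x_2,\dots,x_k,qx_1),$$ where $\mathrm{pr}_1$ is the $\mathbb K$-linear projection that fixes the monomials divisible by $x_1$ and kills the others. **Theorem.** There is a unique representation of $\mathscr H^+$ on $\mathscr P_{\rm as}^+$ (the standard representation) in which $T_i$ and $X_i$ act by the inverse limits of the operators $T_i^{(k)}$ and $X_i^{(k)}$, and $Y_i$ acts by $f\mapsto\lim_k\widetilde Y_i^{(k)}\Pi_kf$; and for every $k\ge1$ there is a unique algebra morphism $\varphi_k:\mathscr H(k)^+\to\mathscr H_k^+$ that sends each generator $T_i,X_i,Y_i$ to the generator of the same name. Let $r\ge1$ and $\mathbf H\in\mathscr H(r)^+$. Then the following are equivalent: 1. $\mathbf H$ acts by zero on $\mathscr P_{\rm as}^+$; 2. $\varphi_k(\mathbf H)=0$ for all $k\ge r$; 3. $\varphi_k(\mathbf H)=0$ for all sufficiently large $k\ge r$. -/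

import Mathlib

open Filter

noncomputable section

namespace StableLimit

/-! ## The base field `ℚ(t, q)` and the `t`-adic notion of convergence -/

/-- The polynomial ring `ℚ[t, q]`. -/
abbrev R : Type := MvPolynomial (Fin 2) ℚ

/-- The field `𝕂 = ℚ(t, q)`. -/
abbrev K : Type := FractionRing R

/-- The parameter `t ∈ ℚ(t, q)`. -/
def t : K := algebraMap R K (MvPolynomial.X 0)

/-- The parameter `q ∈ ℚ(t, q)`. -/
def q : K := algebraMap R K (MvPolynomial.X 1)

/-- The order of vanishing of `a ∈ ℚ(t, q)` at `t = 0` is at least `n`: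
`a = tⁿ A / B` with `A, B ∈ ℚ[t, q]` and `t ∤ B` (so that `0` vanishes to every order). -/
def OrdGE (n : ℕ) (a : K) : Prop :=
  ∃ A B : R, ¬ (MvPolynomial.X 0 ∣ B) ∧ a = t ^ n * algebraMap R K A / algebraMap R K B

/-- `lim_k aₖ = a` in `ℚ(t, q)`: the order of vanishing at `t = 0` of `aₖ - a` tends to `+∞`. -/
def ScalarTendsTo (a : ℕ → K) (l : K) : Prop :=
  ∀ n : ℕ, ∀ᶠ k in atTop, OrdGE n (a k - l)

/-! ## Polynomials, formal polynomials, almost symmetric functions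

The variable `x_{i+1}` is the one with index `i`: all indices start from `0` below. -/

/-- `𝒫ₖ⁺ = 𝕂[x₁, …, xₖ]`. -/
abbrev P (k : ℕ) : Type := MvPolynomial (Fin k) K

/-- The morphism `𝒫ₖ₊₁⁺ → 𝒫ₖ⁺` that maps the last variable to `0`. -/
def proj (k : ℕ) : P (k + 1) →ₐ[K] P k :=
  MvPolynomial.aeval fun i : Fin (k + 1) =>
    if h : (i : ℕ) < k then MvPolynomial.X ⟨i, h⟩ else 0

/-- The transposition of the variables with indices `j` and `j + 1`. -/
def simpleRefl (k j : ℕ) (h : j + 1 < k) : P k →ₐ[K] P k :=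
  MvPolynomial.rename (Equiv.swap (⟨j, Nat.lt_of_succ_lt h⟩ : Fin k) ⟨j + 1, h⟩)

/-- The graded inverse limit `𝒫_∞⁺` of the rings `𝒫ₖ⁺`: compatible sequences of polynomials of
bounded degree. The component at `k` of such a sequence is its image under `Πₖ`. -/
def Pinf : Submodule K (∀ k, P k) where
  carrier := {F | (∀ k, proj k (F (k + 1)) = F k) ∧ ∃ d : ℕ, ∀ k, (F k).totalDegree ≤ d}
  add_mem' := by
    rintro F G ⟨hF, d, hd⟩ ⟨hG, e, he⟩
    refine ⟨fun k => by simp [hF, hG], max d e, fun k => ?_⟩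
    exact (MvPolynomial.totalDegree_add _ _).trans (max_le_max (hd k) (he k))
  zero_mem' := ⟨fun k => by simp, 0, fun k => by simp⟩
  smul_mem' := by
    rintro c F ⟨hF, d, hd⟩
    exact ⟨fun k => by simp [hF], d, fun k => (MvPolynomial.totalDegree_smul_le _ _).trans (hd k)⟩

/-- `𝒫(m)⁺`: the elements of `𝒫_∞⁺` that are fixed by the transpositions of `x_i` and `x_{i+1}`
for all `i > m` (that is, those with index `j = i - 1 ≥ m`). -/
def Plevel (m : ℕ) : Submodule K (∀ k, P k) where
  carrier := {F | F ∈ Pinf ∧ ∀ j, m ≤ j → ∀ k (h : j + 1 < k), simpleRefl k j h (F k) = F k}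
  add_mem' := by
    rintro F G ⟨hF, hF'⟩ ⟨hG, hG'⟩
    exact ⟨Pinf.add_mem hF hG, fun j hj k h => by simp [hF' j hj k h, hG' j hj k h]⟩
  zero_mem' := ⟨Pinf.zero_mem, fun j hj k h => by simp⟩
  smul_mem' := by
    rintro c F ⟨hF, hF'⟩
    exact ⟨Pinf.smul_mem c hF, fun j hj k h => by simp [hF' j hj k h]⟩

lemma Plevel_mono {m n : ℕ} (h : m ≤ n) : Plevel m ≤ Plevel n :=
  fun _ hF => ⟨hF.1, fun j hj => hF.2 j (h.trans hj)⟩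

/-- The almost symmetric module `𝒫_as⁺ = ⋃ₘ 𝒫(m)⁺`. -/
def Pas : Submodule K (∀ k, P k) where
  carrier := {F | ∃ m, F ∈ Plevel m}
  add_mem' := by
    rintro F G ⟨m, hF⟩ ⟨n, hG⟩
    exact ⟨max m n, (Plevel (max m n)).add_mem (Plevel_mono (le_max_left _ _) hF)
      (Plevel_mono (le_max_right _ _) hG)⟩
  zero_mem' := ⟨0, (Plevel 0).zero_mem⟩
  smul_mem' := by
    rintro c F ⟨m, hF⟩
    exact ⟨m, (Plevel m).smul_mem c hF⟩

/-- The sequence `fₖ ∈ 𝒫ₖ⁺` converges to `F`: `fₖ = hₖ + ∑ᵢ aᵢₖ gᵢₖ` (finite sum) where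
`h = (hₖ) ∈ 𝒫_∞⁺`, `gᵢ = (gᵢₖ) ∈ 𝒫_as⁺`, the scalars `aᵢₖ` converge to `aᵢ` as `k → ∞`, and
`F = h + ∑ᵢ aᵢ gᵢ`. The decomposition is asked for from some index on, so that the notion applies
to sequences that are defined only for large `k`; finitely many terms can always be absorbed by
further summands `aᵢₖ gᵢₖ` with `aᵢₖ = 0` for large `k`. -/
def ConvergesTo (f : ∀ k, P k) (F : ∀ k, P k) : Prop :=
  ∃ (N : ℕ) (h : ∀ k, P k) (g : Fin N → ∀ k, P k) (a : Fin N → ℕ → K) (l : Fin N → K),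
    h ∈ Pinf ∧ (∀ i, g i ∈ Pas) ∧ (∀ i, ScalarTendsTo (a i) (l i)) ∧
    (∃ k₀, ∀ k, k₀ ≤ k → f k = h k + ∑ i, a i k • g i k) ∧
    F = h + ∑ i, l i • g i

/-! ## Operators on polynomials -/

lemma exists_divDiff {k : ℕ} (a b : Fin k) (f : P k) :
    ∃ g : P k, (MvPolynomial.X a - MvPolynomial.X b) * g =
      f - MvPolynomial.rename (Equiv.swap a b) f := by
  induction f using MvPolynomial.induction_on with
  | C c => exact ⟨0, by simp⟩
  | add f₁ f₂ h₁ h₂ =>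
    obtain ⟨g₁, h₁⟩ := h₁
    obtain ⟨g₂, h₂⟩ := h₂
    exact ⟨g₁ + g₂, by rw [mul_add, h₁, h₂, map_add]; ring⟩
  | mul_X f i hf =>
    obtain ⟨g, hg⟩ := hf
    rw [map_mul, MvPolynomial.rename_X]
    by_cases hia : i = a
    · subst hia
      refine ⟨g * MvPolynomial.X b + f, ?_⟩
      rw [Equiv.swap_apply_left]
      linear_combination (MvPolynomial.X b) * hg
    · by_cases hib : i = b
      · subst hib
        refine ⟨g * MvPolynomial.X a - f, ?_⟩
        rw [Equiv.swap_apply_right]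
        linear_combination (MvPolynomial.X a) * hg
      · refine ⟨g * MvPolynomial.X i, ?_⟩
        rw [Equiv.swap_apply_of_ne_of_ne hia hib]
        linear_combination (MvPolynomial.X i) * hg

lemma X_sub_X_ne_zero {k : ℕ} {a b : Fin k} (hab : a ≠ b) :
    (MvPolynomial.X a - MvPolynomial.X b : P k) ≠ 0 :=
  sub_ne_zero.mpr fun h => hab (MvPolynomial.X_injective h)

/-- The divided difference `f ↦ (f - s f) / (x_a - x_b)`, where `s` exchanges `x_a` and `x_b`. -/
def divDiff {k : ℕ} (a b : Fin k) (hab : a ≠ b) : P k →ₗ[K] P k where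
  toFun f := (exists_divDiff a b f).choose
  map_add' f₁ f₂ := by
    apply mul_left_cancel₀ (X_sub_X_ne_zero hab)
    rw [mul_add, (exists_divDiff a b (f₁ + f₂)).choose_spec, (exists_divDiff a b f₁).choose_spec,
      (exists_divDiff a b f₂).choose_spec, map_add]
    ring
  map_smul' c f := by
    apply mul_left_cancel₀ (X_sub_X_ne_zero hab)
    rw [(exists_divDiff a b (c • f)).choose_spec, RingHom.id_apply, mul_smul_comm,
      (exists_divDiff a b f).choose_spec, map_smul, smul_sub]

lemma divDiff_spec {k : ℕ} (a b : Fin k) (hab : a ≠ b) (f : P k) :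
    (MvPolynomial.X a - MvPolynomial.X b) * divDiff a b hab f =
      f - MvPolynomial.rename (Equiv.swap a b) f :=
  (exists_divDiff a b f).choose_spec

/-- The Demazure-Lusztig operator `T f = s f + (1 - t) x_a (f - s f) / (x_a - x_b)` on `𝒫ₖ⁺`, with
`a = j`, `b = j + 1`, and `s` the transposition of `x_a` and `x_b`
(set to the identity for `j` out of range). -/
def opT (k j : ℕ) : Module.End K (P k) :=
  if h : j + 1 < k then
    (simpleRefl k j h).toLinearMap +
      (1 - t) • (LinearMap.mulLeft K (MvPolynomial.X ⟨j, Nat.lt_of_succ_lt h⟩) ∘ₗ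
        divDiff ⟨j, Nat.lt_of_succ_lt h⟩ ⟨j + 1, h⟩ (by simp))
  else 1

/-- The inverse of the Demazure-Lusztig operator, see `opT_mul_opTinv` and `opTinv_mul_opT`. -/
def opTinv (k j : ℕ) : Module.End K (P k) :=
  t⁻¹ • (opT k j + (t - 1) • 1)

lemma t_ne_zero : t ≠ 0 := by
  simp [t]

lemma opT_quadratic (k j : ℕ) : opT k j * opT k j = (1 - t) • opT k j + t • 1 := by
  by_cases h : j + 1 < k
  swap
  · simp only [opT, dif_neg h, mul_one, ← add_smul]
    simp
  have hab : (⟨j, Nat.lt_of_succ_lt h⟩ : Fin k) ≠ ⟨j + 1, h⟩ := by simp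
  generalize ha : (⟨j, Nat.lt_of_succ_lt h⟩ : Fin k) = a at hab
  generalize hb : (⟨j + 1, h⟩ : Fin k) = b at hab
  have hT : ∀ f, opT k j f = MvPolynomial.rename (Equiv.swap a b) f +
      MvPolynomial.C (1 - t) * (MvPolynomial.X a * divDiff a b hab f) := by
    intro f
    subst ha hb
    simp only [opT, dif_pos h, simpleRefl, LinearMap.add_apply, LinearMap.smul_apply,
      MvPolynomial.smul_eq_C_mul]
    rfl
  refine LinearMap.ext fun f => ?_
  apply mul_left_cancel₀ (X_sub_X_ne_zero hab)
  rw [Module.End.mul_apply, hT (opT k j f)]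
  have h1 := divDiff_spec a b hab (opT k j f)
  have h2 := divDiff_spec a b hab f
  have h3 := congrArg (MvPolynomial.rename (Equiv.swap a b)) h2
  have hss : MvPolynomial.rename (Equiv.swap a b) (MvPolynomial.rename (Equiv.swap a b) f) = f := by
    rw [MvPolynomial.rename_rename]
    simp [← Equiv.coe_trans, ← Equiv.Perm.mul_def]
  simp only [map_mul, map_sub, MvPolynomial.rename_X, Equiv.swap_apply_left,
    Equiv.swap_apply_right, hss] at h3
  have h4 := congrArg (MvPolynomial.rename (Equiv.swap a b)) (hT f)
  simp only [map_mul, map_add, MvPolynomial.rename_X, Equiv.swap_apply_left,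
    MvPolynomial.rename_C, hss] at h4
  have h6 : ((1 - t) • opT k j + t • (1 : Module.End K (P k))) f =
      MvPolynomial.C (1 - t) * opT k j f + (1 - MvPolynomial.C (1 - t)) * f := by
    simp [MvPolynomial.smul_eq_C_mul]
  rw [h6]
  have hD : MvPolynomial.rename (Equiv.swap a b) (divDiff a b hab f) = divDiff a b hab f := by
    apply mul_left_cancel₀ (X_sub_X_ne_zero hab)
    linear_combination -h3 - h2
  rw [hD] at h4
  rw [hT f] at h4 h1 ⊢
  generalize (MvPolynomial.C (1 - t) : P k) = c at *
  linear_combination (c * MvPolynomial.X a) * h1 +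
    (MvPolynomial.X a - MvPolynomial.X b - c * MvPolynomial.X a) * h4 +
    c * MvPolynomial.X b * h2

lemma opT_mul_opTinv (k j : ℕ) : opT k j * opTinv k j = 1 := by
  have h := opT_quadratic k j
  rw [opTinv, mul_smul_comm, mul_add, h, mul_smul_comm, mul_one, inv_smul_eq_iff₀ t_ne_zero]
  rw [add_right_comm, ← add_smul]
  simp

lemma opTinv_mul_opT (k j : ℕ) : opTinv k j * opT k j = 1 := by
  have h := opT_quadratic k j
  rw [opTinv, smul_mul_assoc, add_mul, h, smul_mul_assoc, one_mul, inv_smul_eq_iff₀ t_ne_zero]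
  rw [add_right_comm, ← add_smul]
  simp

/-- Multiplication by the variable with index `j` on `𝒫ₖ⁺` (set to `0` for `j` out of range). -/
def opX (k j : ℕ) : Module.End K (P k) :=
  if h : j < k then LinearMap.mulLeft K (MvPolynomial.X ⟨j, h⟩) else 0

/-- The projection `pr₁`: the identity on the monomials that are divisible by the first variable,
zero on the other monomials. -/
def pr₁ (k : ℕ) : Module.End K (P k) :=
  (MvPolynomial.basisMonomials (Fin k) K).constr K fun m =>
    if ∃ i : Fin k, (i : ℕ) = 0 ∧ m i ≠ 0 then MvPolynomial.monomial m 1 else 0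

/-- The substitution `f(x₁, …, xₖ) ↦ f(x₂, …, xₖ, q x₁)`. -/
def rotate (k : ℕ) : P k →ₐ[K] P k :=
  MvPolynomial.aeval fun i : Fin k =>
    if h : (i : ℕ) + 1 < k then MvPolynomial.X ⟨i + 1, h⟩
    else MvPolynomial.C q * MvPolynomial.X ⟨0, i.pos⟩

/-- `ϖₖ f(x₁, …, xₖ) = pr₁ f(x₂, …, xₖ, q x₁)`. -/
def varpi (k : ℕ) : Module.End K (P k) :=
  pr₁ k ∘ₗ (rotate k).toLinearMap

/-- The deformed Cherednik operator
`t^(k+1-i) T_{i-1} ⋯ T_1 ϖₖ T_{k-1}⁻¹ ⋯ T_i⁻¹` with `i = j + 1 ≤ k`. -/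
def opYtilde (k j : ℕ) : Module.End K (P k) :=
  t ^ (k - j) • (((List.range j).reverse.map (opT k)).prod * varpi k *
    ((List.range' j (k - 1 - j)).reverse.map (opTinv k)).prod)

/-! ## The stable limit DAHA -/

/-- The generators of `ℋ⁺`; the index `i` stands for `i + 1` in one-based notation. -/
inductive StableGen : Type
  | T (i : ℕ)
  | X (i : ℕ)
  | Y (i : ℕ)

open StableGen in
/-- The defining relations of `ℋ⁺`. The quadratic relation makes `T_i` invertible, and
`T_i X_{i+1} T_i = t X_i` is the relation `t T_i⁻¹ X_i T_i⁻¹ = X_{i+1}`. -/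
inductive StableRel : FreeAlgebra K StableGen → FreeAlgebra K StableGen → Prop
  | T_comm (i j : ℕ) (h : i + 1 < j) : StableRel
      (FreeAlgebra.ι K (T i) * FreeAlgebra.ι K (T j))
      (FreeAlgebra.ι K (T j) * FreeAlgebra.ι K (T i))
  | braid (i : ℕ) : StableRel
      (FreeAlgebra.ι K (T i) * FreeAlgebra.ι K (T (i + 1)) * FreeAlgebra.ι K (T i))
      (FreeAlgebra.ι K (T (i + 1)) * FreeAlgebra.ι K (T i) * FreeAlgebra.ι K (T (i + 1)))
  | quadratic (i : ℕ) : StableRel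
      ((FreeAlgebra.ι K (T i) - 1) * (FreeAlgebra.ι K (T i) + algebraMap K _ t)) 0
  | X_succ (i : ℕ) : StableRel
      (FreeAlgebra.ι K (T i) * FreeAlgebra.ι K (X (i + 1)) * FreeAlgebra.ι K (T i))
      (t • FreeAlgebra.ι K (X i))
  | T_X (i j : ℕ) (h : j ≠ i) (h' : j ≠ i + 1) : StableRel
      (FreeAlgebra.ι K (T i) * FreeAlgebra.ι K (X j))
      (FreeAlgebra.ι K (X j) * FreeAlgebra.ι K (T i))
  | X_comm (i j : ℕ) : StableRel
      (FreeAlgebra.ι K (X i) * FreeAlgebra.ι K (X j))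
      (FreeAlgebra.ι K (X j) * FreeAlgebra.ι K (X i))
  | Y_succ (i : ℕ) : StableRel
      (t⁻¹ • (FreeAlgebra.ι K (T i) * FreeAlgebra.ι K (Y i) * FreeAlgebra.ι K (T i)))
      (FreeAlgebra.ι K (Y (i + 1)))
  | T_Y (i j : ℕ) (h : j ≠ i) (h' : j ≠ i + 1) : StableRel
      (FreeAlgebra.ι K (T i) * FreeAlgebra.ι K (Y j))
      (FreeAlgebra.ι K (Y j) * FreeAlgebra.ι K (T i))
  | Y_comm (i j : ℕ) : StableRel
      (FreeAlgebra.ι K (Y i) * FreeAlgebra.ι K (Y j))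
      (FreeAlgebra.ι K (Y j) * FreeAlgebra.ι K (Y i))
  | cross : StableRel
      (FreeAlgebra.ι K (Y 0) * FreeAlgebra.ι K (T 0) * FreeAlgebra.ι K (X 0))
      (FreeAlgebra.ι K (X 1) * FreeAlgebra.ι K (Y 0) * FreeAlgebra.ι K (T 0))

/-- The stable limit DAHA `ℋ⁺`. -/
abbrev StableDAHA : Type := RingQuot StableRel

/-- The class of a generator in `ℋ⁺`. -/
def sgen (x : StableGen) : StableDAHA := RingQuot.mkAlgHom K StableRel (FreeAlgebra.ι K x)

/-- The generators `T_i` with `1 ≤ i ≤ k - 1` and `X_i`, `Y_i` with `1 ≤ i ≤ k`. -/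
def genOfLevel (k : ℕ) : StableGen → Prop
  | .T i => i + 1 < k
  | .X i => i < k
  | .Y i => i < k

/-- `ℋ(k)⁺`: the subalgebra of `ℋ⁺` generated by `T_i`, `1 ≤ i ≤ k - 1`, and `X_i`, `Y_i`,
`1 ≤ i ≤ k`. -/
def level (k : ℕ) : Subalgebra K StableDAHA :=
  Algebra.adjoin K (sgen '' {x | genOfLevel k x})

lemma sgen_mem_level {k : ℕ} {x : StableGen} (h : genOfLevel k x) : sgen x ∈ level k :=
  Algebra.subset_adjoin ⟨x, h, rfl⟩

lemma level_mono {r k : ℕ} (h : r ≤ k) : level r ≤ level k := by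
  refine Algebra.adjoin_mono (Set.image_mono fun x hx => ?_)
  cases x <;> simp only [Set.mem_ofPred_eq, genOfLevel] at hx ⊢ <;> omega

/-! ## The finite rank DAHA -/

/-- The generators of `ℋₖ`, with zero-based indices. -/
inductive Gen (k : ℕ) : Type
  | T (i : ℕ) (h : i + 1 < k)
  | X (i : ℕ) (h : i < k)
  | Xinv (i : ℕ) (h : i < k)
  | Y (i : ℕ) (h : i < k)
  | Yinv (i : ℕ) (h : i < k)

open Gen in
/-- The defining relations of `ℋₖ`: those of `ℋ⁺` between the generators that are present, the
relation `Y₁ X₁ ⋯ Xₖ = q X₁ ⋯ Xₖ Y₁`, and the invertibility of the `X_i` and `Y_i`. -/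
inductive Rel (k : ℕ) : FreeAlgebra K (Gen k) → FreeAlgebra K (Gen k) → Prop
  | T_comm (i j : ℕ) (hi : i + 1 < k) (hj : j + 1 < k) (h : i + 1 < j) : Rel k
      (FreeAlgebra.ι K (T i hi) * FreeAlgebra.ι K (T j hj))
      (FreeAlgebra.ι K (T j hj) * FreeAlgebra.ι K (T i hi))
  | braid (i : ℕ) (hi : i + 1 < k) (hi' : i + 1 + 1 < k) : Rel k
      (FreeAlgebra.ι K (T i hi) * FreeAlgebra.ι K (T (i + 1) hi') * FreeAlgebra.ι K (T i hi))
      (FreeAlgebra.ι K (T (i + 1) hi') * FreeAlgebra.ι K (T i hi) *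
        FreeAlgebra.ι K (T (i + 1) hi'))
  | quadratic (i : ℕ) (hi : i + 1 < k) : Rel k
      ((FreeAlgebra.ι K (T i hi) - 1) * (FreeAlgebra.ι K (T i hi) + algebraMap K _ t)) 0
  | X_succ (i : ℕ) (hi : i < k) (hi' : i + 1 < k) : Rel k
      (FreeAlgebra.ι K (T i hi') * FreeAlgebra.ι K (X (i + 1) hi') * FreeAlgebra.ι K (T i hi'))
      (t • FreeAlgebra.ι K (X i hi))
  | T_X (i j : ℕ) (hi : i + 1 < k) (hj : j < k) (h : j ≠ i) (h' : j ≠ i + 1) : Rel k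
      (FreeAlgebra.ι K (T i hi) * FreeAlgebra.ι K (X j hj))
      (FreeAlgebra.ι K (X j hj) * FreeAlgebra.ι K (T i hi))
  | X_comm (i j : ℕ) (hi : i < k) (hj : j < k) : Rel k
      (FreeAlgebra.ι K (X i hi) * FreeAlgebra.ι K (X j hj))
      (FreeAlgebra.ι K (X j hj) * FreeAlgebra.ι K (X i hi))
  | Y_succ (i : ℕ) (hi : i < k) (hi' : i + 1 < k) : Rel k
      (t⁻¹ • (FreeAlgebra.ι K (T i hi') * FreeAlgebra.ι K (Y i hi) * FreeAlgebra.ι K (T i hi')))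
      (FreeAlgebra.ι K (Y (i + 1) hi'))
  | T_Y (i j : ℕ) (hi : i + 1 < k) (hj : j < k) (h : j ≠ i) (h' : j ≠ i + 1) : Rel k
      (FreeAlgebra.ι K (T i hi) * FreeAlgebra.ι K (Y j hj))
      (FreeAlgebra.ι K (Y j hj) * FreeAlgebra.ι K (T i hi))
  | Y_comm (i j : ℕ) (hi : i < k) (hj : j < k) : Rel k
      (FreeAlgebra.ι K (Y i hi) * FreeAlgebra.ι K (Y j hj))
      (FreeAlgebra.ι K (Y j hj) * FreeAlgebra.ι K (Y i hi))
  | cross (h0 : 0 < k) (h1 : 0 + 1 < k) : Rel k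
      (FreeAlgebra.ι K (Y 0 h0) * FreeAlgebra.ι K (T 0 h1) * FreeAlgebra.ι K (X 0 h0))
      (FreeAlgebra.ι K (X 1 h1) * FreeAlgebra.ι K (Y 0 h0) * FreeAlgebra.ι K (T 0 h1))
  | det (h0 : 0 < k) : Rel k
      (FreeAlgebra.ι K (Y 0 h0) *
        (List.ofFn fun i : Fin k => FreeAlgebra.ι K (X i.1 i.2)).prod)
      (q • ((List.ofFn fun i : Fin k => FreeAlgebra.ι K (X i.1 i.2)).prod *
        FreeAlgebra.ι K (Y 0 h0)))
  | X_mul_Xinv (i : ℕ) (hi : i < k) : Rel k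
      (FreeAlgebra.ι K (X i hi) * FreeAlgebra.ι K (Xinv i hi)) 1
  | Xinv_mul_X (i : ℕ) (hi : i < k) : Rel k
      (FreeAlgebra.ι K (Xinv i hi) * FreeAlgebra.ι K (X i hi)) 1
  | Y_mul_Yinv (i : ℕ) (hi : i < k) : Rel k
      (FreeAlgebra.ι K (Y i hi) * FreeAlgebra.ι K (Yinv i hi)) 1
  | Yinv_mul_Y (i : ℕ) (hi : i < k) : Rel k
      (FreeAlgebra.ι K (Yinv i hi) * FreeAlgebra.ι K (Y i hi)) 1

/-- The double affine Hecke algebra `ℋₖ` of type `GLₖ`. -/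
abbrev DAHA (k : ℕ) : Type := RingQuot (Rel k)

/-- The class of a generator in `ℋₖ`. -/
def gen {k : ℕ} (x : Gen k) : DAHA k := RingQuot.mkAlgHom K (Rel k) (FreeAlgebra.ι K x)

/-- The generator of `ℋₖ` that corresponds to a generator `T_i`, `X_i` or `Y_i` of `ℋ(k)⁺`. -/
def toGen {k : ℕ} : (x : StableGen) → genOfLevel k x → Gen k
  | .T i, h => .T i h
  | .X i, h => .X i h
  | .Y i, h => .Y i h

/-- `ℋₖ⁺`: the subalgebra of `ℋₖ` generated by `T_i`, `1 ≤ i ≤ k - 1`, and `X_i`, `Y_i`,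
`1 ≤ i ≤ k`. -/
def DAHAPlus (k : ℕ) : Subalgebra K (DAHA k) :=
  Algebra.adjoin K {y | ∃ (x : StableGen) (h : genOfLevel k x), y = gen (toGen x h)}

/-! ## The standard representation and the canonical morphisms -/

/-- `ρ` is the standard representation of `ℋ⁺` on `𝒫_as⁺`: the generators `T_i` and `X_i` act by
the inverse limits of the Demazure-Lusztig operators and of the multiplication operators, and
`Y_i` acts by the limit of the deformed Cherednik operators. -/
structure IsStandardRep (ρ : StableDAHA →ₐ[K] Module.End K Pas) : Prop where
  T_apply : ∀ (i : ℕ) (f : Pas) (k : ℕ), i + 1 < k →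
    (ρ (sgen (.T i)) f : ∀ k, P k) k = opT k i ((f : ∀ k, P k) k)
  X_apply : ∀ (i : ℕ) (f : Pas) (k : ℕ), i < k →
    (ρ (sgen (.X i)) f : ∀ k, P k) k = opX k i ((f : ∀ k, P k) k)
  Y_apply : ∀ (i : ℕ) (f : Pas),
    ConvergesTo (fun k => opYtilde k i ((f : ∀ k, P k) k)) (ρ (sgen (.Y i)) f : ∀ k, P k)

/-- `φ : ℋ(k)⁺ → ℋₖ⁺` is the canonical morphism: it sends each of the generators `T_i`, `X_i`,
`Y_i` of `ℋ(k)⁺` to the corresponding generator of `ℋₖ⁺`. -/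
def IsCanonicalMorphism (k : ℕ) (φ : level k →ₐ[K] DAHAPlus k) : Prop :=
  ∀ (x : StableGen) (h : genOfLevel k x),
    (φ ⟨sgen x, sgen_mem_level h⟩ : DAHA k) = gen (toGen x h)

end StableLimit

end

/-!
The operators `ϖ_k` are not the operators of the polynomial representation of `ℋₖ`: there, `Y_0` is
built from the full rotation `f ↦ f(x_1, …, x_{k-1}, q x_0)`, without the projection `pr₁`. The two
versions of `Y_0` differ by a multiple of `t ^ k` (`opY_zero_sub_opYtilde_zero`), so they have the
same limit in the `t`-adic topology, and everything can be read off the polynomial representation.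

*The finite rank action.* On the field of rational functions in `x_0, …, x_{k-1}` the operators
`T_i`, `X_i^{±1}`, `Y_i^{±1}` satisfy the relations of `ℋₖ` (`genL_rel`), which gives a
representation `repL k`; `T_i`, `X_i` and `Y_i` preserve polynomials.

*The limit action, and why vanishing in finite rank implies vanishing in the limit.* Every almost
symmetric function is a combination of products of a symmetric function and a monomial in finitely
many variables. On symmetric functions the Cherednik operator `Y_0` is `t ^ k` times the
substitution `x_i ↦ q x_i` (`opY_zero_of_symm`), which tends to zero, and on multiples of `x_0` it
is compatible with the projections; the Hecke operators reduce the general case to these two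
(`Yconv_of_degree`). Convergence is refined to a notion `SConv` which the operators preserve, so
that words in the generators act by the limit of their finite rank actions (`SConv_act`). Thus an
element of the free algebra that vanishes in `ℋₖ` for all large `k` acts by zero on `𝒫_as⁺`
(`actInf_eq_of_eventually`). Applied to the defining relations this produces the standard
representation; applied to `𝐇` it shows that the third condition implies the first.

*Why vanishing in the limit implies vanishing in finite rank.* On the multiples of
`x_0 ⋯ x_{k-1}` all the operators of level `k` are compatible with the projections, so an element of
level `k` that acts by zero on `𝒫_as⁺` acts by zero on the multiples of `x_0 ⋯ x_{k-1}` in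
`𝒫_k⁺` (`actP_eq_zero`). The algebra `ℋₖ⁺` acts faithfully there (`toDAHA_eq_zero_of_actP`): it is
spanned by the products `X^a T_w Y^b` (`DAHAPlus_le_span`), and at `t = 1` the operator `T_w Y^b`
becomes the substitution `x_i ↦ q^{b_i} x_i` followed by the permutation `w`. These substitutions are
pairwise distinct, hence independent over the field of rational functions (Dedekind). A relation
among the `T_w Y^b` with polynomial coefficients, cleared of denominators, therefore has all its
coefficients divisible by `t - 1`, and dividing repeatedly shows that they vanish
(`eq_zero_of_sum_mul_eq_zero`). So an element of the free algebra of level `k` that acts by zero on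
`𝒫_as⁺` maps to zero in `ℋₖ` (`toDAHA_eq_zero`). As the relations of `ℋ⁺` act by zero on `𝒫_as⁺`,
this yields the existence of `φ_k` (`canonical`), and it shows that the first condition implies the
second.
-/

noncomputable section

namespace StableLimit

open MvPolynomial (C)

/-! ### The `t`-adic order on `ℚ(t, q)` -/

lemma prime_X0 : Prime (MvPolynomial.X 0 : R) := MvPolynomial.X_prime

lemma not_dvd_mul_X0 {B B' : R} (h : ¬ (MvPolynomial.X 0 ∣ B)) (h' : ¬ (MvPolynomial.X 0 ∣ B')) :
    ¬ ((MvPolynomial.X 0 : R) ∣ B * B') := fun hd => (prime_X0.dvd_or_dvd hd).elim h h'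

lemma algebraMap_ne_zero_of_not_dvd {B : R} (h : ¬ (MvPolynomial.X 0 ∣ B)) :
    algebraMap R K B ≠ 0 := by
  intro h0
  rw [FaithfulSMul.algebraMap_eq_zero_iff] at h0
  exact h (h0 ▸ dvd_zero _)

lemma algebraMap_X0 : algebraMap R K (MvPolynomial.X 0) = t := rfl

lemma OrdGE.add {n : ℕ} {a b : K} (ha : OrdGE n a) (hb : OrdGE n b) : OrdGE n (a + b) := by
  obtain ⟨A, B, hB, rfl⟩ := ha
  obtain ⟨A', B', hB', rfl⟩ := hb
  refine ⟨A * B' + A' * B, B * B', not_dvd_mul_X0 hB hB', ?_⟩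
  have h1 := algebraMap_ne_zero_of_not_dvd hB
  have h2 := algebraMap_ne_zero_of_not_dvd hB'
  rw [map_add, map_mul, map_mul, map_mul]
  field_simp

lemma OrdGE.mul {n m : ℕ} {a b : K} (ha : OrdGE n a) (hb : OrdGE m b) :
    OrdGE (n + m) (a * b) := by
  obtain ⟨A, B, hB, rfl⟩ := ha
  obtain ⟨A', B', hB', rfl⟩ := hb
  refine ⟨A * A', B * B', not_dvd_mul_X0 hB hB', ?_⟩
  rw [map_mul, map_mul, pow_add]
  ring

lemma OrdGE.mono {n m : ℕ} (h : m ≤ n) {a : K} (ha : OrdGE n a) : OrdGE m a := by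
  obtain ⟨A, B, hB, rfl⟩ := ha
  refine ⟨MvPolynomial.X 0 ^ (n - m) * A, B, hB, ?_⟩
  rw [map_mul, map_pow, algebraMap_X0, ← mul_assoc, ← pow_add, Nat.add_sub_cancel' h]

lemma OrdGE.zero (n : ℕ) : OrdGE n 0 :=
  ⟨0, 1, fun h => prime_X0.not_isUnit (isUnit_of_dvd_one h), by simp⟩

lemma OrdGE.t_pow (n : ℕ) : OrdGE n (t ^ n) :=
  ⟨1, 1, fun h => prime_X0.not_isUnit (isUnit_of_dvd_one h), by simp⟩

/-- Every scalar has a pole of finite order at `t = 0`. -/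
lemma exists_ordGE_t_pow_mul (c : K) : ∃ N : ℕ, OrdGE 0 (t ^ N * c) := by
  obtain ⟨A, B, hB, rfl⟩ := IsFractionRing.div_surjective (A := R) c
  have hB0 : B ≠ 0 := nonZeroDivisors.ne_zero hB
  obtain ⟨B', hBB, hB'⟩ :=
    (FiniteMultiplicity.of_prime_left prime_X0 hB0).exists_eq_pow_mul_and_not_dvd
  generalize multiplicity (MvPolynomial.X 0) B = N at hBB
  subst hBB
  refine ⟨N, A, B', hB', ?_⟩
  have h1 := algebraMap_ne_zero_of_not_dvd hB'
  have h2 := pow_ne_zero N t_ne_zero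
  rw [map_mul, map_pow, algebraMap_X0]
  field_simp

lemma OrdGE.eq_zero {c : K} (h : ∀ n, OrdGE n c) : c = 0 := by
  by_contra hc
  obtain ⟨A, B, hB, rfl⟩ := IsFractionRing.div_surjective (A := R) c
  have hB0 : B ≠ 0 := nonZeroDivisors.ne_zero hB
  have hB1 : algebraMap R K B ≠ 0 := by simpa using hB0
  have hA : A ≠ 0 := by rintro rfl; simp at hc
  obtain ⟨A', hAA, hA'⟩ :=
    (FiniteMultiplicity.of_prime_left prime_X0 hA).exists_eq_pow_mul_and_not_dvd
  generalize multiplicity (MvPolynomial.X 0) A = N at hAA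
  subst hAA
  obtain ⟨C, D, hD, hCD⟩ := h (N + 1)
  have hD1 := algebraMap_ne_zero_of_not_dvd hD
  rw [div_eq_div_iff hB1 hD1, map_mul, map_pow, algebraMap_X0, pow_succ] at hCD
  have h3 : algebraMap R K (A' * D) = algebraMap R K (MvPolynomial.X 0 * (C * B)) := by
    rw [map_mul, map_mul, map_mul, algebraMap_X0]
    apply mul_left_cancel₀ (pow_ne_zero N t_ne_zero)
    linear_combination hCD
  have h4 := FaithfulSMul.algebraMap_injective R K h3
  exact not_dvd_mul_X0 hA' hD ⟨_, h4⟩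

lemma ScalarTendsTo.const (c : K) : ScalarTendsTo (fun _ => c) c := fun n =>
  .of_forall fun _ => by simpa using OrdGE.zero n

lemma ScalarTendsTo.add {a b : ℕ → K} {l m : K} (ha : ScalarTendsTo a l)
    (hb : ScalarTendsTo b m) : ScalarTendsTo (fun k => a k + b k) (l + m) := fun n => by
  filter_upwards [ha n, hb n] with k h1 h2
  rw [add_sub_add_comm]
  exact h1.add h2

lemma OrdGE.eventually_const_mul {c : ℕ → K} (hc : ∀ n, ∀ᶠ k in atTop, OrdGE n (c k)) (b : K)
    (n : ℕ) : ∀ᶠ k in atTop, OrdGE n (b * c k) := by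
  obtain ⟨N, hN⟩ := exists_ordGE_t_pow_mul b
  filter_upwards [hc (n + N)] with k hk
  obtain ⟨A, B, hB, h1⟩ := hN
  obtain ⟨C, D, hD, h2⟩ := hk
  refine ⟨A * C, B * D, not_dvd_mul_X0 hB hD, ?_⟩
  apply mul_left_cancel₀ (pow_ne_zero N t_ne_zero)
  rw [← mul_assoc, h1, h2, map_mul, map_mul, pow_add]
  ring

lemma ScalarTendsTo.mul {a b : ℕ → K} {l m : K} (ha : ScalarTendsTo a l)
    (hb : ScalarTendsTo b m) : ScalarTendsTo (fun k => a k * b k) (l * m) := fun n => by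
  filter_upwards [ha n, hb n, OrdGE.eventually_const_mul ha m n,
    OrdGE.eventually_const_mul hb l n] with k h1 h2 h3 h4
  have : a k * b k - l * m = (a k - l) * (b k - m) + m * (a k - l) + l * (b k - m) := by ring
  rw [this]
  exact (((h1.mul h2).mono (by omega)).add h3).add h4

lemma ScalarTendsTo.congr {a b : ℕ → K} {l : K} (ha : ScalarTendsTo a l)
    (h : ∀ᶠ k in atTop, a k = b k) : ScalarTendsTo b l := fun n => by
  filter_upwards [ha n, h] with k h1 h2
  rwa [← h2]

lemma ScalarTendsTo.unique {a : ℕ → K} {l m : K} (hl : ScalarTendsTo a l)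
    (hm : ScalarTendsTo a m) : l = m := by
  rw [← sub_eq_zero]
  refine OrdGE.eq_zero fun n => ?_
  have h := (ScalarTendsTo.const (-1)).mul hl
  obtain ⟨k, h1, h2⟩ := ((hm n).and (h n)).exists
  have : l - m = (a k - m) + (-1 * a k - -1 * l) := by ring
  rw [this]
  exact h1.add h2

lemma ScalarTendsTo.t_pow : ScalarTendsTo (fun k => t ^ k) 0 := fun n => by
  filter_upwards [eventually_ge_atTop n] with k hk
  rw [sub_zero]
  exact (OrdGE.t_pow k).mono hk

/-! ### Sequences of polynomials -/

/-- The variable with index `i` in `𝒫ₖ⁺`, set to `0` for `i ≥ k`. -/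
def var (k i : ℕ) : P k := if h : i < k then MvPolynomial.X ⟨i, h⟩ else 0

lemma var_of_lt {k i : ℕ} (h : i < k) : var k i = MvPolynomial.X ⟨i, h⟩ := dif_pos h

lemma var_of_le {k i : ℕ} (h : k ≤ i) : var k i = 0 := dif_neg (by omega)

@[simp] lemma var_fin {k : ℕ} (i : Fin k) : var k i = MvPolynomial.X i := dif_pos i.2

lemma var_ne_zero {k i : ℕ} (h : i < k) : var k i ≠ 0 := by
  rw [var_of_lt h]; exact MvPolynomial.X_ne_zero _

/-- The substitution `x_i ↦ c i`, with values in an arbitrary algebra. -/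
def subst {A : Type*} [CommRing A] [Algebra K A] (c : ℕ → A) (k : ℕ) : P k →ₐ[K] A :=
  MvPolynomial.aeval fun i : Fin k => c i

section subst
variable {A B : Type*} [CommRing A] [Algebra K A] [CommRing B] [Algebra K B]

@[simp] lemma subst_X (c : ℕ → A) (k : ℕ) (i : Fin k) :
    subst c k (MvPolynomial.X i) = c i := by
  simp [subst]

lemma subst_var (c : ℕ → A) {k i : ℕ} (h : i < k) : subst c k (var k i) = c i := by
  rw [var_of_lt h, subst_X]

lemma comp_subst (φ : A →ₐ[K] B) (c : ℕ → A) (k : ℕ) (f : P k) :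
    φ (subst c k f) = subst (fun i => φ (c i)) k f := by
  have : φ.comp (subst c k) = subst (fun i => φ (c i)) k := by
    ext i; simp
  exact DFunLike.congr_fun this f

lemma subst_congr {c c' : ℕ → A} {k : ℕ} (h : ∀ i < k, c i = c' i) (f : P k) :
    subst c k f = subst c' k f := by
  have : subst c k = subst c' k := by
    ext i; simp [h i i.2]
  rw [this]

end subst

lemma subst_var_self (k : ℕ) (f : P k) : subst (var k) k f = f := by
  have : subst (var k) k = AlgHom.id K (P k) := by
    ext i; simp
  rw [this]; rfl

/-- Two algebra morphisms out of `𝒫ₙ⁺` that agree on the variables agree. -/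
lemma algHom_apply_eq {A : Type*} [CommRing A] [Algebra K A] {n : ℕ} {φ ψ : P n →ₐ[K] A}
    (h : ∀ i, i < n → φ (var n i) = ψ (var n i)) (f : P n) : φ f = ψ f := by
  have : φ = ψ := by
    ext i
    simpa using h i i.2
  rw [this]

/-- The morphism `𝒫_N⁺ → 𝒫ₙ⁺` that kills the variables with index at least `n`; for `N ≤ n` it is
the inclusion. -/
def projTo (N n : ℕ) : P N →ₐ[K] P n := subst (var n) N

lemma projTo_var {N n i : ℕ} (h : i < N) : projTo N n (var N i) = var n i := subst_var _ h

lemma projTo_self (n : ℕ) (f : P n) : projTo n n f = f := subst_var_self n f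

lemma proj_eq_projTo (k : ℕ) (f : P (k + 1)) : proj k f = projTo (k + 1) k f := rfl

lemma proj_var (k i : ℕ) : proj k (var (k + 1) i) = var k i := by
  rcases lt_or_ge i (k + 1) with h | h
  · exact projTo_var h
  · rw [var_of_le h, var_of_le (by omega), map_zero]

lemma projTo_projTo {M N n : ℕ} (h : n ≤ N ∨ M ≤ N) (f : P M) :
    projTo N n (projTo M N f) = projTo M n f := by
  rw [projTo, projTo, projTo, comp_subst]
  refine subst_congr (fun i hi => ?_) f
  rcases lt_or_ge i N with h' | h'
  · exact subst_var _ h'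
  · rw [var_of_le h', var_of_le (by omega), map_zero]

lemma subst_succ {A : Type*} [CommRing A] [Algebra K A] {c : ℕ → A} {n : ℕ} (h : c n = 0)
    (f : P (n + 1)) : subst c (n + 1) f = subst c n (proj n f) := by
  rw [proj_eq_projTo, projTo, comp_subst]
  refine subst_congr (fun i hi => ?_) f
  rcases lt_or_ge i n with h' | h'
  · rw [subst_var _ h']
  · obtain rfl : i = n := by omega
    rw [var_of_le le_rfl, map_zero, h]

/-- For a compatible sequence, `F n` is the image of `F N` for all `N ≥ n`. -/
lemma projTo_apply {F : ∀ k, P k} {k₀ : ℕ} (hF : ∀ k, k₀ ≤ k → proj k (F (k + 1)) = F k)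
    {n N : ℕ} (h0 : k₀ ≤ n) (h : n ≤ N) : projTo N n (F N) = F n := by
  induction N, h using Nat.le_induction with
  | base => exact projTo_self n _
  | succ N hN ih =>
    rw [← ih, ← hF N (h0.trans hN), proj_eq_projTo, projTo_projTo (Or.inl hN)]

lemma totalDegree_subst_le {n k : ℕ} (c : ℕ → P k) (hc : ∀ i, (c i).totalDegree ≤ 1) (f : P n) :
    (subst c n f).totalDegree ≤ f.totalDegree := by
  rw [subst, MvPolynomial.aeval_def, MvPolynomial.eval₂_eq]
  refine MvPolynomial.totalDegree_finsetSum_le fun d hd => ?_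
  refine (MvPolynomial.totalDegree_mul _ _).trans ?_
  rw [MvPolynomial.algebraMap_eq, MvPolynomial.totalDegree_C, zero_add]
  refine (MvPolynomial.totalDegree_finsetProd _ _).trans ?_
  refine le_trans (Finset.sum_le_sum (g := fun i => d i) fun i _ => ?_) ?_
  · exact (MvPolynomial.totalDegree_pow _ _).trans (by nlinarith [hc i])
  · have := MvPolynomial.le_totalDegree hd
    exact this

lemma totalDegree_var_le (k i : ℕ) : (var k i).totalDegree ≤ 1 := by
  unfold var
  split_ifs
  · simp
  · simp

lemma totalDegree_projTo_le (N n : ℕ) (f : P N) : (projTo N n f).totalDegree ≤ f.totalDegree :=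
  totalDegree_subst_le _ (totalDegree_var_le n) f

lemma simpleRefl_var {k j : ℕ} (h : j + 1 < k) (i : ℕ) :
    simpleRefl k j h (var k i) = var k (Equiv.swap j (j + 1) i) := by
  rcases lt_or_ge i k with hi | hi
  · have h' : Equiv.swap j (j + 1) i < k := by
      rw [Equiv.swap_apply_def]; split_ifs <;> omega
    rw [var_of_lt hi, var_of_lt h', simpleRefl, MvPolynomial.rename_X]
    congr 1
    ext
    simp only [Equiv.swap_apply_def, Fin.ext_iff]
    split_ifs <;> rfl
  · rw [var_of_le hi, map_zero, Equiv.swap_apply_of_ne_of_ne (by omega) (by omega), var_of_le hi]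

lemma simpleRefl_simpleRefl {k j : ℕ} (h : j + 1 < k) (f : P k) :
    simpleRefl k j h (simpleRefl k j h f) = f := by
  have : ((simpleRefl k j h).comp (simpleRefl k j h)) f = AlgHom.id K _ f :=
    algHom_apply_eq (fun i hi => by simp [simpleRefl_var]) f
  exact this

lemma projTo_simpleRefl {N n j : ℕ} (h : j + 1 < n) (h' : j + 1 < N) (f : P N) :
    projTo N n (simpleRefl N j h' f) = simpleRefl n j h (projTo N n f) := by
  refine algHom_apply_eq (φ := (projTo N n).comp (simpleRefl N j h'))
    (ψ := (simpleRefl n j h).comp (projTo N n)) (fun i hi => ?_) f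
  simp only [AlgHom.comp_apply]
  rw [projTo_var hi, simpleRefl_var, simpleRefl_var, projTo_var]
  rw [Equiv.swap_apply_def]; split_ifs <;> omega

/-- A sequence that is compatible from index `k₀` on, corrected below `k₀` so as to be compatible
everywhere. -/
def lowExt (k₀ : ℕ) (f : ∀ k, P k) : ∀ k, P k := fun k => projTo (k + k₀) k (f (k + k₀))

lemma lowExt_apply {k₀ : ℕ} {f : ∀ k, P k} (hf : ∀ k, k₀ ≤ k → proj k (f (k + 1)) = f k) {k : ℕ}
    (hk : k₀ ≤ k) : lowExt k₀ f k = f k :=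
  projTo_apply hf hk (by omega)

/-- Sufficient conditions, involving only large indices, for a sequence to define an almost
symmetric function. -/
lemma lowExt_mem_Plevel {k₀ m d : ℕ} {f : ∀ k, P k}
    (hf : ∀ k, k₀ ≤ k → proj k (f (k + 1)) = f k)
    (hd : ∀ k, k₀ ≤ k → (f k).totalDegree ≤ d)
    (hs : ∀ j, m ≤ j → ∀ k, k₀ ≤ k → ∀ h : j + 1 < k, simpleRefl k j h (f k) = f k) :
    lowExt k₀ f ∈ Plevel m := by
  refine ⟨⟨fun k => ?_, d, fun k => ?_⟩, fun j hj k h => ?_⟩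
  · rw [lowExt, lowExt, proj_eq_projTo, projTo_projTo (Or.inl (by omega)),
      ← projTo_apply hf (show k₀ ≤ k + k₀ by omega) (show k + k₀ ≤ k + 1 + k₀ by omega),
      projTo_projTo (Or.inl (by omega))]
  · exact (totalDegree_projTo_le _ _ _).trans (hd _ (by omega))
  · rw [lowExt, ← projTo_simpleRefl h (by omega), hs j hj _ (by omega)]

lemma Pas_proj (F : Pas) (k : ℕ) : proj k (F.1 (k + 1)) = F.1 k := F.2.choose_spec.1.1 k

lemma Pas_projTo (F : Pas) {n N : ℕ} (h : n ≤ N) : projTo N n (F.1 N) = F.1 n :=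
  projTo_apply (k₀ := 0) (fun k _ => Pas_proj F k) (Nat.zero_le _) h

lemma Pas_degree (F : Pas) : ∃ d : ℕ, ∀ k, (F.1 k).totalDegree ≤ d := F.2.choose_spec.1.2

lemma Pas_symm (F : Pas) : ∃ m, ∀ j, m ≤ j → ∀ k (h : j + 1 < k),
    simpleRefl k j h (F.1 k) = F.1 k := ⟨_, F.2.choose_spec.2⟩

lemma Plevel_le_Pas (m : ℕ) : Plevel m ≤ Pas := fun _ h => ⟨m, h⟩

/-- Elements of `𝒫_∞⁺` that agree for large indices agree. -/
lemma Pas_ext_of_ge {F G : Pas} (k₀ : ℕ) (h : ∀ k, k₀ ≤ k → F.1 k = G.1 k) : F = G := by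
  refine Subtype.ext (funext fun k => ?_)
  rw [← Pas_projTo F (show k ≤ k + k₀ by omega), ← Pas_projTo G (show k ≤ k + k₀ by omega),
    h _ (by omega)]

/-! ### Demazure-Lusztig operators on polynomials -/

section opT
variable {k j : ℕ}

lemma var_sub_var_ne_zero {i j : ℕ} (hi : i < k) (hj : j < k) (hij : i ≠ j) :
    var k i - var k j ≠ 0 := by
  rw [var_of_lt hi, var_of_lt hj]
  exact X_sub_X_ne_zero (by simpa [Fin.ext_iff] using hij)

/-- The Demazure-Lusztig operator, with the denominator cleared. -/
lemma opT_spec (h : j + 1 < k) (f : P k) :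
    (var k j - var k (j + 1)) * opT k j f =
      C (1 - t) * var k j * f + (C t * var k j - var k (j + 1)) * simpleRefl k j h f := by
  have hab : (⟨j, Nat.lt_of_succ_lt h⟩ : Fin k) ≠ ⟨j + 1, h⟩ := by simp
  have h2 := divDiff_spec _ _ hab f
  have h1 : opT k j f = simpleRefl k j h f +
      C (1 - t) * (var k j * divDiff _ _ hab f) := by
    simp only [opT, dif_pos h, LinearMap.add_apply, LinearMap.smul_apply,
      MvPolynomial.smul_eq_C_mul, var_of_lt (Nat.lt_of_succ_lt h)]
    rfl
  change _ = f - simpleRefl k j h f at h2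
  rw [← var_of_lt, ← var_of_lt] at h2
  rw [h1]
  simp only [map_sub, map_one]
  linear_combination (1 - C t) * var k j * h2

/-- The inverse of the Demazure-Lusztig operator, with the denominator cleared. -/
lemma opTinv_spec (h : j + 1 < k) (f : P k) :
    C t * (var k j - var k (j + 1)) * opTinv k j f =
      C (1 - t) * var k (j + 1) * f + (C t * var k j - var k (j + 1)) * simpleRefl k j h f := by
  have h1 : C t * opTinv k j f = opT k j f + C (t - 1) * f := by
    have : opTinv k j f = t⁻¹ • (opT k j f + (t - 1) • f) := rfl
    rw [this, ← MvPolynomial.smul_eq_C_mul, ← MvPolynomial.smul_eq_C_mul, smul_smul,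
      mul_inv_cancel₀ t_ne_zero, one_smul]
  have h2 := opT_spec h f
  simp only [map_sub, map_one] at h1 h2 ⊢
  linear_combination (var k j - var k (j + 1)) * h1 + h2

lemma opT_eq_of_spec (h : j + 1 < k) {f g : P k}
    (hg : (var k j - var k (j + 1)) * g =
      C (1 - t) * var k j * f + (C t * var k j - var k (j + 1)) * simpleRefl k j h f) :
    opT k j f = g :=
  mul_left_cancel₀ (var_sub_var_ne_zero (by omega) h (by omega)) ((opT_spec h f).trans hg.symm)

/-- Morphisms that transport one pair of neighbouring variables to another intertwine the
Demazure-Lusztig operators. -/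
lemma map_opT {k' j' : ℕ} (h : j + 1 < k) (h' : j' + 1 < k') (φ : P k →ₐ[K] P k')
    (h0 : φ (var k j) = var k' j') (h1 : φ (var k (j + 1)) = var k' (j' + 1))
    (hs : ∀ f, φ (simpleRefl k j h f) = simpleRefl k' j' h' (φ f)) (f : P k) :
    φ (opT k j f) = opT k' j' (φ f) := by
  refine (opT_eq_of_spec h' ?_).symm
  have hC : ∀ c : K, φ (C c) = C c := fun c => φ.commutes c
  have := congrArg φ (opT_spec h f)
  simpa only [map_mul, map_sub, map_add, h0, h1, hs, hC] using this

lemma map_opTinv {k' j' : ℕ} {φ : P k →ₗ[K] P k'} {f : P k}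
    (H : φ (opT k j f) = opT k' j' (φ f)) :
    φ (opTinv k j f) = opTinv k' j' (φ f) := by
  change φ (t⁻¹ • (opT k j f + (t - 1) • f)) = t⁻¹ • (opT k' j' (φ f) + (t - 1) • φ f)
  rw [map_smul, map_add, map_smul, H]

lemma opT_opTinv (f : P k) : opT k j (opTinv k j f) = f :=
  DFunLike.congr_fun (opT_mul_opTinv k j) f

lemma opTinv_opT (f : P k) : opTinv k j (opT k j f) = f :=
  DFunLike.congr_fun (opTinv_mul_opT k j) f

lemma opTinv_eq_self {f : P k} (h : opT k j f = f) : opTinv k j f = f := by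
  conv_lhs => rw [← h]
  exact opTinv_opT f

/-- The invariants of the Demazure-Lusztig operator are those of the transposition. -/
lemma opT_eq_self_iff (h : j + 1 < k) (f : P k) :
    opT k j f = f ↔ simpleRefl k j h f = f := by
  constructor
  · intro hf
    have h1 := opT_spec h f
    rw [hf] at h1
    simp only [map_sub, map_one] at h1
    have h2 : (C t * var k j - var k (j + 1)) * (simpleRefl k j h f) =
        (C t * var k j - var k (j + 1)) * f := by linear_combination -h1
    refine mul_left_cancel₀ (fun h0 => ?_) h2
    -- setting the variable with index `j` to `0` shows that the factor is nonzero
    have h3 := congrArg (subst (fun i => if i = j then 0 else var k i) k) h0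
    rw [map_sub, map_mul, subst_var _ (by omega), subst_var _ h, if_pos rfl, if_neg (by omega),
      mul_zero, zero_sub, map_zero, neg_eq_zero] at h3
    exact var_ne_zero h h3
  · intro hf
    refine opT_eq_of_spec h ?_
    rw [hf]
    simp only [map_sub, map_one]
    ring

lemma opT_mul_of_symm (h : j + 1 < k) {e : P k} (he : simpleRefl k j h e = e) (f : P k) :
    opT k j (e * f) = e * opT k j f := by
  refine opT_eq_of_spec h ?_
  rw [map_mul, he]
  linear_combination e * opT_spec h f

lemma projTo_opT {N n : ℕ} (h : j + 1 < n) (h' : j + 1 < N) (f : P N) :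
    projTo N n (opT N j f) = opT n j (projTo N n f) :=
  map_opT h' h (projTo N n) (projTo_var (by omega)) (projTo_var h')
    (projTo_simpleRefl h h') f

lemma proj_opT (h : j + 1 < k) (f : P (k + 1)) :
    proj k (opT (k + 1) j f) = opT k j (proj k f) := projTo_opT h (by omega) f

lemma proj_opTinv (h : j + 1 < k) (f : P (k + 1)) :
    proj k (opTinv (k + 1) j f) = opTinv k j (proj k f) :=
  map_opTinv (φ := (proj k).toLinearMap) (proj_opT h f)

lemma simpleRefl_comm {i : ℕ} (hi : i + 1 < k) (hj : j + 1 < k) (hij : i + 1 < j ∨ j + 1 < i)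
    (f : P k) : simpleRefl k i hi (simpleRefl k j hj f) =
      simpleRefl k j hj (simpleRefl k i hi f) := by
  refine algHom_apply_eq (φ := (simpleRefl k i hi).comp (simpleRefl k j hj))
    (ψ := (simpleRefl k j hj).comp (simpleRefl k i hi)) (fun n hn => ?_) f
  simp only [AlgHom.comp_apply, simpleRefl_var]
  congr 1
  simp only [Equiv.swap_apply_def]
  split_ifs <;> omega

lemma simpleRefl_opT {i : ℕ} (hi : i + 1 < k) (hj : j + 1 < k) (hij : i + 1 < j ∨ j + 1 < i)
    (f : P k) : simpleRefl k i hi (opT k j f) = opT k j (simpleRefl k i hi f) := by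
  refine map_opT hj hj (simpleRefl k i hi) ?_ ?_ (simpleRefl_comm hi hj hij) f
  · rw [simpleRefl_var, Equiv.swap_apply_of_ne_of_ne (by omega) (by omega)]
  · rw [simpleRefl_var, Equiv.swap_apply_of_ne_of_ne (by omega) (by omega)]

lemma totalDegree_simpleRefl_le (h : j + 1 < k) (f : P k) :
    (simpleRefl k j h f).totalDegree ≤ f.totalDegree := MvPolynomial.totalDegree_rename_le _ _

lemma totalDegree_var_mul {i : ℕ} (hi : i < k) {f : P k} (hf : f ≠ 0) :
    (var k i * f).totalDegree = f.totalDegree + 1 := by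
  rw [MvPolynomial.totalDegree_mul_of_isDomain (var_ne_zero hi) hf, var_of_lt hi,
    MvPolynomial.totalDegree_X, add_comm]

lemma totalDegree_opT_le (f : P k) : (opT k j f).totalDegree ≤ f.totalDegree := by
  by_cases h : j + 1 < k
  swap
  · simp [opT, h]
  by_cases h0 : opT k j f = 0
  · simp [h0]
  have h1 : (var k j - var k (j + 1)).totalDegree = 1 := by
    have hne := var_sub_var_ne_zero (show j < k by omega) h (by omega)
    apply MvPolynomial.IsHomogeneous.totalDegree _ hne
    rw [var_of_lt h, var_of_lt (show j < k by omega)]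
    exact (MvPolynomial.isHomogeneous_X _ _).sub (MvPolynomial.isHomogeneous_X _ _)
  have h2 := MvPolynomial.totalDegree_mul_of_isDomain
    (var_sub_var_ne_zero (show j < k by omega) h (by omega)) h0
  rw [h1, opT_spec h] at h2
  have h3 : ∀ c : K, ∀ i, (C c * var k i).totalDegree ≤ 1 := fun c i => by
    refine (MvPolynomial.totalDegree_mul _ _).trans ?_
    simpa using totalDegree_var_le k i
  have h4 : (C (1 - t) * var k j * f +
      (C t * var k j - var k (j + 1)) * simpleRefl k j h f).totalDegree ≤ 1 + f.totalDegree := by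
    refine (MvPolynomial.totalDegree_add _ _).trans (max_le ?_ ?_)
    · exact (MvPolynomial.totalDegree_mul _ _).trans (Nat.add_le_add_right (h3 _ _) _)
    · refine (MvPolynomial.totalDegree_mul _ _).trans
        (Nat.add_le_add ?_ (totalDegree_simpleRefl_le h f))
      exact (MvPolynomial.totalDegree_sub _ _).trans (max_le (h3 _ _) (totalDegree_var_le _ _))
  omega

lemma totalDegree_opTinv_le (f : P k) : (opTinv k j f).totalDegree ≤ f.totalDegree := by
  refine (MvPolynomial.totalDegree_smul_le _ _).trans ?_
  refine (MvPolynomial.totalDegree_add _ _).trans (max_le (totalDegree_opT_le f) ?_)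
  exact MvPolynomial.totalDegree_smul_le _ _


lemma opX_apply (i : ℕ) (f : P k) : opX k i f = var k i * f := by
  unfold opX var
  split_ifs
  · rfl
  · simp

lemma subst_simpleRefl {A : Type*} [CommRing A] [Algebra K A] (c : ℕ → A) (h : j + 1 < k)
    (f : P k) : subst c k (simpleRefl k j h f) =
      subst (fun i => c (Equiv.swap j (j + 1) i)) k f := by
  refine algHom_apply_eq (φ := (subst c k).comp (simpleRefl k j h)) (fun i hi => ?_) f
  have h' : Equiv.swap j (j + 1) i < k := by
    rw [Equiv.swap_apply_def]; split_ifs <;> omega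
  rw [AlgHom.comp_apply, simpleRefl_var, subst_var _ h', subst_var _ hi]

/-! ### Divisibility by variables -/

/-- Two morphisms that agree modulo `d` on the constants and on the variables agree modulo `d`. -/
lemma dvd_map_sub_map {S σ A : Type*} [CommRing S] [CommRing A] {φ ψ : MvPolynomial σ S →+* A}
    {d : A} (hC : ∀ c, d ∣ φ (C c) - ψ (C c))
    (hX : ∀ i, d ∣ φ (MvPolynomial.X i) - ψ (MvPolynomial.X i)) (f : MvPolynomial σ S) :
    d ∣ φ f - ψ f := by
  induction f using MvPolynomial.induction_on with
  | C c => exact hC c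
  | add f g hf hg =>
    rw [map_add, map_add, add_sub_add_comm]
    exact dvd_add hf hg
  | mul_X f i hf =>
    rw [map_mul, map_mul, show ∀ a b c d : A, a * b - c * d = (a - c) * b + c * (b - d) by
      intros; ring]
    exact dvd_add (hf.mul_right _) ((hX i).mul_left _)

lemma dvd_sub_of_dvd_var {A : Type*} [CommRing A] [Algebra K A] {φ ψ : P k →ₐ[K] A} {d : A}
    (h : ∀ i, i < k → d ∣ φ (var k i) - ψ (var k i)) (f : P k) : d ∣ φ f - ψ f := by
  refine dvd_map_sub_map (φ := φ.toRingHom) (ψ := ψ.toRingHom) (fun c => ?_) (fun i => ?_) f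
  · have h1 : φ (C c) = algebraMap K A c := φ.commutes c
    have h2 : ψ (C c) = algebraMap K A c := ψ.commutes c
    change d ∣ φ (C c) - ψ (C c)
    rw [h1, h2, sub_self]
    exact dvd_zero d
  · have h1 := h i i.2
    rwa [var_fin] at h1

/-- The substitution `x_i ↦ 0`. -/
def kill (k i : ℕ) : P k →ₐ[K] P k := subst (fun l => if l = i then 0 else var k l) k

lemma kill_var {i l : ℕ} (hl : l < k) : kill k i (var k l) = if l = i then 0 else var k l :=
  subst_var _ hl

lemma var_dvd_iff {i : ℕ} (hi : i < k) (f : P k) : var k i ∣ f ↔ kill k i f = 0 := by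
  constructor
  · rintro ⟨g, rfl⟩
    rw [map_mul, kill_var hi, if_pos rfl, zero_mul]
  · intro h
    have h1 : var k i ∣ AlgHom.id K _ f - kill k i f := by
      refine dvd_sub_of_dvd_var (fun l hl => ?_) f
      rw [kill_var hl]
      split_ifs with h
      · simp [h]
      · simp
    simpa [h] using h1

lemma prime_var {i : ℕ} (hi : i < k) : Prime (var k i) := by
  rw [var_of_lt hi]; exact MvPolynomial.X_prime

lemma not_var_dvd_var {i l : ℕ} (hi : i < k) (hl : l < k) (h : l ≠ i) : ¬ var k i ∣ var k l := by
  rw [var_dvd_iff hi, kill_var hl, if_neg h]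
  exact var_ne_zero hl

lemma C_t_ne_zero : (C t : P k) ≠ 0 := by simpa using t_ne_zero

lemma var_dvd_opTinv_succ (h : j + 1 < k) {f : P k} (hf : var k j ∣ f) :
    var k (j + 1) ∣ opTinv k j f := by
  rw [var_dvd_iff h]
  have h1 := congrArg (kill k (j + 1)) (opTinv_spec h f)
  have h2 : kill k (j + 1) (simpleRefl k j h f) = 0 := by
    obtain ⟨g, rfl⟩ := hf
    rw [map_mul, simpleRefl_var, Equiv.swap_apply_left, map_mul, kill_var h, if_pos rfl, zero_mul]
  have hC : ∀ c : K, kill k (j + 1) (C c) = C c := fun c => (kill k (j + 1)).commutes c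
  simp only [map_mul, map_add, map_sub (kill k (j + 1)), h2, kill_var h,
    kill_var (show j < k by omega), hC,
    if_true, if_neg (show j ≠ j + 1 by omega), mul_zero, zero_mul, add_zero, sub_zero] at h1
  have h3 := mul_ne_zero C_t_ne_zero (var_ne_zero (show j < k by omega))
  exact (mul_eq_zero.mp h1).resolve_left h3

lemma opTinv_mul_of_symm (h : j + 1 < k) {e : P k} (he : simpleRefl k j h e = e) (f : P k) :
    opTinv k j (e * f) = e * opTinv k j f := by
  conv_lhs => rw [← opT_opTinv (j := j) f, ← opT_mul_of_symm h he]
  exact opTinv_opT _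

lemma simpleRefl_var_of_ne (h : j + 1 < k) {i : ℕ} (h0 : i ≠ j) (h1 : i ≠ j + 1) :
    simpleRefl k j h (var k i) = var k i := by
  rw [simpleRefl_var, Equiv.swap_apply_of_ne_of_ne h0 h1]

/-- The Hecke operators and their inverses preserve divisibility by a variable that they do not
involve, or by both variables that they involve. -/
lemma var_dvd_opT (h : j + 1 < k) {f : P k} {i : ℕ} (hi : var k i ∣ f)
    (hj : i = j ∨ i = j + 1 → var k j ∣ f ∧ var k (j + 1) ∣ f) :
    var k i ∣ opT k j f ∧ var k i ∣ opTinv k j f := by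
  by_cases hij : i = j ∨ i = j + 1
  · obtain ⟨⟨g, rfl⟩, h1⟩ := hj hij
    obtain ⟨g, rfl⟩ := ((prime_var h).dvd_or_dvd h1).resolve_left
      (not_var_dvd_var h (by omega) (by omega))
    have he : simpleRefl k j h (var k j * var k (j + 1)) = var k j * var k (j + 1) := by
      rw [map_mul, simpleRefl_var, simpleRefl_var, Equiv.swap_apply_left, Equiv.swap_apply_right,
        mul_comm]
    have hd : var k i ∣ var k j * var k (j + 1) := by
      rcases hij with rfl | rfl
      · exact dvd_mul_right _ _
      · exact dvd_mul_left _ _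
    rw [← mul_assoc, opT_mul_of_symm h he, opTinv_mul_of_symm h he]
    exact ⟨hd.mul_right _, hd.mul_right _⟩
  · obtain ⟨g, rfl⟩ := hi
    have he := simpleRefl_var_of_ne h (show i ≠ j by tauto) (by tauto)
    rw [opT_mul_of_symm h he, opTinv_mul_of_symm h he]
    exact ⟨dvd_mul_right _ _, dvd_mul_right _ _⟩

end opT

/-! ### The Cherednik operators on polynomials -/

section opY
variable {k : ℕ}

lemma rotate_var {i : ℕ} (h : i + 1 < k) : rotate k (var k i) = var k (i + 1) := by
  rw [var_of_lt (Nat.lt_of_succ_lt h), var_of_lt h]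
  simp [rotate, h]

lemma rotate_var_last {n : ℕ} : rotate (n + 1) (var (n + 1) n) = C q * var (n + 1) 0 := by
  rw [var_of_lt (Nat.lt_succ_self n), var_of_lt (Nat.succ_pos n)]
  simp [rotate]

lemma rotate_eq_subst (f : P k) :
    rotate k f = subst (fun i => if i + 1 < k then var k (i + 1) else C q * var k 0) k f := by
  refine algHom_apply_eq (fun i hi => ?_) f
  rw [subst_var _ hi]
  split_ifs with h
  · exact rotate_var h
  · obtain rfl : k = i + 1 := by omega
    exact rotate_var_last

lemma rotate_simpleRefl {j : ℕ} (h : j + 1 + 1 < k) (f : P k) :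
    rotate k (simpleRefl k j (by omega) f) = simpleRefl k (j + 1) h (rotate k f) := by
  simp only [rotate_eq_subst]
  rw [subst_simpleRefl, comp_subst]
  refine subst_congr (fun i hi => ?_) f
  have hC : ∀ c : K, simpleRefl k (j + 1) h (C c) = C c := fun c => (simpleRefl k _ h).commutes c
  simp only [apply_ite (simpleRefl k (j + 1) h), map_mul, simpleRefl_var, hC]
  by_cases h1 : i = j
  · subst h1
    rw [Equiv.swap_apply_left, Equiv.swap_apply_left, if_pos (by omega), if_pos (by omega)]
  by_cases h2 : i = j + 1
  · subst h2
    rw [Equiv.swap_apply_right, Equiv.swap_apply_right, if_pos (by omega), if_pos (by omega)]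
  rw [Equiv.swap_apply_of_ne_of_ne h1 h2, Equiv.swap_apply_of_ne_of_ne (by omega) (by omega),
    Equiv.swap_apply_of_ne_of_ne (by omega) (by omega)]

lemma totalDegree_rotate_le (f : P k) : (rotate k f).totalDegree ≤ f.totalDegree := by
  rw [rotate_eq_subst]
  refine totalDegree_subst_le _ (fun i => ?_) f
  split_ifs
  · exact totalDegree_var_le _ _
  · refine (MvPolynomial.totalDegree_mul _ _).trans ?_
    simpa using totalDegree_var_le k 0

/-- The operator `t^(k-j) T_{j-1} ⋯ T_0 w T_{k-2}⁻¹ ⋯ T_j⁻¹` (zero-based indices). -/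
def conjY (k : ℕ) (w : Module.End K (P k)) (j : ℕ) : Module.End K (P k) :=
  t ^ (k - j) • (((List.range j).reverse.map (opT k)).prod * w *
    ((List.range' j (k - 1 - j)).reverse.map (opTinv k)).prod)

lemma opYtilde_eq_conjY (k j : ℕ) : opYtilde k j = conjY k (varpi k) j := rfl

/-- The Cherednik operators of the polynomial representation of `ℋₖ`. -/
def opY (k j : ℕ) : Module.End K (P k) := conjY k (rotate k).toLinearMap j

/-- The product `T_{n-1}⁻¹ ⋯ T_0⁻¹`. -/
def downInv (k n : ℕ) : Module.End K (P k) := ((List.range n).reverse.map (opTinv k)).prod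

lemma downInv_succ (n : ℕ) (f : P k) : downInv k (n + 1) f = opTinv k n (downInv k n f) := by
  simp [downInv, List.range_succ]

@[simp] lemma downInv_zero (f : P k) : downInv k 0 f = f := rfl

lemma conjY_zero (w : Module.End K (P k)) (f : P k) :
    conjY k w 0 f = t ^ k • w (downInv k (k - 1) f) := by
  simp [conjY, downInv, List.range_eq_range']

lemma conjY_succ (w : Module.End K (P k)) {j : ℕ} (h : j + 1 < k) :
    conjY k w (j + 1) = t⁻¹ • (opT k j * conjY k w j * opT k j) := by
  have h1 : k - 1 - j = (k - 1 - (j + 1)) + 1 := by omega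
  have h2 : k - j = (k - (j + 1)) + 1 := by omega
  have h3 : opTinv k j * opT k j = 1 := opTinv_mul_opT k j
  unfold conjY
  rw [h1, h2, List.range'_succ, List.range_succ, pow_succ']
  simp only [List.reverse_append, List.map_cons, List.prod_cons, List.reverse_cons,
    List.reverse_nil, List.map_append, List.prod_append, List.map_nil, List.prod_nil, mul_one,
    one_mul, mul_smul_comm, smul_mul_assoc, smul_smul]
  rw [inv_mul_cancel_left₀ t_ne_zero]
  simp only [mul_assoc, h3, mul_one]

lemma opY_zero (f : P k) : opY k 0 f = t ^ k • rotate k (downInv k (k - 1) f) := conjY_zero _ f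

lemma opY_succ {j : ℕ} (h : j + 1 < k) :
    opY k (j + 1) = t⁻¹ • (opT k j * opY k j * opT k j) := conjY_succ _ h

lemma totalDegree_downInv_le (n : ℕ) (f : P k) :
    (downInv k n f).totalDegree ≤ f.totalDegree := by
  induction n with
  | zero => rfl
  | succ n ih => rw [downInv_succ]; exact (totalDegree_opTinv_le _).trans ih

lemma totalDegree_opY_zero_le (f : P k) : (opY k 0 f).totalDegree ≤ f.totalDegree := by
  rw [opY_zero]
  exact (MvPolynomial.totalDegree_smul_le _ _).trans
    ((totalDegree_rotate_le _).trans (totalDegree_downInv_le _ _))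

/-! ### Comparison of the Cherednik operators with their deformations -/

lemma pr₁_apply (f : P k) : pr₁ k f = f - kill k 0 f := by
  have : pr₁ k = LinearMap.id - (kill k 0).toLinearMap := by
    refine (MvPolynomial.basisMonomials (Fin k) K).ext fun m => ?_
    rw [pr₁, Module.Basis.constr_basis]
    simp only [MvPolynomial.coe_basisMonomials, LinearMap.sub_apply, LinearMap.id_apply,
      AlgHom.toLinearMap_apply]
    rw [kill, subst, MvPolynomial.aeval_monomial, map_one (algebraMap K (P k)), one_mul]
    split_ifs with h
    · obtain ⟨i, hi, hm⟩ := h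
      rw [Finsupp.prod, Finset.prod_eq_zero (Finsupp.mem_support_iff.mpr hm), sub_zero]
      rw [if_pos hi, zero_pow hm]
    · push Not at h
      rw [eq_comm, sub_eq_zero, MvPolynomial.monomial_eq, map_one MvPolynomial.C, one_mul]
      refine Finsupp.prod_congr fun i hi => ?_
      have : (i : ℕ) ≠ 0 := fun h0 => Finsupp.mem_support_iff.mp hi (h i h0)
      rw [if_neg this, var_fin]
  rw [this]; rfl

/-- The substitution `x_i ↦ x_{i+1}` for `i < j`, `x_j ↦ 0`, `x_i ↦ x_i` for `i > j`. -/
def shiftKill (k j : ℕ) : P k →ₐ[K] P k :=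
  subst (fun i => if i < j then var k (i + 1) else if i = j then 0 else var k i) k

/-- At `x_{j+1} = 0` the operator `T_j⁻¹` reduces to a transposition. -/
lemma shiftKill_opTinv {j : ℕ} (h : j + 1 < k) (f : P k) :
    shiftKill k (j + 1) (opTinv k j f) = shiftKill k j f := by
  have h1 := congrArg (shiftKill k (j + 1)) (opTinv_spec h f)
  have h2 : shiftKill k (j + 1) (simpleRefl k j h f) = shiftKill k j f := by
    rw [shiftKill, subst_simpleRefl, shiftKill]
    refine subst_congr (fun i hi => ?_) f
    by_cases h1 : i = j
    · subst h1
      rw [Equiv.swap_apply_left]; simp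
    by_cases h2 : i = j + 1
    · subst h2
      rw [Equiv.swap_apply_right]; simp
    rw [Equiv.swap_apply_of_ne_of_ne h1 h2]
    rcases lt_or_gt_of_ne h1 with h3 | h3
    · rw [if_pos (by omega), if_pos h3]
    · rw [if_neg (by omega), if_neg (by omega), if_neg (by omega), if_neg h1]
  have hC : ∀ c : K, shiftKill k (j + 1) (C c) = C c := fun c => (shiftKill k _).commutes c
  have h3 : shiftKill k (j + 1) (var k j) = var k (j + 1) := by
    rw [shiftKill, subst_var _ (by omega), if_pos (by omega)]
  have h4 : shiftKill k (j + 1) (var k (j + 1)) = 0 := by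
    rw [shiftKill, subst_var _ h, if_neg (by omega), if_pos rfl]
  simp only [map_mul, map_add, map_sub (shiftKill k (j + 1)), h2, h3, h4, hC, mul_zero, zero_mul,
    sub_zero, zero_add] at h1
  exact mul_left_cancel₀ (mul_ne_zero C_t_ne_zero (var_ne_zero h)) h1

lemma shiftKill_downInv {n : ℕ} (h : n < k) (f : P k) :
    shiftKill k n (downInv k n f) = shiftKill k 0 f := by
  induction n with
  | zero => rfl
  | succ n ih => rw [downInv_succ, shiftKill_opTinv h, ih (by omega)]

/-- The part of `f(x_1, …, x_{k-1}, q x_0)` that `pr₁` kills is obtained by setting `x_0 = 0`. -/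
lemma rotate_sub_varpi (f : P k) :
    rotate k f - varpi k f = shiftKill k (k - 1) f := by
  have h : varpi k f = pr₁ k (rotate k f) := rfl
  rw [h, pr₁_apply, sub_sub_cancel, rotate_eq_subst, comp_subst, shiftKill]
  refine subst_congr (fun i hi => ?_) f
  have hC : ∀ c : K, kill k 0 (C c) = C c := fun c => (kill k 0).commutes c
  split_ifs with h1 h2 h2 h3
  · rw [kill_var h1, if_neg (by omega)]
  · omega
  · omega
  · omega
  · rw [map_mul, kill_var (by omega), if_pos rfl, mul_zero]
  · omega

lemma shiftKill_zero_eq_kill (f : P k) : shiftKill k 0 f = kill k 0 f := by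
  refine subst_congr (fun i _ => ?_) f
  rw [if_neg (by omega)]

/-- The first Cherednik operator and its deformation differ by `t^k` times the substitution
`x_0 ↦ 0`. -/
lemma opY_zero_sub_opYtilde_zero (hk : 0 < k) (f : P k) :
    opY k 0 f - opYtilde k 0 f = t ^ k • kill k 0 f := by
  rw [opYtilde_eq_conjY, opY_zero, conjY_zero, ← smul_sub, rotate_sub_varpi,
    shiftKill_downInv (by omega), shiftKill_zero_eq_kill]

/-! ### Compatibility of the first Cherednik operators with the projections -/

/-- The operators `T_0⁻¹, …, T_{n-1}⁻¹` move one of the first `m` factors to the variable `x_n` and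
keep the others. -/
lemma var_dvd_downInv {f : P k} {m : ℕ} (hm : 0 < m) (h : ∀ i < m, var k i ∣ f) {n : ℕ}
    (hn : n < k) (hmn : m ≤ n + 1) : (∀ i, i + 1 < m → var k i ∣ downInv k n f) ∧
      var k n ∣ downInv k n f := by
  -- the operators `T_i⁻¹` with `i + 1 < m` keep all factors, the others move the last one
  have h1 : ∀ l, l < m → ∀ i, i < m → var k i ∣ downInv k l f := by
    intro l
    induction l with
    | zero => exact fun _ => h
    | succ l ih =>
      intro hl i hi
      rw [downInv_succ]
      exact (var_dvd_opT (by omega) (ih (by omega) i hi)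
        fun _ => ⟨ih (by omega) _ (by omega), ih (by omega) _ (by omega)⟩).2
  have h2 : m - 1 ≤ n := by omega
  clear hmn
  induction n, h2 using Nat.le_induction with
  | base => exact ⟨fun i hi => h1 _ (by omega) i (by omega), h1 _ (by omega) _ (by omega)⟩
  | succ n hle ih =>
    obtain ⟨ih1, ih2⟩ := ih (by omega)
    rw [downInv_succ]
    exact ⟨fun i hi => (var_dvd_opT hn (ih1 i hi) (by omega)).2, var_dvd_opTinv_succ hn ih2⟩

/-- The first Cherednik operator preserves divisibility by the product of the first variables. -/
lemma var_dvd_opY_zero {f : P k} {m : ℕ} (hm : 0 < m) (hmk : m ≤ k) (h : ∀ i < m, var k i ∣ f) :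
    ∀ i < m, var k i ∣ opY k 0 f := by
  intro i hi
  obtain ⟨h1, h2⟩ := var_dvd_downInv hm h (n := k - 1) (by omega) (by omega)
  rw [opY_zero, MvPolynomial.smul_eq_C_mul]
  refine Dvd.dvd.mul_left ?_ _
  cases i with
  | zero =>
    obtain ⟨n, rfl⟩ : ∃ n, k = n + 1 := ⟨k - 1, by omega⟩
    have := map_dvd (rotate (n + 1)) h2
    rw [Nat.add_sub_cancel, rotate_var_last] at this
    exact (dvd_mul_left _ _).trans this
  | succ i =>
    have := map_dvd (rotate k) (h1 i hi)
    rwa [rotate_var (by omega)] at this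

/-- The last factor `T_n⁻¹` and the rotation in `n + 2` variables become, up to `t⁻¹`, the rotation
in `n + 1` variables when the last variable is set to zero after the rotation. -/
lemma proj_rotate_opTinv {n : ℕ} {f : P (n + 1 + 1)} (hf : var _ n ∣ f) :
    proj (n + 1) (rotate (n + 1 + 1) (opTinv (n + 1 + 1) n f)) =
      t⁻¹ • rotate (n + 1) (proj (n + 1) f) := by
  obtain ⟨ψ, hψ⟩ : ∃ ψ : P (n + 1 + 1) →ₐ[K] P (n + 1),
      ∀ g, proj (n + 1) (rotate (n + 1 + 1) g) = ψ g :=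
    ⟨(proj (n + 1)).comp (rotate (n + 1 + 1)), fun _ => rfl⟩
  have hC : ∀ c : K, ψ (C c) = C c := fun c => ψ.commutes c
  have h0 : ψ (var _ n) = 0 := by
    rw [← hψ, rotate_var (by omega), proj_var, var_of_le le_rfl]
  have h1 : ψ (var _ (n + 1)) = C q * var _ 0 := by
    have : proj (n + 1) (C q) = C q := (proj (n + 1)).commutes q
    rw [← hψ, rotate_var_last, map_mul, proj_var, this]
  have h2 : ψ f = 0 := zero_dvd_iff.mp (h0 ▸ map_dvd ψ hf)
  have hn : n + 1 < n + 1 + 1 := Nat.lt_succ_self _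
  have h3 : ψ (simpleRefl (n + 1 + 1) n hn f) = rotate (n + 1) (proj (n + 1) f) := by
    refine algHom_apply_eq (φ := ψ.comp (simpleRefl (n + 1 + 1) n hn))
      (ψ := (rotate (n + 1)).comp (proj (n + 1))) (fun i hi => ?_) f
    rw [AlgHom.comp_apply, AlgHom.comp_apply, simpleRefl_var, proj_var]
    by_cases hi1 : i = n
    · subst hi1
      rw [Equiv.swap_apply_left, h1, rotate_var_last]
    by_cases hi2 : i = n + 1
    · subst hi2
      rw [Equiv.swap_apply_right, h0, var_of_le le_rfl, map_zero]
    rw [Equiv.swap_apply_of_ne_of_ne hi1 hi2, ← hψ, rotate_var (by omega), proj_var,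
      rotate_var (by omega)]
  have h4 := congrArg ψ (opTinv_spec hn f)
  simp only [map_mul, map_add, map_sub ψ, h0, h1, h2, h3, hC, mul_zero, zero_add, zero_sub] at h4
  have hq : (C q * var (n + 1) 0 : P (n + 1)) ≠ 0 :=
    mul_ne_zero (by simp [q]) (var_ne_zero (by omega))
  rw [hψ, eq_inv_smul_iff₀ t_ne_zero, MvPolynomial.smul_eq_C_mul]
  apply mul_left_cancel₀ hq
  linear_combination -h4

lemma proj_downInv {n l : ℕ} (h : l < n) (f : P (n + 1)) :
    proj n (downInv (n + 1) l f) = downInv n l (proj n f) := by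
  induction l with
  | zero => rfl
  | succ l ih => rw [downInv_succ, proj_opTinv h, ih (by omega), downInv_succ]

/-- On the multiples of the first variable, the first Cherednik operators are compatible with the
projections. -/
lemma proj_opY_zero {n : ℕ} {f : P (n + 1 + 1)} (hf : var _ 0 ∣ f) :
    proj (n + 1) (opY (n + 1 + 1) 0 f) = opY (n + 1) 0 (proj (n + 1) f) := by
  have h1 := (var_dvd_downInv (m := 1) (by omega) (by simpa using hf) (n := n) (by omega)
    (by omega)).2
  rw [opY_zero, opY_zero, map_smul, Nat.add_sub_cancel, Nat.add_sub_cancel, downInv_succ,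
    proj_rotate_opTinv h1, proj_downInv (by omega), smul_smul, pow_succ,
    mul_inv_cancel_right₀ t_ne_zero]

/-! ### The first Cherednik operator on symmetric polynomials -/

/-- The substitution `x_0 ↦ c x_0`. -/
def scale (c : K) (k : ℕ) : P k →ₐ[K] P k :=
  subst (fun i => if i = 0 then C c * var k 0 else var k i) k

/-- On symmetric polynomials the `T_i⁻¹` act trivially, so that only the substitution remains. The
factor `t^k` makes the operators tend to zero on symmetric functions. -/
lemma opY_zero_of_symm {f : P k} (hf : ∀ j (h : j + 1 < k), simpleRefl k j h f = f) :
    opY k 0 f = t ^ k • scale q k f := by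
  have h1 : ∀ n, n < k → downInv k n f = f := by
    intro n
    induction n with
    | zero => exact fun _ => rfl
    | succ n ih =>
      intro hn
      rw [downInv_succ, ih (by omega), opTinv_eq_self ((opT_eq_self_iff hn f).mpr (hf n hn))]
  -- move the variable `q x_0` from the last to the first position by transpositions
  have h2 : ∀ n, n < k → subst (fun i => if i < n then var k (i + 1) else
      if i = n then C q * var k 0 else var k i) k f = scale q k f := by
    intro n
    induction n with
    | zero =>
      intro _
      refine subst_congr (fun i _ => ?_) f
      rw [if_neg (by omega)]
    | succ n ih =>
      intro hn
      rw [← ih (by omega)]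
      conv_lhs => rw [← hf n hn, subst_simpleRefl]
      refine subst_congr (fun i _ => ?_) f
      by_cases hi1 : i = n
      · subst hi1
        rw [Equiv.swap_apply_left]; simp
      by_cases hi2 : i = n + 1
      · subst hi2
        rw [Equiv.swap_apply_right]; simp
      rw [Equiv.swap_apply_of_ne_of_ne hi1 hi2]
      rcases lt_or_gt_of_ne hi1 with h3 | h3
      · rw [if_pos (by omega), if_pos h3]
      · rw [if_neg (by omega), if_neg (by omega), if_neg (by omega), if_neg hi1]
  rcases Nat.eq_zero_or_pos k with rfl | hk
  · rw [opY_zero, rotate_eq_subst, scale]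
    congr 1
    exact subst_congr (fun i hi => by omega) f
  · rw [opY_zero, h1 _ (by omega), rotate_eq_subst, ← h2 (k - 1) (by omega)]
    congr 1
    refine subst_congr (fun i hi => ?_) f
    split_ifs <;> first | rfl | omega

end opY

/-! ### Consequences of the affine Hecke relations -/

section Braid
variable {A : Type*} [Ring A] {T : ℕ → A}

/-- The product `T_a T_{a+1} ⋯ T_{a+n-1}`. -/
def upProd (T : ℕ → A) (a n : ℕ) : A := ((List.range' a n).map T).prod

@[simp] lemma upProd_zero (a : ℕ) : upProd T a 0 = 1 := rfl

lemma upProd_succ (a n : ℕ) : upProd T a (n + 1) = upProd T a n * T (a + n) := by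
  simp [upProd, List.range'_concat]

lemma upProd_succ' (a n : ℕ) : upProd T a (n + 1) = T a * upProd T (a + 1) n := by
  simp [upProd, List.range'_succ]

lemma upProd_comm (hcomm : ∀ i j, i + 1 < j → T i * T j = T j * T i) {a n j : ℕ}
    (h : a + n < j) : T j * upProd T a n = upProd T a n * T j := by
  induction n with
  | zero => simp
  | succ n ih =>
    rw [upProd_succ, ← mul_assoc, ih (by omega), mul_assoc, ← hcomm (a + n) j (by omega),
      mul_assoc]

/-- The product `T_a ⋯ T_{a+n-1}` intertwines each generator with the next one. -/
lemma mul_upProd (hcomm : ∀ i j, i + 1 < j → T i * T j = T j * T i)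
    (hbraid : ∀ i, T i * T (i + 1) * T i = T (i + 1) * T i * T (i + 1)) {a n j : ℕ}
    (ha : a ≤ j) (h : j + 1 < a + n) :
    T (j + 1) * upProd T a n = upProd T a n * T j := by
  induction n with
  | zero => omega
  | succ n ih =>
    rcases lt_or_ge (j + 1) (a + n) with h' | h'
    · rw [upProd_succ, ← mul_assoc, ih h', mul_assoc, hcomm j (a + n) h', mul_assoc]
    · obtain ⟨n, rfl⟩ : ∃ m, n = m + 1 := ⟨n - 1, by omega⟩
      obtain rfl : j = a + n := by omega
      rw [upProd_succ, upProd_succ, ← add_assoc, ← mul_assoc, ← mul_assoc,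
        upProd_comm hcomm (by omega), mul_assoc, mul_assoc, mul_assoc, mul_assoc, ← mul_assoc (T _),
        ← hbraid]
      simp only [mul_assoc]

lemma upProd_mul_upProd (hcomm : ∀ i j, i + 1 < j → T i * T j = T j * T i)
    (hbraid : ∀ i, T i * T (i + 1) * T i = T (i + 1) * T i * T (i + 1)) (a n m : ℕ)
    (h : m < n) : upProd T (a + 1) m * upProd T a n = upProd T a n * upProd T a m := by
  induction m with
  | zero => simp
  | succ m ih =>
    rw [upProd_succ, upProd_succ, mul_assoc, show a + 1 + m = a + m + 1 by omega,
      mul_upProd hcomm hbraid (by omega) (by omega), ← mul_assoc, ih (by omega), mul_assoc]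

variable {k : ℕ} {ω y : A}

lemma shift_upProd (hω : ∀ i, i + 2 < k → ω * T i = T (i + 1) * ω) {m : ℕ} (h : m + 1 < k) :
    ω * upProd T 0 m = upProd T 1 m * ω := by
  induction m with
  | zero => simp
  | succ m ih =>
    rw [upProd_succ, upProd_succ, ← mul_assoc, ih (by omega), mul_assoc, hω _ (by omega),
      mul_assoc, zero_add, add_comm 1 m]

/-- If `ω` shifts the generators `T_i`, then `y = ω (T_0 ⋯ T_{k-2})⁻¹` commutes with the `T_j`,
`j ≥ 1`. -/
lemma commute_of_shift (hcomm : ∀ i j, i + 1 < j → T i * T j = T j * T i)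
    (hbraid : ∀ i, T i * T (i + 1) * T i = T (i + 1) * T i * T (i + 1))
    (hω : ∀ i, i + 2 < k → ω * T i = T (i + 1) * ω)
    (hu : IsUnit (upProd T 0 (k - 1))) (hy : y * upProd T 0 (k - 1) = ω) {j : ℕ}
    (h : j + 2 < k) : T (j + 1) * y = y * T (j + 1) := by
  apply hu.mul_right_cancel
  rw [mul_assoc, hy, mul_assoc, mul_upProd hcomm hbraid (by omega) (by omega), ← mul_assoc, hy,
    hω j h]

/-- If `ω` shifts the generators `T_i` and `ω²` intertwines the last one with the first one, then
`y = ω (T_0 ⋯ T_{k-2})⁻¹` satisfies the braid relation of type `B` with `T_0`. -/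
lemma braid_of_shift (hcomm : ∀ i j, i + 1 < j → T i * T j = T j * T i)
    (hbraid : ∀ i, T i * T (i + 1) * T i = T (i + 1) * T i * T (i + 1))
    (hω : ∀ i, i + 2 < k → ω * T i = T (i + 1) * ω) (hk : 2 ≤ k)
    (hωω : ω * ω * T (k - 2) = T 0 * (ω * ω))
    (hu : ∀ m < k, IsUnit (upProd T 0 m)) (hy : y * upProd T 0 (k - 1) = ω) :
    T 0 * y * T 0 * y = y * T 0 * y * T 0 := by
  obtain ⟨n, rfl⟩ : ∃ n, k = n + 2 := ⟨k - 2, by omega⟩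
  rw [show n + 2 - 1 = n + 1 by omega] at hy
  rw [show n + 2 - 2 = n by omega] at hωω
  have hAB := upProd_mul_upProd hcomm hbraid 0 (n + 1) n (by omega)
  rw [zero_add] at hAB
  have hB := shift_upProd hω (m := n) (by omega)
  have hU := upProd_succ (T := T) 0 n
  have hU' := upProd_succ' (T := T) 0 n
  rw [zero_add] at hU hU'
  have hu1 := hu (n + 1) (by omega)
  have hu0 := hu n (by omega)
  generalize upProd T 0 (n + 1) = U at *
  generalize upProd T 0 n = B at *
  generalize upProd T 1 n = C at *
  -- `y T_0 C = ω` and `ω B = C ω`, so both sides become `ω² T_n` after multiplication by `U B`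
  have h1 : y * T 0 * C = ω := by rw [mul_assoc, ← hU', hy]
  have h2 : y * T 0 * ω * B = ω * ω := by
    rw [mul_assoc _ ω, hB, ← mul_assoc, h1]
  apply (hu1.mul hu0).mul_right_cancel
  calc T 0 * y * T 0 * y * (U * B) = T 0 * (y * T 0 * (y * U) * B) := by simp only [mul_assoc]
    _ = ω * ω * T n := by rw [hy, h2, hωω]
    _ = y * T 0 * (y * T 0 * C) * B * T n := by rw [h1, h2]
    _ = y * T 0 * y * T 0 * (C * U) := by rw [hU]; simp only [mul_assoc]
    _ = y * T 0 * y * T 0 * (U * B) := by rw [hAB]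

variable {𝕜 : Type*} [Field 𝕜] [Algebra 𝕜 A] {τ : 𝕜} {Y : ℕ → A}

/-- The commutation of the `T_i` with the `Y_j` follows from the case `j = 0`. -/
lemma commute_Y (hcomm : ∀ i j, i + 1 < j → T i * T j = T j * T i)
    (hbraid : ∀ i, T i * T (i + 1) * T i = T (i + 1) * T i * T (i + 1))
    (hY : ∀ j, j + 1 < k → Y (j + 1) = τ⁻¹ • (T j * Y j * T j))
    (h0 : ∀ j, j + 2 < k → T (j + 1) * Y 0 = Y 0 * T (j + 1)) {i j : ℕ} (hi : i + 1 < k)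
    (hj : j < k) (hij : j ≠ i) (hij' : j ≠ i + 1) : T i * Y j = Y j * T i := by
  -- the case `j < i`: all factors of `Y_j` commute with `T_i`
  have h1 : ∀ j i, i + 1 < k → j < i → T i * Y j = Y j * T i := by
    intro j
    induction j with
    | zero =>
      intro i hi hij
      obtain ⟨i, rfl⟩ : ∃ m, i = m + 1 := ⟨i - 1, by omega⟩
      exact h0 i (by omega)
    | succ j ih =>
      intro i hi hij
      have h2 := hcomm j i (by omega)
      rw [hY j (by omega), mul_smul_comm, smul_mul_assoc]
      congr 1
      rw [← mul_assoc, ← mul_assoc, ← h2, mul_assoc (T j), ih i hi (by omega), ← mul_assoc,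
        mul_assoc _ (T i), ← h2, mul_assoc, mul_assoc, mul_assoc]
  rcases lt_or_gt_of_ne hij with h | h
  · exact h1 j i hi h
  -- the case `j > i + 1`, starting from `j = i + 2`
  have h2 : i + 2 ≤ j := by omega
  clear hij hij' h
  induction j, h2 using Nat.le_induction with
  | base =>
    have h3 := h1 i (i + 1) (by omega) (by omega)
    rw [show i + 2 = i + 1 + 1 by omega, hY (i + 1) (by omega), hY i (by omega)]
    simp only [mul_smul_comm, smul_mul_assoc]
    congr 2
    have hb := hbraid i
    calc T i * (T (i + 1) * (T i * Y i * T i) * T (i + 1))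
        = (T i * T (i + 1) * T i) * Y i * T i * T (i + 1) := by simp only [mul_assoc]
      _ = T (i + 1) * T i * (T (i + 1) * Y i) * T i * T (i + 1) := by
        rw [hb]; simp only [mul_assoc]
      _ = T (i + 1) * T i * Y i * (T (i + 1) * T i * T (i + 1)) := by
        rw [h3]; simp only [mul_assoc]
      _ = T (i + 1) * (T i * Y i * T i) * T (i + 1) * T i := by
        rw [← hb]; simp only [mul_assoc]
  | succ j hle ih =>
    have h3 := hcomm i j (by omega)
    rw [hY j hj, mul_smul_comm, smul_mul_assoc]
    congr 1
    rw [← mul_assoc, ← mul_assoc, h3, mul_assoc (T j), ih (by omega), ← mul_assoc,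
      mul_assoc _ (T i), h3, mul_assoc, mul_assoc, mul_assoc]

/-- The commutation of the `Y_i` follows from the relations between `Y_0` and the `T_i`. -/
lemma Y_comm_Y (hcomm : ∀ i j, i + 1 < j → T i * T j = T j * T i)
    (hbraid : ∀ i, T i * T (i + 1) * T i = T (i + 1) * T i * T (i + 1))
    (hY : ∀ j, j + 1 < k → Y (j + 1) = τ⁻¹ • (T j * Y j * T j))
    (h0 : ∀ j, j + 2 < k → T (j + 1) * Y 0 = Y 0 * T (j + 1))
    (h00 : 2 ≤ k → T 0 * Y 0 * T 0 * Y 0 = Y 0 * T 0 * Y 0 * T 0) {i j : ℕ} (hi : i < k)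
    (hj : j < k) : Y i * Y j = Y j * Y i := by
  have hT := fun i j hi hj hij hij' => commute_Y (k := k) hcomm hbraid hY h0 (i := i) (j := j) hi hj
    hij hij'
  -- if `Y_i` commutes with `T_j` and `Y_j`, then it commutes with `Y_{j+1}`
  have hstep : ∀ j, j + 1 < k → ∀ z, T j * z = z * T j → z * Y j = Y j * z →
      z * Y (j + 1) = Y (j + 1) * z := by
    intro j hj z h1 h2
    rw [hY j hj, mul_smul_comm, smul_mul_assoc]
    congr 1
    rw [← mul_assoc, ← mul_assoc, ← h1, mul_assoc (T j), h2, mul_assoc, mul_assoc, ← h1]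
    simp only [mul_assoc]
  have hsucc : ∀ i, i + 1 < k → Y i * Y (i + 1) = Y (i + 1) * Y i := by
    intro i
    induction i with
    | zero =>
      intro h
      rw [hY 0 h, mul_smul_comm, smul_mul_assoc]
      congr 1
      rw [← mul_assoc, ← mul_assoc]
      exact (h00 (by omega)).symm
    | succ i ih =>
      intro h
      have h1 : Y i * Y (i + 1 + 1) = Y (i + 1 + 1) * Y i :=
        hstep (i + 1) h _ (hT _ _ h (by omega) (by omega) (by omega)) (ih (by omega))
      exact (hstep i (by omega) _ (hT _ _ (by omega) h (by omega) (by omega)) h1.symm).symm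
  have hlt : ∀ i j, i < j → j < k → Y i * Y j = Y j * Y i := by
    intro i j hij
    induction j, hij using Nat.le_induction with
    | base => exact hsucc i
    | succ j hle ih =>
      intro hj
      have hle' : i + 1 ≤ j := hle
      exact hstep j hj _ (hT _ _ hj (by omega) (by omega) (by omega)) (ih (by omega))
  rcases lt_trichotomy i j with h | rfl | h
  · exact hlt i j h hj
  · rfl
  · exact (hlt j i h hi).symm

end Braid

/-! ### Demazure-Lusztig operators on a field -/

section Demazure
variable {𝕜 E : Type*} [Field 𝕜] [Field E] [Algebra 𝕜 E]

/-- The Demazure-Lusztig operator `f ↦ s f + (1 - τ) a (f - s f) / (a - b)` on a field. -/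
def demazure (τ : 𝕜) (s : E →ₐ[𝕜] E) (a b : E) : Module.End 𝕜 E :=
  LinearMap.mulLeft 𝕜 ((1 - algebraMap 𝕜 E τ) * a / (a - b)) +
    LinearMap.mulLeft 𝕜 ((algebraMap 𝕜 E τ * a - b) / (a - b)) ∘ₗ s.toLinearMap

variable {τ : 𝕜} {s s' : E →ₐ[𝕜] E} {a b a' b' c : E}

lemma demazure_apply (f : E) : demazure τ s a b f =
    (1 - algebraMap 𝕜 E τ) * a / (a - b) * f +
      (algebraMap 𝕜 E τ * a - b) / (a - b) * s f := rfl

lemma demazure_quadratic (hs : ∀ f, s (s f) = f) (ha : s a = b) (hb : s b = a) (hab : a ≠ b)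
    (f : E) : demazure τ s a b (demazure τ s a b f) = (1 - τ) • demazure τ s a b f + τ • f := by
  simp only [demazure_apply, map_add, map_mul, map_div₀, map_sub s, map_one, AlgHom.commutes, ha,
    hb, hs, Algebra.smul_def, map_sub (algebraMap 𝕜 E)]
  have h1 : a - b ≠ 0 := sub_ne_zero.mpr hab
  have h2 : b - a ≠ 0 := sub_ne_zero.mpr hab.symm
  rw [← neg_sub a b]
  field_simp
  ring

lemma demazure_mul_demazure (hs : ∀ f, s (s f) = f) (ha : s a = b) (hb : s b = a) (hab : a ≠ b)
    (f : E) : demazure τ s a b (b * demazure τ s a b f) = τ • (a * f) := by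
  simp only [demazure_apply, map_add, map_mul, map_div₀, map_sub s, map_one, AlgHom.commutes, ha,
    hb, hs, Algebra.smul_def]
  have h1 : a - b ≠ 0 := sub_ne_zero.mpr hab
  rw [← neg_sub a b]
  field_simp
  ring

lemma demazure_mul_of_fixed {e : E} (he : s e = e) (f : E) :
    demazure τ s a b (e * f) = e * demazure τ s a b f := by
  simp only [demazure_apply, map_mul, he]
  ring

lemma map_demazure {φ : E →ₐ[𝕜] E} (ha : φ a = a') (hb : φ b = b')
    (hs : ∀ f, φ (s f) = s' (φ f)) (f : E) :
    φ (demazure τ s a b f) = demazure τ s' a' b' (φ f) := by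
  simp only [demazure_apply, map_add, map_mul, map_div₀, map_sub φ, map_one, AlgHom.commutes, ha,
    hb, hs]

lemma demazure_comm (hs : ∀ f, s (s' f) = s' (s f)) (ha : s' a = a) (hb : s' b = b)
    (ha' : s a' = a') (hb' : s b' = b') (f : E) :
    demazure τ s a b (demazure τ s' a' b' f) = demazure τ s' a' b' (demazure τ s a b f) := by
  simp only [demazure_apply, map_add, map_mul, map_div₀, map_sub s, map_sub s', map_one,
    AlgHom.commutes, ha, hb, ha', hb', hs]
  ring

lemma demazure_braid (hs : ∀ f, s (s f) = f) (hs' : ∀ f, s' (s' f) = f)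
    (hss : ∀ f, s (s' (s f)) = s' (s (s' f)))
    (ha : s a = b) (hb : s b = a) (hc : s c = c) (ha' : s' a = a) (hb' : s' b = c) (hc' : s' c = b)
    (hab : a ≠ b) (hac : a ≠ c) (hbc : b ≠ c) (f : E) :
    demazure τ s a b (demazure τ s' b c (demazure τ s a b f)) =
      demazure τ s' b c (demazure τ s a b (demazure τ s' b c f)) := by
  simp only [demazure_apply, map_add, map_mul, map_div₀, map_sub s, map_sub s', map_one,
    AlgHom.commutes, ha, hb, hc, ha', hb', hc', hs, hs', hss]
  have h1 : a - b ≠ 0 := sub_ne_zero.mpr hab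
  have h2 : a - c ≠ 0 := sub_ne_zero.mpr hac
  have h3 : b - c ≠ 0 := sub_ne_zero.mpr hbc
  rw [← neg_sub a b, ← neg_sub b c]
  generalize algebraMap 𝕜 E τ = u
  generalize s f = f1
  generalize s' f = f2
  generalize s (s' f) = f3
  generalize s' f1 = f4
  field_simp
  ring

end Demazure

/-! ### The polynomial representation of `ℋₖ` -/

/-- The field of rational functions in `k` variables over `ℚ(t, q)`. -/
def L (k : ℕ) : Type := FractionRing (P k)

instance (k : ℕ) : Field (L k) := inferInstanceAs (Field (FractionRing (P k)))

instance (k : ℕ) : Algebra (P k) (L k) := inferInstanceAs (Algebra (P k) (FractionRing (P k)))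

instance (k : ℕ) : IsFractionRing (P k) (L k) :=
  inferInstanceAs (IsFractionRing (P k) (FractionRing (P k)))

instance (k : ℕ) : Algebra K (L k) := inferInstanceAs (Algebra K (FractionRing (P k)))

instance (k : ℕ) : IsScalarTower K (P k) (L k) :=
  inferInstanceAs (IsScalarTower K (P k) (FractionRing (P k)))

section liftL
variable {k : ℕ}

/-- The inclusion of the polynomials into the rational functions. -/
def toL (k : ℕ) : P k →ₐ[K] L k := Algebra.algHom K (P k) (L k)

lemma toL_injective : Function.Injective (toL k) := FaithfulSMul.algebraMap_injective (P k) (L k)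

lemma toL_comp_injective {φ : P k →ₐ[K] P k} (h : Function.Injective φ) :
    Function.Injective ((toL k).comp φ) := by
  rw [AlgHom.coe_comp]
  exact toL_injective.comp h

/-- The extension of an injective endomorphism of the polynomials to the rational functions. -/
def liftL (φ : P k →ₐ[K] P k) (h : Function.Injective φ) : L k →ₐ[K] L k :=
  IsFractionRing.liftAlgHom (A := P k) (g := (toL k).comp φ) (toL_comp_injective h)

lemma liftL_toL (φ : P k →ₐ[K] P k) (h : Function.Injective φ) (f : P k) :
    liftL φ h (toL k f) = toL k (φ f) := by
  rw [liftL, IsFractionRing.liftAlgHom_apply]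
  exact IsFractionRing.lift_algebraMap (toL_comp_injective h) f

lemma algHomL_apply_eq {φ ψ : L k →ₐ[K] L k} (h : ∀ i, i < k →
    φ (toL k (var k i)) = ψ (toL k (var k i))) (f : L k) : φ f = ψ f := by
  have h1 : φ.comp (toL k) = ψ.comp (toL k) :=
    AlgHom.ext fun f => algHom_apply_eq (φ := φ.comp (toL k)) (ψ := ψ.comp (toL k)) h f
  have : φ = ψ := IsLocalization.algHom_ext (nonZeroDivisors (P k)) h1
  rw [this]

end liftL

section operators
variable {k : ℕ}

/-- The variable with index `i` as a rational function. -/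
def varL (k i : ℕ) : L k := toL k (var k i)

lemma varL_ne_zero {i : ℕ} (h : i < k) : varL k i ≠ 0 := by
  rw [varL, ne_eq, map_eq_zero_iff _ toL_injective]
  exact var_ne_zero h

lemma varL_ne {i j : ℕ} (hi : i < k) (hj : j < k) (hij : i ≠ j) : varL k i ≠ varL k j :=
  fun h => var_sub_var_ne_zero hi hj hij (sub_eq_zero.mpr (toL_injective h))

lemma simpleRefl_injective {j : ℕ} (h : j + 1 < k) : Function.Injective (simpleRefl k j h) :=
  Function.LeftInverse.injective (simpleRefl_simpleRefl h)

/-- The transposition of two neighbouring variables on the rational functions. -/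
def reflL (k j : ℕ) (h : j + 1 < k) : L k →ₐ[K] L k :=
  liftL (simpleRefl k j h) (simpleRefl_injective h)

lemma reflL_toL {j : ℕ} (h : j + 1 < k) (f : P k) :
    reflL k j h (toL k f) = toL k (simpleRefl k j h f) := liftL_toL _ _ f

lemma reflL_varL {j : ℕ} (h : j + 1 < k) (i : ℕ) :
    reflL k j h (varL k i) = varL k (Equiv.swap j (j + 1) i) := by
  rw [varL, reflL_toL, simpleRefl_var]; rfl

/-- The inverse of the substitution `rotate`. -/
def unrotate (k : ℕ) : P k →ₐ[K] P k :=
  subst (fun i => if i = 0 then C q⁻¹ * var k (k - 1) else var k (i - 1)) k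

lemma q_ne_zero : q ≠ 0 := by simp [q]

lemma unrotate_rotate (f : P k) : unrotate k (rotate k f) = f := by
  refine algHom_apply_eq (φ := (unrotate k).comp (rotate k)) (ψ := AlgHom.id K _)
    (fun i hi => ?_) f
  rw [AlgHom.comp_apply]
  by_cases h : i + 1 < k
  · rw [rotate_var h, unrotate, subst_var _ h, if_neg (by omega)]
    rfl
  · obtain rfl : k = i + 1 := by omega
    have hC : ∀ c : K, unrotate (i + 1) (C c) = C c := fun c => (unrotate (i + 1)).commutes c
    rw [rotate_var_last, map_mul, hC, unrotate, subst_var _ (Nat.succ_pos i), if_pos rfl,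
      ← mul_assoc, ← map_mul, mul_inv_cancel₀ q_ne_zero, map_one, one_mul]
    rfl

lemma rotate_unrotate (f : P k) : rotate k (unrotate k f) = f := by
  refine algHom_apply_eq (φ := (rotate k).comp (unrotate k)) (ψ := AlgHom.id K _)
    (fun i hi => ?_) f
  rw [AlgHom.comp_apply, unrotate, subst_var _ hi]
  have hC : ∀ c : K, rotate k (C c) = C c := fun c => (rotate k).commutes c
  split_ifs with h
  · subst h
    obtain ⟨n, rfl⟩ : ∃ n, k = n + 1 := ⟨k - 1, by omega⟩
    rw [map_mul, hC, Nat.add_sub_cancel, rotate_var_last, ← mul_assoc,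
      ← map_mul, inv_mul_cancel₀ q_ne_zero, map_one, one_mul]
    rfl
  · rw [rotate_var (by omega), Nat.sub_add_cancel (by omega)]
    rfl

/-- The substitution `f(x_0, …, x_{k-1}) ↦ f(x_1, …, x_{k-1}, q x_0)` on the rational functions. -/
def rotateL (k : ℕ) : L k →ₐ[K] L k :=
  liftL (rotate k) (Function.LeftInverse.injective unrotate_rotate)

/-- The inverse of `rotateL`. -/
def unrotateL (k : ℕ) : L k →ₐ[K] L k :=
  liftL (unrotate k) (Function.LeftInverse.injective rotate_unrotate)

lemma rotateL_toL (f : P k) : rotateL k (toL k f) = toL k (rotate k f) := liftL_toL _ _ f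

lemma rotateL_varL {i : ℕ} (h : i + 1 < k) : rotateL k (varL k i) = varL k (i + 1) := by
  rw [varL, rotateL_toL, rotate_var h]; rfl

lemma rotateL_varL_last {n : ℕ} (h : k = n + 1) : rotateL k (varL k n) = q • varL k 0 := by
  subst h
  rw [varL, rotateL_toL, rotate_var_last, ← MvPolynomial.smul_eq_C_mul, map_smul]; rfl

lemma rotateL_unrotateL (f : L k) : rotateL k (unrotateL k f) = f := by
  refine algHomL_apply_eq (φ := (rotateL k).comp (unrotateL k)) (ψ := AlgHom.id K _)
    (fun i hi => ?_) f
  rw [AlgHom.comp_apply, unrotateL, liftL_toL, rotateL_toL, rotate_unrotate]; rfl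

lemma unrotateL_rotateL (f : L k) : unrotateL k (rotateL k f) = f := by
  refine algHomL_apply_eq (φ := (unrotateL k).comp (rotateL k)) (ψ := AlgHom.id K _)
    (fun i hi => ?_) f
  rw [AlgHom.comp_apply, rotateL_toL, unrotateL, liftL_toL, unrotate_rotate]; rfl

lemma reflL_reflL {j : ℕ} (h : j + 1 < k) (f : L k) : reflL k j h (reflL k j h f) = f := by
  refine algHomL_apply_eq (φ := (reflL k j h).comp (reflL k j h)) (ψ := AlgHom.id K _)
    (fun i hi => ?_) f
  rw [AlgHom.comp_apply, reflL_toL, reflL_toL, simpleRefl_simpleRefl]; rfl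

/-- The Demazure-Lusztig operators on the rational functions, set to `0` out of range, which does
not affect the braid relations. -/
def opTL (k j : ℕ) : Module.End K (L k) :=
  if h : j + 1 < k then demazure t (reflL k j h) (varL k j) (varL k (j + 1)) else 0

lemma opTL_of_lt {j : ℕ} (h : j + 1 < k) :
    opTL k j = demazure t (reflL k j h) (varL k j) (varL k (j + 1)) := dif_pos h

lemma opTL_of_le {j : ℕ} (h : k ≤ j + 1) : opTL k j = 0 := dif_neg (by omega)

lemma reflL_left {j : ℕ} (h : j + 1 < k) : reflL k j h (varL k j) = varL k (j + 1) := by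
  rw [reflL_varL, Equiv.swap_apply_left]

lemma reflL_right {j : ℕ} (h : j + 1 < k) : reflL k j h (varL k (j + 1)) = varL k j := by
  rw [reflL_varL, Equiv.swap_apply_right]

lemma reflL_of_ne {i j : ℕ} (h : j + 1 < k) (h0 : i ≠ j) (h1 : i ≠ j + 1) :
    reflL k j h (varL k i) = varL k i := by
  rw [reflL_varL, Equiv.swap_apply_of_ne_of_ne h0 h1]

lemma opTL_toL {j : ℕ} (h : j + 1 < k) (f : P k) :
    opTL k j (toL k f) = toL k (opT k j f) := by
  have h1 := congrArg (toL k) (opT_spec h f)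
  have hne : varL k j - varL k (j + 1) ≠ 0 := sub_ne_zero.mpr (varL_ne (by omega) h (by omega))
  have hC : ∀ c : K, toL k (C c) = algebraMap K (L k) c := fun c => (toL k).commutes c
  rw [opTL_of_lt h, demazure_apply, reflL_toL]
  apply mul_left_cancel₀ hne
  have h2 : ∀ i, toL k (var k i) = varL k i := fun _ => rfl
  simp only [map_mul, map_add, map_sub, hC, map_one, h2] at h1
  rw [h1]
  field_simp

lemma opTL_quadratic {j : ℕ} (h : j + 1 < k) :
    opTL k j * opTL k j = (1 - t) • opTL k j + t • 1 := by
  refine LinearMap.ext fun f => ?_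
  rw [opTL_of_lt h]
  exact demazure_quadratic (reflL_reflL h) (reflL_left h) (reflL_right h)
    (varL_ne (by omega) h (by omega)) f

lemma reflL_comm {i j : ℕ} (hi : i + 1 < k) (hj : j + 1 < k) (hij : i + 1 < j) (f : L k) :
    reflL k i hi (reflL k j hj f) = reflL k j hj (reflL k i hi f) := by
  refine algHomL_apply_eq (φ := (reflL k i hi).comp (reflL k j hj))
    (ψ := (reflL k j hj).comp (reflL k i hi)) (fun l _ => ?_) f
  simp only [AlgHom.comp_apply]
  rw [reflL_toL, reflL_toL, reflL_toL, reflL_toL, simpleRefl_comm hi hj (Or.inl hij)]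

lemma opTL_comm (i j : ℕ) (hij : i + 1 < j) : opTL k i * opTL k j = opTL k j * opTL k i := by
  rcases lt_or_ge (j + 1) k with h | h
  swap
  · rw [opTL_of_le h]; simp
  refine LinearMap.ext fun f => ?_
  rw [opTL_of_lt h, opTL_of_lt (show i + 1 < k by omega)]
  refine demazure_comm (reflL_comm _ _ hij) ?_ ?_ ?_ ?_ f <;>
    exact reflL_of_ne _ (by omega) (by omega)

lemma reflL_braid {i : ℕ} (h : i + 1 + 1 < k) (f : L k) :
    reflL k i (by omega) (reflL k (i + 1) h (reflL k i (by omega) f)) =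
      reflL k (i + 1) h (reflL k i (by omega) (reflL k (i + 1) h f)) := by
  have h' : i + 1 < k := by omega
  refine algHomL_apply_eq (φ := (reflL k i h').comp ((reflL k (i + 1) h).comp (reflL k i h')))
    (ψ := (reflL k (i + 1) h).comp ((reflL k i h').comp (reflL k (i + 1) h))) (fun l _ => ?_) f
  simp only [AlgHom.comp_apply]
  change reflL k i h' (reflL k (i + 1) h (reflL k i h' (varL k l))) =
    reflL k (i + 1) h (reflL k i h' (reflL k (i + 1) h (varL k l)))
  simp only [reflL_varL]
  congr 1
  simp only [Equiv.swap_apply_def]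
  split_ifs <;> omega

lemma opTL_braid (i : ℕ) : opTL k i * opTL k (i + 1) * opTL k i =
    opTL k (i + 1) * opTL k i * opTL k (i + 1) := by
  rcases lt_or_ge (i + 1 + 1) k with h | h
  swap
  · rw [opTL_of_le h]; simp
  refine LinearMap.ext fun f => ?_
  rw [opTL_of_lt h, opTL_of_lt (show i + 1 < k by omega)]
  exact demazure_braid (reflL_reflL _) (reflL_reflL _) (reflL_braid h) (reflL_left _)
    (reflL_right _) (reflL_of_ne _ (by omega) (by omega)) (reflL_of_ne _ (by omega) (by omega))
    (reflL_left _) (reflL_right _) (varL_ne (by omega) (by omega) (by omega))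
    (varL_ne (by omega) (by omega) (by omega)) (varL_ne (by omega) (by omega) (by omega)) f

/-- The inverse of the Demazure-Lusztig operator on the rational functions. -/
def opTinvL (k j : ℕ) : Module.End K (L k) := t⁻¹ • (opTL k j + (t - 1) • 1)

lemma opTL_mul_opTinvL {j : ℕ} (h : j + 1 < k) : opTL k j * opTinvL k j = 1 := by
  rw [opTinvL, mul_smul_comm, mul_add, opTL_quadratic h, mul_smul_comm, mul_one,
    inv_smul_eq_iff₀ t_ne_zero, add_right_comm, ← add_smul]
  simp

lemma opTinvL_mul_opTL {j : ℕ} (h : j + 1 < k) : opTinvL k j * opTL k j = 1 := by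
  rw [opTinvL, smul_mul_assoc, add_mul, opTL_quadratic h, smul_mul_assoc, one_mul,
    inv_smul_eq_iff₀ t_ne_zero, add_right_comm, ← add_smul]
  simp

lemma isUnit_opTL {j : ℕ} (h : j + 1 < k) : IsUnit (opTL k j) :=
  ⟨⟨_, _, opTL_mul_opTinvL h, opTinvL_mul_opTL h⟩, rfl⟩

lemma isUnit_upProd_opTL {m : ℕ} (h : m < k) : IsUnit (upProd (opTL k) 0 m) := by
  induction m with
  | zero => simp
  | succ m ih =>
    rw [upProd_succ, zero_add]
    exact (ih (by omega)).mul (isUnit_opTL h)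

/-- Multiplication by the variable with index `i` on the rational functions. -/
def opXL (k i : ℕ) : Module.End K (L k) := LinearMap.mulLeft K (varL k i)

lemma opXL_toL (i : ℕ) (f : P k) : opXL k i (toL k f) = toL k (opX k i f) := by
  rw [opX_apply, map_mul]; rfl

lemma opTL_mul_opXL {i j : ℕ} (hi : i + 1 < k) (h0 : j ≠ i) (h1 : j ≠ i + 1) :
    opTL k i * opXL k j = opXL k j * opTL k i := by
  refine LinearMap.ext fun f => ?_
  rw [opTL_of_lt hi]
  exact demazure_mul_of_fixed (reflL_of_ne hi h0 h1) f

lemma opTL_mul_opXL_mul_opTL {i : ℕ} (hi : i + 1 < k) :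
    opTL k i * opXL k (i + 1) * opTL k i = t • opXL k i := by
  refine LinearMap.ext fun f => ?_
  rw [opTL_of_lt hi]
  exact demazure_mul_demazure (reflL_reflL hi) (reflL_left hi) (reflL_right hi)
    (varL_ne (by omega) hi (by omega)) f

lemma opXL_comm (i j : ℕ) : opXL k i * opXL k j = opXL k j * opXL k i :=
  LinearMap.ext fun f => mul_left_comm (varL k i) (varL k j) f

/-- The operator `rotateL` as a linear map. -/
def opRL (k : ℕ) : Module.End K (L k) := (rotateL k).toLinearMap

lemma isUnit_opRL : IsUnit (opRL k) :=
  ⟨⟨opRL k, (unrotateL k).toLinearMap, LinearMap.ext rotateL_unrotateL,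
    LinearMap.ext unrotateL_rotateL⟩, rfl⟩

lemma rotateL_reflL {j : ℕ} (h : j + 1 + 1 < k) (f : L k) :
    rotateL k (reflL k j (by omega) f) = reflL k (j + 1) h (rotateL k f) := by
  have h' : j + 1 < k := by omega
  refine algHomL_apply_eq (φ := (rotateL k).comp (reflL k j h'))
    (ψ := (reflL k (j + 1) h).comp (rotateL k)) (fun l _ => ?_) f
  simp only [AlgHom.comp_apply]
  rw [reflL_toL, rotateL_toL, rotateL_toL, reflL_toL, rotate_simpleRefl h]

lemma opRL_mul_opTL (i : ℕ) (h : i + 2 < k) : opRL k * opTL k i = opTL k (i + 1) * opRL k := by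
  refine LinearMap.ext fun f => ?_
  rw [opTL_of_lt (show i + 1 < k by omega), opTL_of_lt (show i + 1 + 1 < k by omega)]
  exact map_demazure (rotateL_varL (by omega)) (rotateL_varL (by omega)) (rotateL_reflL h) f

lemma demazure_smul_smul {c : K} (hc : c ≠ 0) (s : L k →ₐ[K] L k) (a b f : L k) :
    demazure t s (c • a) (c • b) f = demazure t s a b f := by
  have hc' : algebraMap K (L k) c ≠ 0 := by simpa using hc
  rw [demazure_apply, demazure_apply, Algebra.smul_def, Algebra.smul_def,
    mul_left_comm, ← mul_sub, mul_div_mul_left _ _ hc', mul_left_comm, ← mul_sub,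
    mul_div_mul_left _ _ hc']

lemma rotateL_rotateL_reflL {n : ℕ} (hk : k = n + 1 + 1) (h : n + 1 < k) (h' : 0 + 1 < k)
    (f : L k) : rotateL k (rotateL k (reflL k n h f)) =
      reflL k 0 h' (rotateL k (rotateL k f)) := by
  refine algHomL_apply_eq (φ := ((rotateL k).comp (rotateL k)).comp (reflL k n h))
    (ψ := (reflL k 0 h').comp ((rotateL k).comp (rotateL k))) (fun l hl => ?_) f
  have h1 : rotateL k (rotateL k (varL k n)) = q • varL k 0 := by
    rw [rotateL_varL h, rotateL_varL_last hk]
  have h2 : rotateL k (rotateL k (varL k (n + 1))) = q • varL k (0 + 1) := by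
    rw [rotateL_varL_last hk, map_smul, rotateL_varL h']
  simp only [AlgHom.comp_apply]
  change rotateL _ (rotateL _ (reflL _ _ _ (varL _ l))) =
    reflL _ _ _ (rotateL _ (rotateL _ (varL _ l)))
  by_cases hl1 : l = n
  · subst hl1
    rw [reflL_left, h1, h2, map_smul, reflL_left]
  by_cases hl2 : l = n + 1
  · subst hl2
    rw [reflL_right, h1, h2, map_smul, reflL_right]
  rw [reflL_of_ne _ hl1 hl2, rotateL_varL (by omega), rotateL_varL (by omega),
    reflL_of_ne _ (by omega) (by omega)]

/-- Two rotations exchange the last Demazure-Lusztig operator and the first one. -/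
lemma opRL_mul_opRL_mul_opTL (hk : 2 ≤ k) :
    opRL k * opRL k * opTL k (k - 2) = opTL k 0 * (opRL k * opRL k) := by
  obtain ⟨n, hn⟩ : ∃ n, k = n + 1 + 1 := ⟨k - 2, by omega⟩
  obtain rfl : n = k - 2 := by omega
  have h : k - 2 + 1 < k := by omega
  have h' : 0 + 1 < k := by omega
  refine LinearMap.ext fun f => ?_
  have h1 : rotateL k (rotateL k (varL k (k - 2))) = q • varL k 0 := by
    rw [rotateL_varL h, rotateL_varL_last hn]
  have h2 : rotateL k (rotateL k (varL k (k - 2 + 1))) = q • varL k (0 + 1) := by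
    rw [rotateL_varL_last hn, map_smul, rotateL_varL h']
  rw [opTL_of_lt h, opTL_of_lt h']
  refine (map_demazure (φ := (rotateL k).comp (rotateL k)) h1 h2
    (rotateL_rotateL_reflL hn h h') f).trans ?_
  -- the common factor `q` of both variables cancels
  exact demazure_smul_smul q_ne_zero _ _ _ _

/-- The Cherednik operators on the rational functions. -/
def opYL (k : ℕ) : ℕ → Module.End K (L k)
  | 0 => t ^ k • (opRL k * Ring.inverse (upProd (opTL k) 0 (k - 1)))
  | j + 1 => t⁻¹ • (opTL k j * opYL k j * opTL k j)

lemma opYL_zero_mul (hk : 0 < k) : opYL k 0 * upProd (opTL k) 0 (k - 1) = t ^ k • opRL k := by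
  rw [opYL, smul_mul_assoc, mul_assoc,
    Ring.inverse_mul_cancel _ (isUnit_upProd_opTL (by omega)), mul_one]

lemma isUnit_smul {c : K} (hc : c ≠ 0) {A : Type*} [Ring A] [Algebra K A] {a : A}
    (ha : IsUnit a) : IsUnit (c • a) := by
  rw [Algebra.smul_def]
  exact ((IsUnit.mk0 c hc).map (algebraMap K A)).mul ha

lemma isUnit_opYL {j : ℕ} (h : j < k) : IsUnit (opYL k j) := by
  induction j with
  | zero =>
    refine isUnit_smul (pow_ne_zero _ t_ne_zero) (isUnit_opRL.mul ?_)
    exact (isUnit_upProd_opTL (by omega)).ringInverse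
  | succ j ih =>
    exact isUnit_smul (inv_ne_zero t_ne_zero)
      (((isUnit_opTL h).mul (ih (by omega))).mul (isUnit_opTL h))

lemma opTL_mul_opYL_zero {j : ℕ} (h : j + 2 < k) :
    opTL k (j + 1) * opYL k 0 = opYL k 0 * opTL k (j + 1) := by
  refine commute_of_shift (k := k) opTL_comm opTL_braid ?_ (isUnit_upProd_opTL (by omega))
    (opYL_zero_mul (by omega)) h
  intro i hi
  rw [smul_mul_assoc, mul_smul_comm, opRL_mul_opTL i hi]

lemma opTL_opYL_braid (hk : 2 ≤ k) : opTL k 0 * opYL k 0 * opTL k 0 * opYL k 0 =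
    opYL k 0 * opTL k 0 * opYL k 0 * opTL k 0 := by
  refine braid_of_shift (k := k) opTL_comm opTL_braid ?_ hk ?_ (fun m hm => isUnit_upProd_opTL hm)
    (opYL_zero_mul (by omega))
  · intro i hi
    rw [smul_mul_assoc, mul_smul_comm, opRL_mul_opTL i hi]
  · simp only [smul_mul_assoc, mul_smul_comm]
    rw [opRL_mul_opRL_mul_opTL hk]

lemma opTL_mul_opYL {i j : ℕ} (hi : i + 1 < k) (hj : j < k) (h0 : j ≠ i) (h1 : j ≠ i + 1) :
    opTL k i * opYL k j = opYL k j * opTL k i :=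
  commute_Y (k := k) opTL_comm opTL_braid (fun _ _ => rfl) (fun _ h => opTL_mul_opYL_zero h)
    hi hj h0 h1

lemma opYL_comm {i j : ℕ} (hi : i < k) (hj : j < k) :
    opYL k i * opYL k j = opYL k j * opYL k i :=
  Y_comm_Y (k := k) opTL_comm opTL_braid (fun _ _ => rfl) (fun _ h => opTL_mul_opYL_zero h)
    opTL_opYL_braid hi hj

lemma opYL_cross (hk : 1 < k) :
    opYL k 0 * opTL k 0 * opXL k 0 = opXL k 1 * opYL k 0 * opTL k 0 := by
  obtain ⟨n, hn⟩ : ∃ n, k - 1 = n + 1 := ⟨k - 2, by omega⟩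
  have h1 := opYL_zero_mul (k := k) (by omega)
  rw [hn, upProd_succ', ← mul_assoc, zero_add] at h1
  -- it suffices to compare after multiplication by the invertible `T_1 ⋯ T_{k-2}`
  have hu : ∀ m ≤ n, IsUnit (upProd (opTL k) 1 m) ∧
      opXL k 0 * upProd (opTL k) 1 m = upProd (opTL k) 1 m * opXL k 0 := by
    intro m
    induction m with
    | zero => simp
    | succ m ih =>
      intro hm
      obtain ⟨ih1, ih2⟩ := ih (by omega)
      rw [upProd_succ]
      refine ⟨ih1.mul (isUnit_opTL (by omega)), ?_⟩
      rw [← mul_assoc, ih2, mul_assoc, ← opTL_mul_opXL (by omega) (by omega) (by omega), mul_assoc]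
  obtain ⟨hu1, hu2⟩ := hu n le_rfl
  apply hu1.mul_right_cancel
  rw [mul_assoc, hu2, ← mul_assoc, h1, mul_assoc (opXL _ 1), mul_assoc (opXL _ 1), h1,
    smul_mul_assoc, mul_smul_comm]
  congr 1
  refine LinearMap.ext fun f => ?_
  change rotateL k (varL k 0 * f) = varL k 1 * rotateL k f
  rw [map_mul, rotateL_varL (show 0 + 1 < k by omega)]

/-- The product of all variables. -/
def prodVarL (k : ℕ) : L k := (List.ofFn fun i : Fin k => varL k i).prod

lemma prod_opXL : (List.ofFn fun i : Fin k => opXL k i).prod = LinearMap.mulLeft K (prodVarL k) := by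
  have h : (fun i : Fin k => opXL k i) = fun i : Fin k => Algebra.lmul K (L k) (varL k i) := rfl
  rw [h, prodVarL]
  change _ = Algebra.lmul K (L k) _
  rw [map_list_prod, List.map_ofFn]
  rfl

lemma reflL_prodVarL {j : ℕ} (h : j + 1 < k) : reflL k j h (prodVarL k) = prodVarL k := by
  rw [prodVarL, List.prod_ofFn, map_prod]
  have hj : j < k := by omega
  refine Fintype.prod_equiv (Equiv.swap ⟨j, hj⟩ ⟨j + 1, h⟩) _ _ fun i => ?_
  rw [reflL_varL]
  congr 1
  simp only [Equiv.swap_apply_def, Fin.ext_iff]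
  split_ifs <;> rfl

lemma rotateL_prodVarL (hk : 0 < k) : rotateL k (prodVarL k) = q • prodVarL k := by
  obtain ⟨n, rfl⟩ : ∃ n, k = n + 1 := ⟨k - 1, by omega⟩
  rw [prodVarL, List.prod_ofFn, map_prod, Fin.prod_univ_castSucc, Fin.prod_univ_succ]
  simp only [Fin.val_castSucc, Fin.val_last, Fin.val_succ, Fin.val_zero]
  rw [rotateL_varL_last rfl, mul_smul_comm, mul_comm]
  congr 2
  exact Finset.prod_congr rfl fun i _ => rotateL_varL (by omega)

lemma opYL_det (hk : 0 < k) : opYL k 0 * LinearMap.mulLeft K (prodVarL k) =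
    q • (LinearMap.mulLeft K (prodVarL k) * opYL k 0) := by
  have hu : ∀ m < k, LinearMap.mulLeft K (prodVarL k) * upProd (opTL k) 0 m =
      upProd (opTL k) 0 m * LinearMap.mulLeft K (prodVarL k) := by
    intro m
    induction m with
    | zero => simp
    | succ m ih =>
      intro hm
      rw [upProd_succ, ← mul_assoc, ih (by omega), mul_assoc, mul_assoc, zero_add]
      congr 1
      refine LinearMap.ext fun f => ?_
      rw [opTL_of_lt hm]
      exact (demazure_mul_of_fixed (reflL_prodVarL hm) f).symm
  have h1 := opYL_zero_mul hk
  apply (isUnit_upProd_opTL (show k - 1 < k by omega)).mul_right_cancel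
  rw [mul_assoc, hu _ (by omega), ← mul_assoc, h1, smul_mul_assoc, smul_mul_assoc, mul_assoc, h1,
    mul_smul_comm, smul_comm]
  congr 1
  refine LinearMap.ext fun f => ?_
  change rotateL _ (prodVarL k * f) = q • (prodVarL k * rotateL _ f)
  rw [map_mul, rotateL_prodVarL hk, smul_mul_assoc]

/-- The operators by which the generators of `ℋₖ` act on the rational functions. -/
def genL (k : ℕ) : Gen k → Module.End K (L k)
  | .T i _ => opTL k i
  | .X i _ => opXL k i
  | .Xinv i _ => LinearMap.mulLeft K (varL k i)⁻¹
  | .Y i _ => opYL k i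
  | .Yinv i _ => Ring.inverse (opYL k i)

lemma genL_rel {x y : FreeAlgebra K (Gen k)} (h : Rel k x y) :
    FreeAlgebra.lift K (genL k) x = FreeAlgebra.lift K (genL k) y := by
  induction h with
  | T_comm i j hi hj h => simpa [genL] using opTL_comm i j h
  | braid i hi hi' => simpa [genL] using opTL_braid i
  | quadratic i hi =>
    simp only [genL, map_mul, map_sub, map_add, map_one, map_zero, FreeAlgebra.lift_ι_apply,
      AlgHom.commutes]
    rw [Algebra.algebraMap_eq_smul_one, sub_mul, mul_add, opTL_quadratic hi, one_mul]
    have h1 : opTL k i * (t • (1 : Module.End K (L k))) = t • opTL k i := by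
      rw [mul_smul_comm, mul_one]
    have h2 : (1 - t) • opTL k i = opTL k i - t • opTL k i :=
      (sub_smul 1 t (opTL k i)).trans (by rw [one_smul])
    rw [h1, h2]
    abel
  | X_succ i hi hi' => simpa [genL] using opTL_mul_opXL_mul_opTL hi'
  | T_X i j hi hj h h' => simpa [genL] using opTL_mul_opXL hi h h'
  | X_comm i j hi hj => simpa [genL] using opXL_comm i j
  | Y_succ i hi hi' => simp [genL, opYL]
  | T_Y i j hi hj h h' => simpa [genL] using opTL_mul_opYL hi hj h h'
  | Y_comm i j hi hj => simpa [genL] using opYL_comm hi hj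
  | cross h0 h1 => simpa [genL] using opYL_cross h1
  | det h0 =>
    simp only [map_mul, map_smul, map_list_prod, List.map_ofFn, Function.comp_def,
      FreeAlgebra.lift_ι_apply, genL]
    rw [prod_opXL]
    exact opYL_det h0
  | X_mul_Xinv i hi =>
    simp only [map_mul, map_one, FreeAlgebra.lift_ι_apply, genL]
    exact LinearMap.ext fun f => mul_inv_cancel_left₀ (varL_ne_zero hi) f
  | Xinv_mul_X i hi =>
    simp only [map_mul, map_one, FreeAlgebra.lift_ι_apply, genL]
    exact LinearMap.ext fun f => inv_mul_cancel_left₀ (varL_ne_zero hi) f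
  | Y_mul_Yinv i hi =>
    simpa [genL] using Ring.mul_inverse_cancel _ (isUnit_opYL hi)
  | Yinv_mul_Y i hi =>
    simpa [genL] using Ring.inverse_mul_cancel _ (isUnit_opYL hi)

/-- The representation of `ℋₖ` on the rational functions. -/
def repL (k : ℕ) : DAHA k →ₐ[K] Module.End K (L k) :=
  RingQuot.liftAlgHom K ⟨FreeAlgebra.lift K (genL k), fun _ _ h => genL_rel h⟩

lemma repL_gen (x : Gen k) : repL k (gen x) = genL k x := by
  rw [repL, gen, RingQuot.liftAlgHom_mkAlgHom_apply, FreeAlgebra.lift_ι_apply]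

lemma opYL_toL {j : ℕ} (h : j < k) (f : P k) : opYL k j (toL k f) = toL k (opY k j f) := by
  induction j generalizing f with
  | zero =>
    have h1 : ∀ m < k, toL k f = upProd (opTL k) 0 m (toL k (downInv k m f)) := by
      intro m
      induction m with
      | zero => exact fun _ => rfl
      | succ m ih =>
        intro hm
        rw [ih (by omega), upProd_succ, Module.End.mul_apply, zero_add, opTL_toL hm, downInv_succ,
          opT_opTinv]
    rw [h1 (k - 1) (by omega), ← Module.End.mul_apply, opYL_zero_mul h, opY_zero, map_smul,
      ← rotateL_toL]
    rfl
  | succ j ih =>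
    rw [opY_succ h]
    change t⁻¹ • opTL k j (opYL k j (opTL k j (toL k f))) =
      toL k (t⁻¹ • opT k j (opY k j (opT k j f)))
    rw [opTL_toL h, ih (by omega), opTL_toL h, map_smul]

end operators

/-! ### Convergence of sequences of polynomials -/

/-- The pairs `(f, F)` such that `fₖ` is eventually a finite sum `∑ᵢ aᵢₖ gᵢₖ` with almost symmetric
`gᵢ` and convergent scalars `aᵢₖ → aᵢ`, and `F = ∑ᵢ aᵢ gᵢ`. -/
def convPairs : Submodule K ((∀ k, P k) × Pas) :=
  Submodule.span K {p | ∃ (g : Pas) (a : ℕ → K) (l : K), ScalarTendsTo a l ∧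
    (∀ᶠ k in atTop, p.1 k = a k • g.1 k) ∧ p.2 = l • g}

/-- Convergence to an almost symmetric limit, in a form that is stable under composition of
operators: the sequence is eventually a finite sum `∑ᵢ aᵢₖ gᵢₖ` with almost symmetric `gᵢ`. -/
def SConv (f : ∀ k, P k) (F : Pas) : Prop := (f, F) ∈ convPairs

section SConv
variable {f f' : ∀ k, P k} {F F' : Pas}

lemma SConv.of_scalar {a : ℕ → K} {l : K} (h : ScalarTendsTo a l) (g : Pas) :
    SConv (fun k => a k • g.1 k) (l • g) :=
  Submodule.subset_span ⟨g, a, l, h, .of_forall fun _ => rfl, rfl⟩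

lemma SConv.const (F : Pas) : SConv F.1 F := by
  simpa using SConv.of_scalar (ScalarTendsTo.const 1) F

lemma SConv.add (h : SConv f F) (h' : SConv f' F') : SConv (fun k => f k + f' k) (F + F') :=
  convPairs.add_mem h h'

lemma SConv.smul (c : K) (h : SConv f F) : SConv (fun k => c • f k) (c • F) :=
  convPairs.smul_mem c h

lemma SConv.zero : SConv (fun _ => 0) 0 := convPairs.zero_mem

lemma SConv.congr (h : SConv f F) (hf : ∀ᶠ k in atTop, f k = f' k) : SConv f' F := by
  have h1 : ((fun k => f' k - f k, 0) : (∀ k, P k) × Pas) ∈ convPairs := by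
    refine Submodule.subset_span ⟨0, fun _ => 0, 0, ScalarTendsTo.const 0, ?_, by simp⟩
    filter_upwards [hf] with k hk
    simp [hk]
  have h2 := convPairs.add_mem h h1
  have h3 : (f, F) + ((fun k => f' k - f k, 0) : (∀ k, P k) × Pas) = (f', F) := by
    ext k
    · simp
    · simp
  rwa [h3] at h2

lemma SConv.scalar_mul {a : ℕ → K} {l : K} (ha : ScalarTendsTo a l) (h : SConv f F) :
    SConv (fun k => a k • f k) (l • F) := by
  have key : ∀ p ∈ convPairs, SConv (fun k => a k • p.1 k) (l • p.2) := by
    intro p hp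
    induction hp using Submodule.span_induction with
    | mem p hp =>
      obtain ⟨g, b, m, hb, h1, h2⟩ := hp
      rw [h2, smul_smul]
      refine (SConv.of_scalar (ha.mul hb) g).congr ?_
      filter_upwards [h1] with k hk
      rw [hk, smul_smul]
    | zero => simpa using SConv.zero
    | add p p' _ _ hp hp' => simpa using hp.add hp'
    | smul c p _ hp =>
      have := hp.smul c
      simp only [smul_comm c] at this
      exact this
  exact key _ h

/-- Operators that converge on the almost symmetric functions transform convergent sequences into
convergent sequences. -/
lemma SConv.map {φ : ∀ k, Module.End K (P k)} {Φ : Module.End K Pas}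
    (hΦ : ∀ G : Pas, SConv (fun k => φ k (G.1 k)) (Φ G)) (h : SConv f F) :
    SConv (fun k => φ k (f k)) (Φ F) := by
  have key : ∀ p ∈ convPairs, SConv (fun k => φ k (p.1 k)) (Φ p.2) := by
    intro p hp
    induction hp using Submodule.span_induction with
    | mem p hp =>
      obtain ⟨g, b, m, hb, h1, h2⟩ := hp
      rw [h2, map_smul]
      refine ((hΦ g).scalar_mul hb).congr ?_
      filter_upwards [h1] with k hk
      rw [hk, map_smul]
    | zero => simpa using SConv.zero
    | add p p' _ _ hp hp' => simpa using hp.add hp'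
    | smul c p _ hp => simpa using hp.smul c
  exact key _ h

end SConv

section ConvergesTo

lemma ConvergesTo.add {f f' F F' : ∀ k, P k} (h : ConvergesTo f F) (h' : ConvergesTo f' F') :
    ConvergesTo (f + f') (F + F') := by
  obtain ⟨N, h, g, a, l, hh, hg, ha, ⟨k₀, hf⟩, rfl⟩ := h
  obtain ⟨N', h', g', a', l', hh', hg', ha', ⟨k₀', hf'⟩, rfl⟩ := h'
  refine ⟨N + N', h + h', Fin.append g g', Fin.append a a', Fin.append l l', Pinf.add_mem hh hh',
    fun i => ?_, fun i => ?_, ⟨max k₀ k₀', fun k hk => ?_⟩, ?_⟩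
  · refine Fin.addCases (fun i => ?_) (fun i => ?_) i
    · simpa using hg i
    · simpa using hg' i
  · refine Fin.addCases (fun i => ?_) (fun i => ?_) i
    · simpa using ha i
    · simpa using ha' i
  · rw [Pi.add_apply, hf k (by omega), hf' k (by omega), Fin.sum_univ_add]
    simp only [Fin.append_left, Fin.append_right, Pi.add_apply]
    abel
  · rw [Fin.sum_univ_add]
    simp only [Fin.append_left, Fin.append_right]
    abel

lemma ConvergesTo.smul {f F : ∀ k, P k} (c : K) (h : ConvergesTo f F) :
    ConvergesTo (c • f) (c • F) := by
  obtain ⟨N, h, g, a, l, hh, hg, ha, ⟨k₀, hf⟩, rfl⟩ := h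
  refine ⟨N, c • h, fun i => c • g i, a, l, Pinf.smul_mem c hh, fun i => Pas.smul_mem c (hg i), ha,
    ⟨k₀, fun k hk => ?_⟩, ?_⟩
  · simp only [Pi.smul_apply, hf k hk, smul_add, Finset.smul_sum, smul_comm c]
  · simp only [smul_add, Finset.smul_sum, smul_comm c]

lemma SConv.convergesTo {f : ∀ k, P k} {F : Pas} (h : SConv f F) : ConvergesTo f F.1 := by
  have key : ∀ p ∈ convPairs, ConvergesTo p.1 p.2.1 := by
    intro p hp
    induction hp using Submodule.span_induction with
    | mem p hp =>
      obtain ⟨g, b, m, hb, h1, h2⟩ := hp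
      obtain ⟨k₀, hk₀⟩ := eventually_atTop.mp h1
      refine ⟨1, 0, fun _ => g.1, fun _ => b, fun _ => m, Pinf.zero_mem, fun _ => g.2, fun _ => hb,
        ⟨k₀, fun k hk => ?_⟩, ?_⟩
      · simpa using hk₀ k hk
      · rw [h2]; simp
    | zero => exact ⟨0, 0, Fin.elim0, Fin.elim0, Fin.elim0, Pinf.zero_mem, fun i => i.elim0,
        fun i => i.elim0, ⟨0, by simp⟩, by simp⟩
    | add p p' _ _ hp hp' => exact hp.add hp'
    | smul c p _ hp => exact hp.smul c
  exact key _ h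

/-- A convergent sequence converges coefficientwise. -/
lemma ConvergesTo.coeff {f F : ∀ k, P k} (h : ConvergesTo f F) (n : ℕ) (m : Fin n →₀ ℕ) :
    ScalarTendsTo (fun k => (projTo k n (f k)).coeff m) ((F n).coeff m) := by
  obtain ⟨N, h, g, a, l, hh, hg, ha, ⟨k₀, hf⟩, rfl⟩ := h
  have h1 : ScalarTendsTo (fun k => (h n).coeff m + ∑ i, a i k * (g i n).coeff m)
      ((h n).coeff m + ∑ i, l i * (g i n).coeff m) := by
    refine (ScalarTendsTo.const _).add ?_
    have h2 : ∀ s : Finset (Fin N), ScalarTendsTo (fun k => ∑ i ∈ s, a i k * (g i n).coeff m)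
        (∑ i ∈ s, l i * (g i n).coeff m) := by
      intro s
      induction s using Finset.induction_on with
      | empty => simpa using ScalarTendsTo.const 0
      | insert i s hi ih =>
        simp only [Finset.sum_insert hi]
        exact ((ha i).mul (ScalarTendsTo.const _)).add ih
    exact h2 _
  have h3 : ((h + ∑ i, l i • g i) n).coeff m = (h n).coeff m + ∑ i, l i * (g i n).coeff m := by
    simp [MvPolynomial.coeff_sum]
  rw [h3]
  refine h1.congr ?_
  filter_upwards [eventually_ge_atTop k₀, eventually_ge_atTop n] with k hk hk'
  have h4 : projTo k n (h k) = h n :=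
    projTo_apply (k₀ := 0) (fun k _ => hh.1 k) (Nat.zero_le _) hk'
  rw [hf k hk, map_add, map_sum, h4, MvPolynomial.coeff_add, MvPolynomial.coeff_sum]
  congr 1
  refine Finset.sum_congr rfl fun i _ => ?_
  have h5 : projTo k n (g i k) = g i n := Pas_projTo ⟨g i, hg i⟩ hk'
  rw [map_smul, h5, MvPolynomial.coeff_smul, smul_eq_mul]

lemma ConvergesTo.unique {f F G : ∀ k, P k} (h : ConvergesTo f F) (h' : ConvergesTo f G) :
    F = G := by
  funext n
  exact MvPolynomial.ext _ _ fun m => (h.coeff n m).unique (h'.coeff n m)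

lemma SConv.unique {f : ∀ k, P k} {F G : Pas} (h : SConv f F) (h' : SConv f G) : F = G :=
  Subtype.ext (h.convergesTo.unique h'.convergesTo)

/-- A sequence that is compatible with the projections from some index on converges to nothing
but its inverse limit. -/
lemma SConv.apply_of_compatible {f : ∀ k, P k} {F : Pas} (h : SConv f F) {k₀ n : ℕ}
    (hf : ∀ k, k₀ ≤ k → proj k (f (k + 1)) = f k) (hn : k₀ ≤ n) : F.1 n = f n := by
  refine MvPolynomial.ext _ _ fun m => (h.convergesTo.coeff n m).unique ?_
  refine (ScalarTendsTo.const ((f n).coeff m)).congr ?_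
  filter_upwards [eventually_ge_atTop n] with k hk
  rw [projTo_apply hf hn hk]

end ConvergesTo

/-! ### Operators on almost symmetric functions -/

/-- The limit of a sequence of operators that is compatible from index `k₀` on. -/
def mkOp (k₀ : ℕ) (φ : ∀ k, Module.End K (P k))
    (h : ∀ F : Pas, lowExt k₀ (fun k => φ k (F.1 k)) ∈ Pas) : Module.End K Pas where
  toFun F := ⟨_, h F⟩
  map_add' F G := by
    refine Subtype.ext (funext fun k => ?_)
    simp [lowExt]
  map_smul' c F := by
    refine Subtype.ext (funext fun k => ?_)
    simp [lowExt]

lemma Pas_proj_opT (i : ℕ) (F : Pas) (k : ℕ) (hk : i + 2 ≤ k) :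
    proj k (opT (k + 1) i (F.1 (k + 1))) = opT k i (F.1 k) := by
  rw [proj_opT (by omega), Pas_proj]

/-- The limit of the Demazure-Lusztig operators. -/
def TInf (i : ℕ) : Module.End K Pas := mkOp (i + 2) (fun k => opT k i) fun F => by
  obtain ⟨d, hd⟩ := Pas_degree F
  obtain ⟨m, hm⟩ := Pas_symm F
  refine Plevel_le_Pas (max m (i + 2)) (lowExt_mem_Plevel (Pas_proj_opT i F) (d := d) ?_ ?_)
  · exact fun k _ => (totalDegree_opT_le _).trans (hd k)
  · intro j hj k hk h
    rw [simpleRefl_opT h (by omega) (by omega), hm j (by omega)]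

lemma TInf_apply (i : ℕ) (F : Pas) {k : ℕ} (h : i + 1 < k) :
    (TInf i F).1 k = opT k i (F.1 k) :=
  lowExt_apply (k₀ := i + 2) (f := fun k => opT k i (F.1 k)) (Pas_proj_opT i F) h

lemma Pas_proj_opX (i : ℕ) (F : Pas) (k : ℕ) :
    proj k (opX (k + 1) i (F.1 (k + 1))) = opX k i (F.1 k) := by
  rw [opX_apply, opX_apply, map_mul, proj_var, Pas_proj]

/-- Multiplication by a variable on the almost symmetric functions. -/
def XInf (i : ℕ) : Module.End K Pas := mkOp 0 (fun k => opX k i) fun F => by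
  obtain ⟨d, hd⟩ := Pas_degree F
  obtain ⟨m, hm⟩ := Pas_symm F
  refine Plevel_le_Pas (max m (i + 1)) (lowExt_mem_Plevel (fun k _ => Pas_proj_opX i F k)
    (d := 1 + d) ?_ ?_)
  · intro k _
    rw [opX_apply]
    exact (MvPolynomial.totalDegree_mul _ _).trans (Nat.add_le_add (totalDegree_var_le _ _) (hd k))
  · intro j hj k hk h
    rw [opX_apply, map_mul, simpleRefl_var_of_ne h (by omega) (by omega), hm j (by omega)]

lemma XInf_apply (i : ℕ) (F : Pas) (k : ℕ) : (XInf i F).1 k = opX k i (F.1 k) :=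
  lowExt_apply (k₀ := 0) (f := fun k => opX k i (F.1 k)) (fun k _ => Pas_proj_opX i F k)
    (Nat.zero_le k)

/-- The inverse of the limit Demazure-Lusztig operator. -/
def TinvInf (i : ℕ) : Module.End K Pas := t⁻¹ • (TInf i + (t - 1) • 1)

lemma TinvInf_apply (i : ℕ) (F : Pas) {k : ℕ} (h : i + 1 < k) :
    (TinvInf i F).1 k = opTinv k i (F.1 k) := by
  change t⁻¹ • ((TInf i F).1 k + (t - 1) • F.1 k) = _
  rw [TInf_apply i F h]
  rfl

lemma proj_scale (c : K) (F : Pas) (k : ℕ) :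
    proj k (scale c (k + 1) (F.1 (k + 1))) = scale c k (F.1 k) := by
  have hC : proj k (C c) = C c := (proj k).commutes c
  rw [scale, scale, comp_subst, ← Pas_proj F k, ← subst_succ]
  · refine subst_congr (fun i _ => ?_) _
    rw [apply_ite (proj k), map_mul, hC, proj_var, proj_var]
  · split_ifs with h
    · rw [h, var_of_le le_rfl, mul_zero]
    · exact var_of_le le_rfl

lemma simpleRefl_scale (c : K) {k j : ℕ} (h : j + 1 < k) (hj : 1 ≤ j) (f : P k) :
    simpleRefl k j h (scale c k f) = scale c k (simpleRefl k j h f) := by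
  have hC : simpleRefl k j h (C c) = C c := (simpleRefl k j h).commutes c
  rw [scale, comp_subst, subst_simpleRefl]
  refine subst_congr (fun i _ => ?_) _
  rw [apply_ite (simpleRefl k j h), map_mul, hC, simpleRefl_var, simpleRefl_var,
    Equiv.swap_apply_of_ne_of_ne (show 0 ≠ j by omega) (by omega)]
  by_cases hi : i = 0
  · subst hi
    rw [Equiv.swap_apply_of_ne_of_ne (by omega) (by omega), if_pos rfl]
  · have h1 : Equiv.swap j (j + 1) i ≠ 0 := by
      rw [Equiv.swap_apply_def]; split_ifs <;> omega
    rw [if_neg hi, if_neg h1]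

lemma exists_Pas_scale (c : K) (F : Pas) : ∃ G : Pas, ∀ k, G.1 k = scale c k (F.1 k) := by
  obtain ⟨d, hd⟩ := Pas_degree F
  obtain ⟨m, hm⟩ := Pas_symm F
  have hcomp : ∀ k, 0 ≤ k → proj k (scale c (k + 1) (F.1 (k + 1))) = scale c k (F.1 k) :=
    fun k _ => proj_scale c F k
  have hmem := lowExt_mem_Plevel (f := fun k => scale c k (F.1 k)) hcomp (d := d) (m := max m 1)
    (fun k _ => ?_) fun j hj k _ h => ?_
  · exact ⟨⟨_, Plevel_le_Pas _ hmem⟩,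
      fun k => lowExt_apply (f := fun k => scale c k (F.1 k)) hcomp (Nat.zero_le k)⟩
  · refine (totalDegree_subst_le _ (fun i => ?_) _).trans (hd k)
    split_ifs
    · refine (MvPolynomial.totalDegree_mul _ _).trans ?_
      simpa using totalDegree_var_le k 0
    · exact totalDegree_var_le _ _
  · rw [simpleRefl_scale c h (by omega), hm j (by omega)]

/-! ### Existence of the limit of the Cherednik operators -/

section Yconv

/-- The sequence `Y_0^{(k)} F_k` converges. -/
def Yconv (F : Pas) : Prop := ∃ G : Pas, SConv (fun k => opY k 0 (F.1 k)) G

lemma Yconv.add {F G : Pas} (hF : Yconv F) (hG : Yconv G) : Yconv (F + G) := by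
  obtain ⟨F', hF⟩ := hF
  obtain ⟨G', hG⟩ := hG
  exact ⟨_, (hF.add hG).congr (.of_forall fun k => (map_add (opY k 0) _ _).symm)⟩

lemma Yconv.smul {F : Pas} (c : K) (hF : Yconv F) : Yconv (c • F) := by
  obtain ⟨F', hF⟩ := hF
  exact ⟨_, (hF.smul c).congr (.of_forall fun k => (map_smul (opY k 0) _ _).symm)⟩

lemma opT_opY_zero {k j : ℕ} (h : j + 2 < k) (f : P k) :
    opT k (j + 1) (opY k 0 f) = opY k 0 (opT k (j + 1) f) := by
  apply toL_injective
  rw [← opTL_toL h, ← opYL_toL (by omega), ← opYL_toL (by omega), ← opTL_toL h]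
  exact DFunLike.congr_fun (opTL_mul_opYL_zero h) (toL k f)

lemma opY_zero_opT_opX {k : ℕ} (h : 1 < k) (f : P k) :
    opY k 0 (opT k 0 (opX k 0 f)) = opX k 1 (opY k 0 (opT k 0 f)) := by
  apply toL_injective
  rw [← opYL_toL (by omega), ← opTL_toL h, ← opXL_toL, ← opXL_toL, ← opYL_toL (by omega),
    ← opTL_toL h]
  exact DFunLike.congr_fun (opYL_cross h) (toL k f)

lemma opT_opX_opT {k i : ℕ} (h : i + 1 < k) (f : P k) :
    opT k i (opX k (i + 1) (opT k i f)) = t • opX k i f := by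
  apply toL_injective
  rw [← opTL_toL h, ← opXL_toL, ← opTL_toL h, map_smul, ← opXL_toL]
  exact DFunLike.congr_fun (opTL_mul_opXL_mul_opTL h) (toL k f)

/-- On fully symmetric functions the limit is zero. -/
lemma Yconv_of_symm {F : Pas} (hF : F.1 ∈ Plevel 0) : Yconv F := by
  obtain ⟨G, hG⟩ := exists_Pas_scale q F
  refine ⟨_, (SConv.of_scalar ScalarTendsTo.t_pow G).congr (.of_forall fun k => ?_)⟩
  rw [opY_zero_of_symm (fun j h => hF.2 j (Nat.zero_le j) k h), hG]

/-- On multiples of the first variable, the limit is an inverse limit. -/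
lemma exists_Pas_opY_zero {F : Pas} (hF : ∀ k, 1 ≤ k → var k 0 ∣ F.1 k) :
    ∃ G : Pas, ∀ k, 1 ≤ k → G.1 k = opY k 0 (F.1 k) := by
  obtain ⟨d, hd⟩ := Pas_degree F
  obtain ⟨m, hm⟩ := Pas_symm F
  have hcomp : ∀ k, 1 ≤ k → proj k (opY (k + 1) 0 (F.1 (k + 1))) = opY k 0 (F.1 k) := by
    intro k hk
    obtain ⟨n, rfl⟩ : ∃ n, k = n + 1 := ⟨k - 1, by omega⟩
    rw [proj_opY_zero (hF _ (by omega)), Pas_proj]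
  refine ⟨⟨_, Plevel_le_Pas (max m 1) (lowExt_mem_Plevel (f := fun k => opY k 0 (F.1 k)) hcomp
    (d := d) ?_ ?_)⟩, fun k hk => lowExt_apply (f := fun k => opY k 0 (F.1 k)) hcomp hk⟩
  · exact fun k _ => (totalDegree_opY_zero_le _).trans (hd k)
  · intro j hj k _ h
    obtain ⟨j, rfl⟩ : ∃ n, j = n + 1 := ⟨j - 1, by omega⟩
    rw [← opT_eq_self_iff h, opT_opY_zero h,
      (opT_eq_self_iff h _).mpr (hm (j + 1) (by omega) k h)]

lemma Yconv_of_var_dvd {F : Pas} (hF : ∀ k, 1 ≤ k → var k 0 ∣ F.1 k) : Yconv F := by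
  obtain ⟨G, hG⟩ := exists_Pas_opY_zero hF
  refine ⟨G, (SConv.const G).congr ?_⟩
  filter_upwards [eventually_ge_atTop 1] with k hk using hG k hk

lemma Yconv_XInf_zero (F : Pas) : Yconv (XInf 0 F) :=
  Yconv_of_var_dvd fun k _ => by
    rw [XInf_apply, opX_apply]
    exact dvd_mul_right _ _

lemma SConv_TInf (i : ℕ) (G : Pas) : SConv (fun k => opT k i (G.1 k)) (TInf i G) := by
  refine (SConv.const _).congr ?_
  filter_upwards [eventually_gt_atTop (i + 1)] with k hk using TInf_apply i G hk

lemma SConv_TinvInf (i : ℕ) (G : Pas) : SConv (fun k => opTinv k i (G.1 k)) (TinvInf i G) := by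
  refine (SConv.const _).congr ?_
  filter_upwards [eventually_gt_atTop (i + 1)] with k hk using TinvInf_apply i G hk

lemma SConv_XInf (i : ℕ) (G : Pas) : SConv (fun k => opX k i (G.1 k)) (XInf i G) :=
  (SConv.const _).congr (.of_forall (XInf_apply i G))

lemma Yconv_TinvInf_succ (j : ℕ) {F : Pas} (hF : Yconv F) : Yconv (TinvInf (j + 1) F) := by
  obtain ⟨G, hG⟩ := hF
  refine ⟨_, (hG.map (SConv_TinvInf (j + 1))).congr ?_⟩
  filter_upwards [eventually_gt_atTop (j + 2)] with k hk
  rw [TinvInf_apply _ _ hk]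
  exact (map_opTinv (φ := opY k 0) (opT_opY_zero hk _).symm).symm

/-- By the cross relation, `Y_0 T_0⁻¹ X_0` can be expressed by `X_1 Y_0 T_0` and `Y_0 X_0`. -/
lemma Yconv_TinvInf_zero {F : Pas} (hF : Yconv (TInf 0 F)) : Yconv (TinvInf 0 (XInf 0 F)) := by
  obtain ⟨G, hG⟩ := hF
  obtain ⟨G', hG'⟩ := Yconv_XInf_zero F
  refine ⟨_, (((hG.map (SConv_XInf 1)).add (hG'.smul (t - 1))).smul t⁻¹).congr ?_⟩
  filter_upwards [eventually_gt_atTop 1] with k hk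
  rw [TinvInf_apply _ _ hk, XInf_apply, TInf_apply _ _ hk, ← opY_zero_opT_opX hk, ← map_smul,
    ← map_add, ← map_smul]
  rfl

/-- Multiplication by `x_{m+1}` is conjugate to multiplication by `x_m`. -/
lemma XInf_succ (m : ℕ) (F : Pas) :
    XInf (m + 1) F = t • TinvInf m (XInf m (TinvInf m F)) := by
  refine Pas_ext_of_ge (m + 2) fun k hk => ?_
  change _ = t • (TinvInf m (XInf m (TinvInf m F))).1 k
  rw [TinvInf_apply _ _ hk, XInf_apply, XInf_apply, TinvInf_apply _ _ hk, ← map_smul,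
    ← opT_opX_opT hk, opTinv_opT, opT_opTinv]

/-- An almost symmetric function that is symmetric in the variables with index `> m` is the sum of
one that is symmetric in the variables with index `≥ m` and of a multiple of `x_m`. -/
lemma exists_decomposition {m : ℕ} {F : Pas} (hF : F.1 ∈ Plevel (m + 1)) {d : ℕ}
    (hd : ∀ k, (F.1 k).totalDegree ≤ d) :
    ∃ G H : Pas, G.1 ∈ Plevel m ∧ (∀ k, (G.1 k).totalDegree ≤ d) ∧
      (∀ k, H.1 k ≠ 0 → (H.1 k).totalDegree < d) ∧ F = G + XInf m H := by
  -- `G` is obtained from `F` by setting `x_m = 0` and shifting down the variables after `x_m`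
  let c : ∀ k, ℕ → P k := fun k i =>
    if i < m then var k i else if i = m then 0 else var k (i - 1)
  let g : ∀ k, P k := fun k => subst (c k) (k + 1) (F.1 (k + 1))
  have hc1 : ∀ k i, (c k i).totalDegree ≤ 1 := by
    intro k i
    simp only [c]
    split_ifs
    · exact totalDegree_var_le _ _
    · simp
    · exact totalDegree_var_le _ _
  have hgd : ∀ k, (g k).totalDegree ≤ d := fun k =>
    (totalDegree_subst_le _ (hc1 k) _).trans (hd _)
  have hg : ∀ k, 0 ≤ k → proj k (g (k + 1)) = g k := by
    intro k _
    simp only [g]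
    rw [comp_subst, ← Pas_proj F (k + 1), ← subst_succ]
    · refine subst_congr (fun i _ => ?_) _
      simp only [c, apply_ite (proj k), proj_var, map_zero]
    · simp only [c]
      split_ifs
      · exact var_of_le (by omega)
      · rfl
      · exact var_of_le (by omega)
  have hgs : ∀ j, m ≤ j → ∀ k, 0 ≤ k → ∀ h : j + 1 < k, simpleRefl k j h (g k) = g k := by
    intro j hj k _ h
    simp only [g]
    conv_rhs => rw [← hF.2 (j + 1) (by omega) (k + 1) (by omega)]
    rw [comp_subst, subst_simpleRefl]
    refine subst_congr (fun i _ => ?_) _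
    simp only [c, apply_ite (simpleRefl k j h), simpleRefl_var, map_zero]
    by_cases h1 : i = j + 1
    · subst h1
      rw [Equiv.swap_apply_left, if_neg (by omega), if_neg (by omega), if_neg (by omega),
        if_neg (by omega), Nat.add_sub_cancel, Equiv.swap_apply_left, Nat.add_sub_cancel]
    by_cases h2 : i = j + 1 + 1
    · subst h2
      rw [Equiv.swap_apply_right, if_neg (by omega), if_neg (by omega), if_neg (by omega),
        if_neg (by omega), Nat.add_sub_cancel, Equiv.swap_apply_right, Nat.add_sub_cancel]
    rw [Equiv.swap_apply_of_ne_of_ne h1 h2]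
    split_ifs with h3 h4
    · rw [Equiv.swap_apply_of_ne_of_ne (by omega) (by omega)]
    · rfl
    · rw [Equiv.swap_apply_of_ne_of_ne (by omega) (by omega)]
  have hdvd : ∀ k, m < k → var k m ∣ F.1 k - g k := by
    intro k hk
    rw [var_dvd_iff hk, map_sub, sub_eq_zero]
    have hF1 : kill k m (F.1 k) =
        subst (fun i => if i = m then 0 else var k i) (k + 1) (F.1 (k + 1)) := by
      rw [subst_succ, Pas_proj]
      · rfl
      · rw [if_neg (by omega), var_of_le le_rfl]
    -- after setting `x_m = 0`, the two zeros can be moved past each other by symmetry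
    have h2 : ∀ n, m ≤ n → n < k → kill k m (g k) = subst (fun i => if i = m then 0 else
        if i ≤ n then var k i else if i = n + 1 then 0 else var k (i - 1)) (k + 1)
          (F.1 (k + 1)) := by
      intro n hmn
      induction n, hmn using Nat.le_induction with
      | base =>
        intro _
        simp only [g]
        rw [comp_subst]
        refine subst_congr (fun i hi => ?_) _
        simp only [c, apply_ite (kill k m), map_zero]
        rcases lt_trichotomy i m with h | h | h
        · rw [if_pos h, if_neg (by omega), if_pos (by omega), kill_var (by omega),
            if_neg (by omega)]
        · rw [if_neg (by omega), if_pos h, if_pos h]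
        · rw [if_neg (by omega), if_neg (by omega), if_neg (by omega), if_neg (by omega),
            kill_var (by omega)]
          by_cases h' : i = m + 1
          · rw [if_pos (by omega), if_pos h']
          · rw [if_neg (by omega), if_neg h']
      | succ n hmn ih =>
        intro hn
        rw [ih (by omega)]
        conv_lhs => rw [← hF.2 (n + 1) (by omega) (k + 1) (by omega), subst_simpleRefl]
        refine subst_congr (fun i hi => ?_) _
        by_cases h1 : i = n + 1
        · subst h1
          rw [Equiv.swap_apply_left, Nat.add_sub_cancel]
          split_ifs <;> first | rfl | omega
        by_cases h2 : i = n + 1 + 1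
        · subst h2
          rw [Equiv.swap_apply_right]
          split_ifs <;> first | rfl | omega
        rw [Equiv.swap_apply_of_ne_of_ne h1 h2]
        split_ifs <;> first | rfl | omega
    rw [h2 (k - 1) (by omega) (by omega), hF1]
    refine subst_congr (fun i hi => ?_) _
    split_ifs <;> first | rfl | omega | exact var_of_le (show k ≤ i by omega)
  have hex : ∀ k, ∃ h : P k, m < k → F.1 k - g k = var k m * h := by
    intro k
    by_cases hk : m < k
    · obtain ⟨h, hh⟩ := hdvd k hk
      exact ⟨h, fun _ => hh⟩
    · exact ⟨0, fun h => absurd h hk⟩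
  choose h hh using hex
  have hcomp : ∀ k, m + 1 ≤ k → proj k (h (k + 1)) = h k := by
    intro k hk
    apply mul_left_cancel₀ (var_ne_zero (show m < k by omega))
    rw [← hh k hk, ← proj_var, ← map_mul, ← hh (k + 1) (by omega), map_sub, Pas_proj,
      hg k (Nat.zero_le k)]
  have hdeg : ∀ k, m + 1 ≤ k → h k ≠ 0 → (h k).totalDegree < d := by
    intro k hk h0
    have h1 := totalDegree_var_mul (show m < k by omega) h0
    rw [← hh k hk] at h1
    have h2 := (MvPolynomial.totalDegree_sub (F.1 k) (g k)).trans (max_le (hd k) (hgd k))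
    omega
  have hG := lowExt_mem_Plevel hg (fun k _ => hgd k) hgs
  have hG' : ∀ k, lowExt 0 g k = g k := fun k => lowExt_apply hg (Nat.zero_le k)
  have hH : lowExt (m + 1) h ∈ Plevel (m + 1) := by
    refine lowExt_mem_Plevel hcomp (d := d) (fun k hk => ?_) fun j hj k hk hjk => ?_
    · by_cases h0 : h k = 0
      · simp [h0]
      · exact (hdeg k hk h0).le
    · apply mul_left_cancel₀ (var_ne_zero (show m < k by omega))
      conv_lhs => rw [← simpleRefl_var_of_ne hjk (show m ≠ j by omega) (by omega)]
      rw [← map_mul, ← hh k hk, map_sub, hF.2 j (by omega), hgs j (by omega) k (Nat.zero_le k)]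
  refine ⟨⟨_, Plevel_le_Pas _ hG⟩, ⟨_, Plevel_le_Pas _ hH⟩, hG, fun k => ?_, fun k hk => ?_, ?_⟩
  · change (lowExt 0 g k).totalDegree ≤ d
    rw [hG']
    exact hgd k
  · have h1 : h (k + (m + 1)) ≠ 0 := by
      intro h0
      apply hk
      change projTo _ _ (h (k + (m + 1))) = 0
      rw [h0, map_zero]
    exact (totalDegree_projTo_le _ _ _).trans_lt (hdeg _ (by omega) h1)
  · refine Pas_ext_of_ge (m + 1) fun k hk => ?_
    change _ = lowExt 0 g k + (XInf m _).1 k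
    rw [hG', XInf_apply, opX_apply, ← sub_eq_iff_eq_add', hh k hk]
    congr 1
    exact (lowExt_apply hcomp hk).symm

lemma TinvInf_degree {d : ℕ} (i : ℕ) {F : Pas} (hF : ∀ k, F.1 k ≠ 0 → (F.1 k).totalDegree < d) :
    ∀ k, (TinvInf i F).1 k ≠ 0 → ((TinvInf i F).1 k).totalDegree < d := by
  intro k hk
  rw [← Pas_projTo _ (show k ≤ k + (i + 2) by omega), TinvInf_apply _ _ (by omega)] at hk ⊢
  have h0 : F.1 (k + (i + 2)) ≠ 0 := fun h => hk (by rw [h, map_zero, map_zero])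
  exact (totalDegree_projTo_le _ _ _).trans_lt ((totalDegree_opTinv_le _).trans_lt (hF _ h0))

lemma TInf_degree {d : ℕ} (i : ℕ) {F : Pas} (hF : ∀ k, F.1 k ≠ 0 → (F.1 k).totalDegree < d) :
    ∀ k, (TInf i F).1 k ≠ 0 → ((TInf i F).1 k).totalDegree < d := by
  intro k hk
  rw [← Pas_projTo _ (show k ≤ k + (i + 2) by omega), TInf_apply _ _ (by omega)] at hk ⊢
  have h0 : F.1 (k + (i + 2)) ≠ 0 := fun h => hk (by rw [h, map_zero, map_zero])
  exact (totalDegree_projTo_le _ _ _).trans_lt ((totalDegree_opT_le _).trans_lt (hF _ h0))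

/-- The first Cherednik operators converge on all almost symmetric functions. The proof is by
induction on the degree: the almost symmetric functions are generated by the symmetric ones under
multiplication by variables, and every variable is obtained from the first one by conjugation with
Demazure-Lusztig operators. -/
lemma Yconv_of_degree (d : ℕ) : ∀ F : Pas, (∀ k, F.1 k ≠ 0 → (F.1 k).totalDegree < d) →
    Yconv F := by
  induction d with
  | zero =>
    intro F hF
    have h0 : F = 0 := Subtype.ext (funext fun k => by
      by_contra h
      exact absurd (hF k h) (Nat.not_lt_zero _))
    rw [h0]
    exact ⟨0, by simpa using SConv.zero⟩
  | succ d ih =>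
    have h1 : ∀ m, ∀ G : Pas, (∀ k, G.1 k ≠ 0 → (G.1 k).totalDegree < d) → Yconv (XInf m G) := by
      intro m
      induction m with
      | zero => exact fun G _ => Yconv_XInf_zero G
      | succ m ihm =>
        intro G hG
        rw [XInf_succ]
        refine Yconv.smul t ?_
        have hG' := TinvInf_degree m hG
        cases m with
        | zero => exact Yconv_TinvInf_zero (ih _ (TInf_degree 0 hG'))
        | succ m => exact Yconv_TinvInf_succ m (ihm _ hG')
    have h2 : ∀ m, ∀ F : Pas, F.1 ∈ Plevel m → (∀ k, (F.1 k).totalDegree ≤ d) → Yconv F := by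
      intro m
      induction m with
      | zero => exact fun F hF _ => Yconv_of_symm hF
      | succ m ihm =>
        intro F hF hd
        obtain ⟨G, H, hG, hGd, hHd, rfl⟩ := exists_decomposition hF hd
        exact (ihm G hG hGd).add (h1 m H hHd)
    intro F hF
    obtain ⟨m, hm⟩ := F.2
    refine h2 m F hm fun k => ?_
    by_cases h0 : F.1 k = 0
    · simp [h0]
    · exact Nat.le_of_lt_succ (hF k h0)

lemma Yconv_all (F : Pas) : Yconv F := by
  obtain ⟨d, hd⟩ := Pas_degree F
  exact Yconv_of_degree (d + 1) F fun k _ => Nat.lt_succ_of_le (hd k)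

end Yconv

/-- The limits of the Cherednik operators. -/
def YInf : ℕ → Module.End K Pas
  | 0 =>
    { toFun := fun F => (Yconv_all F).choose
      map_add' := fun F G => (Yconv_all (F + G)).choose_spec.unique
        (((Yconv_all F).choose_spec.add (Yconv_all G).choose_spec).congr
          (.of_forall fun k => (map_add (opY k 0) _ _).symm))
      map_smul' := fun c F => (Yconv_all (c • F)).choose_spec.unique
        (((Yconv_all F).choose_spec.smul c).congr
          (.of_forall fun k => (map_smul (opY k 0) _ _).symm)) }
  | j + 1 => t⁻¹ • (TInf j * YInf j * TInf j)

lemma SConv_YInf (j : ℕ) (F : Pas) : SConv (fun k => opY k j (F.1 k)) (YInf j F) := by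
  induction j generalizing F with
  | zero => exact (Yconv_all F).choose_spec
  | succ j ih =>
    refine (((ih (TInf j F)).map (SConv_TInf j)).smul t⁻¹).congr ?_
    filter_upwards [eventually_gt_atTop (j + 1)] with k hk
    rw [opY_succ hk, TInf_apply _ _ hk]
    rfl

/-- The deformed Cherednik operators have the same limits. -/
lemma SConv_opYtilde (j : ℕ) (F : Pas) :
    SConv (fun k => opYtilde k j (F.1 k)) (YInf j F) := by
  induction j generalizing F with
  | zero =>
    obtain ⟨G, hG⟩ := exists_Pas_scale 0 F
    have h1 := (SConv_YInf 0 F).add ((SConv.of_scalar ScalarTendsTo.t_pow G).smul (-1))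
    rw [zero_smul, smul_zero, add_zero] at h1
    refine h1.congr ?_
    filter_upwards [eventually_gt_atTop 0] with k hk
    have h2 : G.1 k = kill k 0 (F.1 k) := by
      rw [hG, kill, scale]
      refine subst_congr (fun i _ => ?_) _
      rw [map_zero, zero_mul]
    rw [h2, ← opY_zero_sub_opYtilde_zero hk, neg_one_smul, ← sub_eq_add_neg, sub_sub_cancel]
  | succ j ih =>
    refine (((ih (TInf j F)).map (SConv_TInf j)).smul t⁻¹).congr ?_
    filter_upwards [eventually_gt_atTop (j + 1)] with k hk
    rw [opYtilde_eq_conjY, opYtilde_eq_conjY, conjY_succ _ hk, TInf_apply _ _ hk]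
    rfl

/-! ### The standard representation -/

/-- The morphism from the free algebra on the generators of `ℋ⁺` to `ℋₖ` that maps each of the
generators of level `k` to the generator with the same name, and the others to `0`. -/
def toDAHA (k : ℕ) : FreeAlgebra K StableGen →ₐ[K] DAHA k :=
  open Classical in
  FreeAlgebra.lift K fun x => if h : genOfLevel k x then gen (toGen x h) else 0

lemma toDAHA_ι {k : ℕ} {x : StableGen} (h : genOfLevel k x) :
    toDAHA k (FreeAlgebra.ι K x) = gen (toGen x h) := by
  simp [toDAHA, h]

lemma toDAHA_ι_of_not {k : ℕ} {x : StableGen} (h : ¬ genOfLevel k x) :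
    toDAHA k (FreeAlgebra.ι K x) = 0 := by
  simp [toDAHA, h]

lemma mkAlgHom_eq {k : ℕ} {x y : FreeAlgebra K (Gen k)} (h : Rel k x y) :
    RingQuot.mkAlgHom K (Rel k) x = RingQuot.mkAlgHom K (Rel k) y := RingQuot.mkAlgHom_rel K h

lemma toDAHA_T {k i : ℕ} (h : i + 1 < k) : toDAHA k (FreeAlgebra.ι K (.T i)) =
    RingQuot.mkAlgHom K (Rel k) (FreeAlgebra.ι K (.T i h)) := toDAHA_ι (x := .T i) h

lemma toDAHA_X {k i : ℕ} (h : i < k) : toDAHA k (FreeAlgebra.ι K (.X i)) =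
    RingQuot.mkAlgHom K (Rel k) (FreeAlgebra.ι K (.X i h)) := toDAHA_ι (x := .X i) h

lemma toDAHA_Y {k i : ℕ} (h : i < k) : toDAHA k (FreeAlgebra.ι K (.Y i)) =
    RingQuot.mkAlgHom K (Rel k) (FreeAlgebra.ι K (.Y i h)) := toDAHA_ι (x := .Y i) h

/-- Each defining relation of `ℋ⁺` holds in `ℋₖ` for large `k`. -/
lemma eventually_toDAHA_eq {x y : FreeAlgebra K StableGen} (h : StableRel x y) :
    ∀ᶠ k in atTop, toDAHA k x = toDAHA k y := by
  cases h with
  | T_comm i j h =>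
    filter_upwards [eventually_gt_atTop (i + j + 2)] with k hk
    rw [map_mul, map_mul, toDAHA_T (show i + 1 < k by omega), toDAHA_T (show j + 1 < k by omega),
      ← map_mul, ← map_mul]
    exact mkAlgHom_eq (.T_comm i j _ _ h)
  | braid i =>
    filter_upwards [eventually_gt_atTop (i + 2)] with k hk
    simp only [map_mul, toDAHA_T (show i + 1 < k by omega), toDAHA_T (show i + 1 + 1 < k by omega)]
    simp only [← map_mul]
    exact mkAlgHom_eq (.braid i _ _)
  | quadratic i =>
    filter_upwards [eventually_gt_atTop (i + 2)] with k hk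
    have h1 := mkAlgHom_eq (.quadratic i (show i + 1 < k by omega))
    rw [map_mul, map_sub, map_add, map_one, AlgHom.commutes, map_zero] at h1 ⊢
    rw [toDAHA_T (show i + 1 < k by omega)]
    exact h1
  | X_succ i =>
    filter_upwards [eventually_gt_atTop (i + 2)] with k hk
    simp only [map_mul, map_smul, toDAHA_T (show i + 1 < k by omega),
      toDAHA_X (show i < k by omega), toDAHA_X (show i + 1 < k by omega)]
    simp only [← map_mul, ← map_smul]
    exact mkAlgHom_eq (.X_succ i _ _)
  | T_X i j h h' =>
    filter_upwards [eventually_gt_atTop (i + j + 2)] with k hk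
    rw [map_mul, map_mul, toDAHA_T (show i + 1 < k by omega), toDAHA_X (show j < k by omega),
      ← map_mul, ← map_mul]
    exact mkAlgHom_eq (.T_X i j _ _ h h')
  | X_comm i j =>
    filter_upwards [eventually_gt_atTop (i + j + 2)] with k hk
    rw [map_mul, map_mul, toDAHA_X (show i < k by omega), toDAHA_X (show j < k by omega),
      ← map_mul, ← map_mul]
    exact mkAlgHom_eq (.X_comm i j _ _)
  | Y_succ i =>
    filter_upwards [eventually_gt_atTop (i + 2)] with k hk
    simp only [map_mul, map_smul, toDAHA_T (show i + 1 < k by omega),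
      toDAHA_Y (show i < k by omega), toDAHA_Y (show i + 1 < k by omega)]
    simp only [← map_mul, ← map_smul]
    exact mkAlgHom_eq (.Y_succ i _ _)
  | T_Y i j h h' =>
    filter_upwards [eventually_gt_atTop (i + j + 2)] with k hk
    rw [map_mul, map_mul, toDAHA_T (show i + 1 < k by omega), toDAHA_Y (show j < k by omega),
      ← map_mul, ← map_mul]
    exact mkAlgHom_eq (.T_Y i j _ _ h h')
  | Y_comm i j =>
    filter_upwards [eventually_gt_atTop (i + j + 2)] with k hk
    rw [map_mul, map_mul, toDAHA_Y (show i < k by omega), toDAHA_Y (show j < k by omega),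
      ← map_mul, ← map_mul]
    exact mkAlgHom_eq (.Y_comm i j _ _)
  | cross =>
    filter_upwards [eventually_gt_atTop 2] with k hk
    simp only [map_mul, toDAHA_T (show 0 + 1 < k by omega), toDAHA_Y (show 0 < k by omega),
      toDAHA_X (show 0 < k by omega), toDAHA_X (show 1 < k by omega)]
    simp only [← map_mul]
    exact mkAlgHom_eq (.cross (by omega) (by omega))

/-- The operators on the polynomials in `k` variables by which the generators of level `k` act. -/
def genP (k : ℕ) : StableGen → Module.End K (P k)
  | .T i => if i + 1 < k then opT k i else 0
  | .X i => opX k i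
  | .Y i => if i < k then opY k i else 0

/-- The action of the free algebra on the polynomials in `k` variables. -/
def actP (k : ℕ) : FreeAlgebra K StableGen →ₐ[K] Module.End K (P k) :=
  FreeAlgebra.lift K (genP k)

/-- The action on polynomials factors through the representation of `ℋₖ`. -/
lemma toL_actP (k : ℕ) (H : FreeAlgebra K StableGen) (f : P k) :
    toL k (actP k H f) = repL k (toDAHA k H) (toL k f) := by
  induction H using FreeAlgebra.induction generalizing f with
  | grade0 c => simp
  | grade1 x =>
    rw [actP, FreeAlgebra.lift_ι_apply]
    by_cases h : genOfLevel k x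
    · rw [toDAHA_ι h, repL_gen]
      cases x with
      | T i =>
        have h' : i + 1 < k := h
        rw [genP, if_pos h']
        exact (opTL_toL h' f).symm
      | X i => exact (opXL_toL i f).symm
      | Y i =>
        have h' : i < k := h
        rw [genP, if_pos h']
        exact (opYL_toL h' f).symm
    · rw [toDAHA_ι_of_not h, map_zero, LinearMap.zero_apply]
      cases x with
      | T i =>
        have h' : ¬ i + 1 < k := h
        rw [genP, if_neg h', LinearMap.zero_apply, map_zero]
      | X i =>
        have h' : ¬ i < k := h
        rw [genP, opX_apply, var_of_le (by omega), zero_mul, map_zero]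
      | Y i =>
        have h' : ¬ i < k := h
        rw [genP, if_neg h', LinearMap.zero_apply, map_zero]
  | mul a b ha hb => rw [map_mul, map_mul, map_mul, Module.End.mul_apply, ha, hb]; rfl
  | add a b ha hb =>
    rw [map_add, map_add, map_add, LinearMap.add_apply, map_add, ha, hb]; rfl

lemma actP_eq_of_toDAHA_eq {k : ℕ} {H H' : FreeAlgebra K StableGen}
    (h : toDAHA k H = toDAHA k H') : actP k H = actP k H' :=
  LinearMap.ext fun f => toL_injective (by rw [toL_actP, toL_actP, h])

/-- The limit operators by which the generators of `ℋ⁺` act on the almost symmetric module. -/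
def genInf : StableGen → Module.End K Pas
  | .T i => TInf i
  | .X i => XInf i
  | .Y i => YInf i

/-- The action of the free algebra on the almost symmetric module. -/
def actInf : FreeAlgebra K StableGen →ₐ[K] Module.End K Pas := FreeAlgebra.lift K genInf

lemma SConv_act (H : FreeAlgebra K StableGen) (F : Pas) :
    SConv (fun k => actP k H (F.1 k)) (actInf H F) := by
  induction H using FreeAlgebra.induction generalizing F with
  | grade0 c => simpa using (SConv.const F).smul c
  | grade1 x =>
    simp only [actP, actInf, FreeAlgebra.lift_ι_apply]
    cases x with
    | T i =>
      refine (SConv_TInf i F).congr ?_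
      filter_upwards [eventually_gt_atTop (i + 1)] with k hk
      rw [genP, if_pos hk]
    | X i => exact SConv_XInf i F
    | Y i =>
      refine (SConv_YInf i F).congr ?_
      filter_upwards [eventually_gt_atTop i] with k hk
      rw [genP, if_pos hk]
  | mul a b ha hb =>
    simp only [map_mul]
    have h := (hb F).map ha
    exact h
  | add a b ha hb =>
    simp only [map_add]
    exact (ha F).add (hb F)

/-- Identities that hold in `ℋₖ` for large `k` hold on the almost symmetric module. -/
lemma actInf_eq_of_eventually {H H' : FreeAlgebra K StableGen}
    (h : ∀ᶠ k in atTop, toDAHA k H = toDAHA k H') : actInf H = actInf H' := by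
  refine LinearMap.ext fun F => (SConv_act H F).unique ((SConv_act H' F).congr ?_)
  filter_upwards [h] with k hk
  rw [actP_eq_of_toDAHA_eq hk]

/-- The standard representation of `ℋ⁺`. -/
def stdRep : StableDAHA →ₐ[K] Module.End K Pas :=
  RingQuot.liftAlgHom K ⟨actInf, fun _ _ h => actInf_eq_of_eventually (eventually_toDAHA_eq h)⟩

lemma stdRep_mk (H : FreeAlgebra K StableGen) :
    stdRep (RingQuot.mkAlgHom K StableRel H) = actInf H :=
  RingQuot.liftAlgHom_mkAlgHom_apply K _ _ H

lemma stdRep_sgen (x : StableGen) : stdRep (sgen x) = genInf x := by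
  rw [sgen, stdRep_mk, actInf, FreeAlgebra.lift_ι_apply]

lemma isStandardRep_stdRep : IsStandardRep stdRep where
  T_apply i f k h := by
    rw [stdRep_sgen]
    exact TInf_apply i f h
  X_apply i f k h := by
    rw [stdRep_sgen]
    exact XInf_apply i f k
  Y_apply i f := by
    rw [stdRep_sgen]
    exact (SConv_opYtilde i f).convergesTo

lemma IsStandardRep.eq {ρ ρ' : StableDAHA →ₐ[K] Module.End K Pas} (h : IsStandardRep ρ)
    (h' : IsStandardRep ρ') : ρ = ρ' := by
  refine RingQuot.ringQuot_ext' K _ _ (FreeAlgebra.hom_ext (funext fun x => ?_))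
  change ρ (sgen x) = ρ' (sgen x)
  refine LinearMap.ext fun F => ?_
  cases x with
  | T i =>
    refine Pas_ext_of_ge (i + 2) fun k hk => ?_
    rw [h.T_apply i F k hk, h'.T_apply i F k hk]
  | X i =>
    refine Pas_ext_of_ge (i + 1) fun k hk => ?_
    rw [h.X_apply i F k hk, h'.X_apply i F k hk]
  | Y i => exact Subtype.ext ((h.Y_apply i F).unique (h'.Y_apply i F))

/-! ### Restriction to the multiples of `x_0 ⋯ x_{k-1}` -/

/-- The operator `Φ` on the almost symmetric module preserves the functions that are divisible by
the first `k` variables, and induces on their images in `𝒫ₖ⁺` the operator `φ`. -/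
def Restricts (k : ℕ) (Φ : Module.End K Pas) (φ : Module.End K (P k)) : Prop :=
  ∀ F : Pas, (∀ n, k ≤ n → ∀ i < k, var n i ∣ F.1 n) →
    (∀ n, k ≤ n → ∀ i < k, var n i ∣ (Φ F).1 n) ∧ (Φ F).1 k = φ (F.1 k)

lemma Restricts.mul {k : ℕ} {Φ Ψ : Module.End K Pas} {φ ψ : Module.End K (P k)}
    (h : Restricts k Φ φ) (h' : Restricts k Ψ ψ) : Restricts k (Φ * Ψ) (φ * ψ) := by
  intro F hF
  obtain ⟨h1, h2⟩ := h' F hF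
  obtain ⟨h3, h4⟩ := h _ h1
  exact ⟨h3, by rw [Module.End.mul_apply, h4, h2]; rfl⟩

lemma Restricts.add {k : ℕ} {Φ Ψ : Module.End K Pas} {φ ψ : Module.End K (P k)}
    (h : Restricts k Φ φ) (h' : Restricts k Ψ ψ) : Restricts k (Φ + Ψ) (φ + ψ) := by
  intro F hF
  obtain ⟨h1, h2⟩ := h' F hF
  obtain ⟨h3, h4⟩ := h F hF
  refine ⟨fun n hn i hi => dvd_add (h3 n hn i hi) (h1 n hn i hi), ?_⟩
  change (Φ F).1 k + (Ψ F).1 k = _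
  rw [h2, h4]
  rfl

lemma Restricts.smul {k : ℕ} {Φ : Module.End K Pas} {φ : Module.End K (P k)} (c : K)
    (h : Restricts k Φ φ) : Restricts k (c • Φ) (c • φ) := by
  intro F hF
  obtain ⟨h3, h4⟩ := h F hF
  refine ⟨fun n hn i hi => ?_, ?_⟩
  · change _ ∣ c • (Φ F).1 n
    rw [MvPolynomial.smul_eq_C_mul]
    exact (h3 n hn i hi).mul_left _
  · change c • (Φ F).1 k = _
    rw [h4]
    rfl

lemma Restricts.one (k : ℕ) : Restricts k 1 1 := fun _ hF => ⟨hF, rfl⟩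

lemma restricts_TInf {k i : ℕ} (h : i + 1 < k) : Restricts k (TInf i) (opT k i) := by
  intro F hF
  refine ⟨fun n hn j hj => ?_, TInf_apply i F h⟩
  rw [TInf_apply i F (by omega)]
  exact (var_dvd_opT (by omega) (hF n hn j hj) fun _ =>
    ⟨hF n hn i (by omega), hF n hn (i + 1) h⟩).1

lemma restricts_XInf {k i : ℕ} : Restricts k (XInf i) (opX k i) := by
  intro F hF
  refine ⟨fun n hn j hj => ?_, XInf_apply i F k⟩
  rw [XInf_apply, opX_apply]
  exact (hF n hn j hj).mul_left _

lemma restricts_YInf {k i : ℕ} (h : i < k) : Restricts k (YInf i) (opY k i) := by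
  induction i with
  | zero =>
    intro F hF
    -- on multiples of the first variable the Cherednik operators are compatible
    have h1 : ∀ n, k ≤ n → proj n (opY (n + 1) 0 (F.1 (n + 1))) = opY n 0 (F.1 n) := by
      intro n hn
      obtain ⟨m, rfl⟩ : ∃ m, n = m + 1 := ⟨n - 1, by omega⟩
      rw [proj_opY_zero (hF _ (by omega) 0 h), Pas_proj]
    have h2 : ∀ n, k ≤ n → (YInf 0 F).1 n = opY n 0 (F.1 n) := fun n hn =>
      (SConv_YInf 0 F).apply_of_compatible h1 hn
    refine ⟨fun n hn j hj => ?_, h2 k le_rfl⟩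
    rw [h2 n hn]
    exact var_dvd_opY_zero h hn (hF n hn) j hj
  | succ i ih =>
    rw [YInf, opY_succ h]
    exact (((restricts_TInf h).mul (ih (by omega))).mul (restricts_TInf h)).smul _

/-- The subalgebra of the free algebra generated by the generators of level `k`. -/
def freeLevel (k : ℕ) : Subalgebra K (FreeAlgebra K StableGen) :=
  Algebra.adjoin K (FreeAlgebra.ι K '' {x | genOfLevel k x})

lemma restricts_act {k : ℕ} {H : FreeAlgebra K StableGen} (hH : H ∈ freeLevel k) :
    Restricts k (actInf H) (actP k H) := by
  induction hH using Algebra.adjoin_induction with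
  | mem H hH =>
    obtain ⟨x, hx, rfl⟩ := hH
    simp only [actP, actInf, FreeAlgebra.lift_ι_apply]
    cases x with
    | T i =>
      have h' : i + 1 < k := hx
      rw [genP, if_pos h']
      exact restricts_TInf h'
    | X i => exact restricts_XInf
    | Y i =>
      have h' : i < k := hx
      rw [genP, if_pos h']
      exact restricts_YInf h'
  | algebraMap c =>
    rw [AlgHom.commutes, AlgHom.commutes, Algebra.algebraMap_eq_smul_one,
      Algebra.algebraMap_eq_smul_one]
    exact (Restricts.one k).smul c
  | add a b _ _ ha hb => simpa only [map_add] using ha.add hb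
  | mul a b _ _ ha hb => simpa only [map_mul] using ha.mul hb

/-- An element of level `k` that acts by zero on the almost symmetric module acts by zero on the
polynomials in `k` variables that are divisible by all variables. -/
lemma actP_eq_zero {k : ℕ} {H : FreeAlgebra K StableGen} (hH : H ∈ freeLevel k)
    (h0 : actInf H = 0) {f : P k} (hf : ∀ i < k, var k i ∣ f) : actP k H f = 0 := by
  -- the polynomial `f`, seen as an almost symmetric function
  have hmem : (fun n => projTo k n f) ∈ Plevel k := by
    refine ⟨⟨fun n => ?_, f.totalDegree, fun n => totalDegree_projTo_le k n f⟩, fun j hj n h => ?_⟩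
    · rw [proj_eq_projTo, projTo_projTo (Or.inl (Nat.le_succ n))]
    · refine algHom_apply_eq (φ := (simpleRefl n j h).comp (projTo k n)) (fun i hi => ?_) f
      rw [AlgHom.comp_apply, projTo_var hi, simpleRefl_var_of_ne h (by omega) (by omega)]
  have h1 := (restricts_act hH ⟨_, Plevel_le_Pas k hmem⟩ fun n hn i hi => ?_).2
  · rw [h0] at h1
    change 0 = actP k H (projTo k k f) at h1
    rw [projTo_self] at h1
    exact h1.symm
  · have := map_dvd (projTo k n) (hf i hi)
    rwa [projTo_var hi] at this

/-! ### Spanning sets of algebras -/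

section Span
variable {𝕜 A : Type*} [Field 𝕜] [Semiring A] [Algebra 𝕜 A]

/-- If `a x ∈ span u * adjoin s` for `a ∈ s` and `x ∈ u`, then all elements of `adjoin s` can be
moved to the right of those of `adjoin u`. -/
lemma adjoin_mul_adjoin_le {s u : Set A}
    (h : ∀ a ∈ s, ∀ x ∈ u,
      a * x ∈ Submodule.span 𝕜 u * Subalgebra.toSubmodule (Algebra.adjoin 𝕜 s)) :
    Subalgebra.toSubmodule (Algebra.adjoin 𝕜 s) * Subalgebra.toSubmodule (Algebra.adjoin 𝕜 u) ≤
      Subalgebra.toSubmodule (Algebra.adjoin 𝕜 u) *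
        Subalgebra.toSubmodule (Algebra.adjoin 𝕜 s) := by
  set B := Subalgebra.toSubmodule (Algebra.adjoin 𝕜 s) with hB
  set U := Subalgebra.toSubmodule (Algebra.adjoin 𝕜 u) with hU
  have hBB : B * B ≤ B := (Subalgebra.isIdempotentElem_toSubmodule (Algebra.adjoin 𝕜 s)).le
  have hUU : U * U ≤ U := (Subalgebra.isIdempotentElem_toSubmodule (Algebra.adjoin 𝕜 u)).le
  have h1B : (1 : A) ∈ B := (Algebra.adjoin 𝕜 s).one_mem
  have h1U : (1 : A) ∈ U := (Algebra.adjoin 𝕜 u).one_mem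
  have hspan : Submodule.span 𝕜 u ≤ U := Algebra.span_le_adjoin 𝕜 u
  have h1 : ∀ b ∈ Algebra.adjoin 𝕜 s, ∀ v ∈ Submodule.span 𝕜 u,
      b * v ∈ Submodule.span 𝕜 u * B := by
    intro b hb
    induction hb using Algebra.adjoin_induction with
    | mem a ha =>
      intro v hv
      induction hv using Submodule.span_induction with
      | mem x hx => exact h a ha x hx
      | zero => simp
      | add v w _ _ hv hw => rw [mul_add]; exact add_mem hv hw
      | smul c v _ hv => rw [mul_smul_comm]; exact Submodule.smul_mem _ _ hv
    | algebraMap c =>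
      intro v hv
      rw [← Algebra.smul_def]
      have := Submodule.mul_mem_mul (Submodule.smul_mem _ c hv) h1B
      rwa [mul_one] at this
    | add a b _ _ ha hb => intro v hv; rw [add_mul]; exact add_mem (ha v hv) (hb v hv)
    | mul a b _ _ ha hb =>
      intro v hv
      rw [mul_assoc]
      have h2 : ∀ z ∈ Submodule.span 𝕜 u * B, a * z ∈ Submodule.span 𝕜 u * B := by
        intro z hz
        induction hz using Submodule.mul_induction_on' with
        | mem_mul_mem v hv b hb =>
          rw [← mul_assoc]
          have := Submodule.mul_mem_mul (ha v hv) hb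
          rw [mul_assoc (Submodule.span 𝕜 u)] at this
          exact mul_le_mul_right hBB _ this
        | add x _ y _ hx hy => rw [mul_add]; exact add_mem hx hy
      exact h2 _ (hb v hv)
  have h2 : ∀ p ∈ Algebra.adjoin 𝕜 u, ∀ b ∈ B, b * p ∈ U * B := by
    intro p hp
    induction hp using Algebra.adjoin_induction with
    | mem x hx =>
      intro b hb
      exact mul_le_mul_left hspan B (h1 b hb x (Submodule.subset_span hx))
    | algebraMap c =>
      intro b hb
      rw [← Algebra.commutes, ← Algebra.smul_def]
      have := Submodule.mul_mem_mul h1U (Submodule.smul_mem _ c hb)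
      rwa [one_mul] at this
    | add a b _ _ ha hb => intro v hv; rw [mul_add]; exact add_mem (ha v hv) (hb v hv)
    | mul p p' _ _ hp hp' =>
      intro b hb
      rw [← mul_assoc]
      have h3 : ∀ z ∈ U * B, z * p' ∈ U * B := by
        intro z hz
        induction hz using Submodule.mul_induction_on' with
        | mem_mul_mem v hv b hb =>
          rw [mul_assoc]
          have := Submodule.mul_mem_mul hv (hp' b hb)
          rw [← mul_assoc] at this
          exact mul_le_mul_left hUU _ this
        | add x _ y _ hx hy => rw [add_mul]; exact add_mem hx hy
      exact h3 _ (hp b hb)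
  exact Submodule.mul_le.mpr fun b hb p hp => h2 p hp b hb

/-- A submodule that contains `1` and is stable under left multiplication by generators contains
the algebra that they generate. -/
lemma adjoin_le_of_mul_mem {s : Set A} {W : Submodule 𝕜 A} (h1 : 1 ∈ W)
    (h : ∀ a ∈ s, ∀ w ∈ W, a * w ∈ W) : Subalgebra.toSubmodule (Algebra.adjoin 𝕜 s) ≤ W := by
  have key : ∀ a ∈ Algebra.adjoin 𝕜 s, ∀ w ∈ W, a * w ∈ W := by
    intro a ha
    induction ha using Algebra.adjoin_induction with
    | mem a ha => exact h a ha
    | algebraMap c => intro w hw; rw [← Algebra.smul_def]; exact W.smul_mem c hw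
    | add a b _ _ ha hb => intro w hw; rw [add_mul]; exact add_mem (ha w hw) (hb w hw)
    | mul a b _ _ ha hb => intro w hw; rw [mul_assoc]; exact ha _ (hb w hw)
  intro a ha
  simpa using key a ha 1 h1

/-- The version of `adjoin_le_of_mul_mem` for right multiplication. -/
lemma adjoin_le_of_mul_mem_right {s : Set A} {W : Submodule 𝕜 A} (h1 : 1 ∈ W)
    (h : ∀ a ∈ s, ∀ w ∈ W, w * a ∈ W) : Subalgebra.toSubmodule (Algebra.adjoin 𝕜 s) ≤ W := by
  have key : ∀ a ∈ Algebra.adjoin 𝕜 s, ∀ w ∈ W, w * a ∈ W := by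
    intro a ha
    induction ha using Algebra.adjoin_induction with
    | mem a ha => exact h a ha
    | algebraMap c =>
      intro w hw; rw [← Algebra.commutes, ← Algebra.smul_def]; exact W.smul_mem c hw
    | add a b _ _ ha hb => intro w hw; rw [mul_add]; exact add_mem (ha w hw) (hb w hw)
    | mul a b _ _ ha hb => intro w hw; rw [← mul_assoc]; exact hb _ (ha w hw)
  intro a ha
  simpa using key a ha 1 h1

/-- The monomial in the elements `z i` with exponents given by a multiset of indices. The factors
are ordered arbitrarily, which is harmless for commuting elements. -/
def mword {n : ℕ} (z : ℕ → A) (s : Multiset (Fin n)) : A := (s.toList.map fun i : Fin n => z i).prod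

@[simp] lemma mword_zero {n : ℕ} (z : ℕ → A) : mword z (0 : Multiset (Fin n)) = 1 := by
  simp [mword]

lemma mword_cons {n : ℕ} {z : ℕ → A} (hz : ∀ i < n, ∀ j < n, z i * z j = z j * z i) (i : Fin n)
    (s : Multiset (Fin n)) : mword z (i ::ₘ s) = z i * mword z s := by
  have h1 : ((i ::ₘ s).toList).Perm (i :: s.toList) := by
    rw [← Multiset.coe_eq_coe, Multiset.coe_toList, ← Multiset.cons_coe, Multiset.coe_toList]
  have h2 := (h1.map fun i : Fin n => z i).prod_eq' ?_
  · rw [mword, h2, List.map_cons, List.prod_cons]; rfl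
  · exact List.pairwise_map.mpr (List.pairwise_of_forall fun a b => hz a a.2 b b.2)

/-- An algebra that is generated by commuting elements is spanned by the monomials in them. -/
lemma adjoin_le_span_mword {n : ℕ} {z : ℕ → A} (hz : ∀ i < n, ∀ j < n, z i * z j = z j * z i) :
    Subalgebra.toSubmodule (Algebra.adjoin 𝕜 (z '' {i | i < n})) ≤
      Submodule.span 𝕜 (Set.range (mword z : Multiset (Fin n) → A)) := by
  refine adjoin_le_of_mul_mem (Submodule.subset_span ⟨0, mword_zero z⟩) ?_
  rintro _ ⟨i, hi, rfl⟩ w hw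
  induction hw using Submodule.span_induction with
  | mem w hw =>
    obtain ⟨s, rfl⟩ := hw
    exact Submodule.subset_span ⟨⟨i, hi⟩ ::ₘ s, mword_cons hz ⟨i, hi⟩ s⟩
  | zero => simp
  | add v w _ _ hv hw => rw [mul_add]; exact add_mem hv hw
  | smul c v _ hv => rw [mul_smul_comm]; exact Submodule.smul_mem _ _ hv

/-- Codes for the elements of the symmetric group on `n + 1` letters: the last entry `l` stands for
the coset of the cycle `s_n s_{n-1} ⋯` with `l` factors. -/
def Code : ℕ → Type
  | 0 => Unit
  | n + 1 => Code n × Fin (n + 2)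

/-- The descending product `T_n T_{n-1} ⋯` with `l` factors. -/
def desc {M : Type*} [Monoid M] (T : ℕ → M) (n : ℕ) : ℕ → M
  | 0 => 1
  | l + 1 => desc T n l * T (n - l)

/-- The standard word in the generators `T_i` with a given code. -/
def codeWord {M : Type*} [Monoid M] (T : ℕ → M) : ∀ n, Code n → M
  | 0, _ => 1
  | n + 1, c => codeWord T n c.1 * desc T n c.2

variable {T : ℕ → A}

lemma mul_desc_of_lt (hcomm : ∀ i j, i + 1 < j → T i * T j = T j * T i) {n l i : ℕ}
    (h : i + l < n) : T i * desc T n l = desc T n l * T i := by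
  induction l with
  | zero => simp [desc]
  | succ l ih =>
    rw [desc, ← mul_assoc, ih (by omega), mul_assoc, hcomm i (n - l) (by omega), mul_assoc]

/-- The product `T_n T_{n-1} ⋯` shifts down those generators whose index is large enough. -/
lemma desc_mul_of_gt (hcomm : ∀ i j, i + 1 < j → T i * T j = T j * T i)
    (hbraid : ∀ i, T i * T (i + 1) * T i = T (i + 1) * T i * T (i + 1)) {n l i : ℕ}
    (h : n + 1 ≤ i + l) (hl : l ≤ n + 1) (hi : i + 1 ≤ n) :
    desc T n l * T (i + 1) = T i * desc T n l := by
  induction l with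
  | zero => omega
  | succ l ih =>
    rcases lt_or_ge n (i + l) with h' | h'
    · rw [desc, mul_assoc, hcomm (n - l) (i + 1) (by omega), ← mul_assoc, ih (by omega) (by omega),
        mul_assoc]
    · obtain ⟨l, rfl⟩ : ∃ m, l = m + 1 := ⟨l - 1, by omega⟩
      have h1 : n - (l + 1) = i := by omega
      have h2 : n - l = i + 1 := by omega
      rw [desc, desc, h1, h2, mul_assoc, mul_assoc, ← mul_assoc (T (i + 1)), ← hbraid,
        ← mul_assoc, ← mul_assoc, ← mul_desc_of_lt hcomm (by omega)]
      simp only [mul_assoc]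

/-- The finite Hecke algebra is spanned by the standard words. -/
lemma codeWord_mul_mem (hcomm : ∀ i j, i + 1 < j → T i * T j = T j * T i)
    (hbraid : ∀ i, T i * T (i + 1) * T i = T (i + 1) * T i * T (i + 1)) {n : ℕ} {τ : 𝕜}
    (hquad : ∀ i < n, T i * T i = (1 - τ) • T i + τ • 1) {i : ℕ} (hi : i < n) {w : A}
    (hw : w ∈ Submodule.span 𝕜 (Set.range (codeWord T n))) :
    w * T i ∈ Submodule.span 𝕜 (Set.range (codeWord T n)) := by
  induction n generalizing i w with
  | zero => omega
  | succ n ih =>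
    have hmul : ∀ l ≤ n + 1, ∀ v ∈ Submodule.span 𝕜 (Set.range (codeWord T n)),
        v * desc T n l ∈ Submodule.span 𝕜 (Set.range (codeWord T (n + 1))) := by
      intro l hl v hv
      induction hv using Submodule.span_induction with
      | mem v hv =>
        obtain ⟨c, rfl⟩ := hv
        exact Submodule.subset_span ⟨(c, ⟨l, by omega⟩), rfl⟩
      | zero => simp
      | add v w _ _ hv hw => rw [add_mul]; exact add_mem hv hw
      | smul c v _ hv => rw [smul_mul_assoc]; exact Submodule.smul_mem _ _ hv
    induction hw using Submodule.span_induction with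
    | mem w hw =>
      obtain ⟨⟨c, l, hl⟩, rfl⟩ := hw
      have hc : codeWord T n c ∈ Submodule.span 𝕜 (Set.range (codeWord T n)) :=
        Submodule.subset_span ⟨c, rfl⟩
      change codeWord T n c * desc T n l * T i ∈ _
      rw [mul_assoc]
      rcases lt_trichotomy (i + l) n with h | h | h
      · rw [← mul_desc_of_lt hcomm h, ← mul_assoc]
        exact hmul l (by omega) _ (ih (fun i hi => hquad i (by omega)) (by omega) hc)
      · have h1 : desc T n l * T i = desc T n (l + 1) := by
          rw [desc, show n - l = i by omega]
        rw [h1]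
        exact hmul (l + 1) (by omega) _ hc
      · rcases Nat.lt_or_ge (n + 1) (i + l) with h' | h'
        · obtain ⟨i, rfl⟩ : ∃ m, i = m + 1 := ⟨i - 1, by omega⟩
          rw [desc_mul_of_gt hcomm hbraid (by omega) (by omega) (by omega), ← mul_assoc]
          exact hmul l (by omega) _ (ih (fun i hi => hquad i (by omega)) (by omega) hc)
        · obtain ⟨l, rfl⟩ : ∃ m, l = m + 1 := ⟨l - 1, by omega⟩
          have h1 : desc T n (l + 1) = desc T n l * T i := by
            rw [desc, show n - l = i by omega]
          have h2 : desc T n (l + 1) * T i = (1 - τ) • desc T n (l + 1) + τ • desc T n l := by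
            rw [h1, mul_assoc, hquad i hi, mul_add, mul_smul_comm, mul_smul_comm, mul_one]
          rw [h2, mul_add, mul_smul_comm, mul_smul_comm]
          exact add_mem (Submodule.smul_mem _ _ (hmul _ (by omega) _ hc))
            (Submodule.smul_mem _ _ (hmul _ (by omega) _ hc))
    | zero => simp
    | add v w _ _ hv hw => rw [add_mul]; exact add_mem hv hw
    | smul c v _ hv => rw [smul_mul_assoc]; exact Submodule.smul_mem _ _ hv

lemma one_mem_span_codeWord (n : ℕ) :
    (1 : A) ∈ Submodule.span 𝕜 (Set.range (codeWord T n)) := by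
  have h : ∀ n, ∃ c : Code n, codeWord T n c = 1 := by
    intro n
    induction n with
    | zero => exact ⟨(), rfl⟩
    | succ n ih =>
      obtain ⟨c, hc⟩ := ih
      exact ⟨(c, 0), by simp [codeWord, hc, desc]⟩
  obtain ⟨c, hc⟩ := h n
  exact Submodule.subset_span ⟨c, hc⟩

/-- Left multiplication by a generator `y = r c` that is built from an element `r` which can be
moved past the first factor. -/
lemma mul_mem_mul_mul {B₁ B₂ B₃ : Subalgebra 𝕜 A}
    (h₁ : Subalgebra.toSubmodule B₂ * Subalgebra.toSubmodule B₁ ≤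
      Subalgebra.toSubmodule B₁ * Subalgebra.toSubmodule B₂)
    (h₂ : Subalgebra.toSubmodule B₃ * Subalgebra.toSubmodule B₂ ≤
      Subalgebra.toSubmodule B₂ * Subalgebra.toSubmodule B₃) {r c : A}
    (hr : r ∈ Subalgebra.toSubmodule B₃ * Subalgebra.toSubmodule B₂)
    (hrx : ∀ x ∈ B₁, ∃ x' ∈ B₁, r * x = x' * r) (hc : c ∈ B₂) {w : A}
    (hw : w ∈ Subalgebra.toSubmodule B₁ * Subalgebra.toSubmodule B₂ *
      Subalgebra.toSubmodule B₃) :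
    r * c * w ∈ Subalgebra.toSubmodule B₁ * Subalgebra.toSubmodule B₂ *
      Subalgebra.toSubmodule B₃ := by
  have i₁ := B₁.isIdempotentElem_toSubmodule
  have i₂ := B₂.isIdempotentElem_toSubmodule
  have i₃ := B₃.isIdempotentElem_toSubmodule
  have hrx' : Submodule.span 𝕜 {r} * Subalgebra.toSubmodule B₁ ≤
      Subalgebra.toSubmodule B₁ * Submodule.span 𝕜 {r} := by
    refine Submodule.mul_le.mpr fun a ha x hx => ?_
    obtain ⟨d, rfl⟩ := Submodule.mem_span_singleton.mp ha
    obtain ⟨x', hx', h⟩ := hrx x hx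
    rw [smul_mul_assoc, h, ← mul_smul_comm]
    exact Submodule.mul_mem_mul hx' ha
  have hr' : Submodule.span 𝕜 {r} ≤ Subalgebra.toSubmodule B₃ * Subalgebra.toSubmodule B₂ := by
    simpa using hr
  have hrc : r * c * w ∈ Submodule.span 𝕜 {r} * Subalgebra.toSubmodule B₂ *
      (Subalgebra.toSubmodule B₁ * Subalgebra.toSubmodule B₂ * Subalgebra.toSubmodule B₃) :=
    Submodule.mul_mem_mul
      (Submodule.mul_mem_mul (Submodule.mem_span_singleton_self r) hc) hw
  generalize Submodule.span 𝕜 {r} = ρ at *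
  generalize Subalgebra.toSubmodule B₁ = b₁ at *
  generalize Subalgebra.toSubmodule B₂ = b₂ at *
  generalize Subalgebra.toSubmodule B₃ = b₃ at *
  refine (?_ : ρ * b₂ * (b₁ * b₂ * b₃) ≤ b₁ * b₂ * b₃) hrc
  calc ρ * b₂ * (b₁ * b₂ * b₃) = ρ * (b₂ * b₁) * (b₂ * b₃) := by simp only [mul_assoc]
    _ ≤ ρ * (b₁ * b₂) * (b₂ * b₃) := by gcongr
    _ = (ρ * b₁) * (b₂ * b₂) * b₃ := by simp only [mul_assoc]
    _ ≤ (b₁ * (b₃ * b₂)) * b₂ * b₃ := by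
      rw [i₂.eq]
      exact mul_le_mul_left (mul_le_mul_left (hrx'.trans (mul_le_mul_right hr' b₁)) b₂) b₃
    _ = b₁ * (b₃ * (b₂ * b₂)) * b₃ := by simp only [mul_assoc]
    _ ≤ b₁ * (b₂ * b₃) * b₃ := by
      rw [i₂.eq]
      gcongr
    _ = b₁ * b₂ * b₃ := by rw [mul_assoc b₁, mul_assoc b₂, i₃.eq, mul_assoc]

variable {B₁ B₂ B₃ : Subalgebra 𝕜 A}

lemma one_mem_mul_mul : (1 : A) ∈ Subalgebra.toSubmodule B₁ * Subalgebra.toSubmodule B₂ *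
    Subalgebra.toSubmodule B₃ := by
  have := Submodule.mul_mem_mul (Submodule.mul_mem_mul
    (M := Subalgebra.toSubmodule B₁) (N := Subalgebra.toSubmodule B₂) B₁.one_mem B₂.one_mem)
    (show 1 ∈ Subalgebra.toSubmodule B₃ from B₃.one_mem)
  rwa [mul_one, mul_one] at this

lemma left_mul_mem_mul_mul {x w : A} (hx : x ∈ B₁)
    (hw : w ∈ Subalgebra.toSubmodule B₁ * Subalgebra.toSubmodule B₂ *
      Subalgebra.toSubmodule B₃) :
    x * w ∈ Subalgebra.toSubmodule B₁ * Subalgebra.toSubmodule B₂ *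
      Subalgebra.toSubmodule B₃ := by
  have := Submodule.mul_mem_mul (M := Subalgebra.toSubmodule B₁) hx hw
  rwa [← mul_assoc, ← mul_assoc, B₁.isIdempotentElem_toSubmodule.eq] at this

lemma middle_mul_mem_mul_mul
    (h₁ : Subalgebra.toSubmodule B₂ * Subalgebra.toSubmodule B₁ ≤
      Subalgebra.toSubmodule B₁ * Subalgebra.toSubmodule B₂)
    (h₂ : Subalgebra.toSubmodule B₃ * Subalgebra.toSubmodule B₂ ≤
      Subalgebra.toSubmodule B₂ * Subalgebra.toSubmodule B₃) {x w : A} (hx : x ∈ B₂)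
    (hw : w ∈ Subalgebra.toSubmodule B₁ * Subalgebra.toSubmodule B₂ *
      Subalgebra.toSubmodule B₃) :
    x * w ∈ Subalgebra.toSubmodule B₁ * Subalgebra.toSubmodule B₂ *
      Subalgebra.toSubmodule B₃ := by
  have h1 := Submodule.mul_mem_mul (M := Subalgebra.toSubmodule B₃)
    (N := Subalgebra.toSubmodule B₂) B₃.one_mem B₂.one_mem
  rw [mul_one] at h1
  have := mul_mem_mul_mul h₁ h₂ h1 (fun a ha => ⟨a, ha, by rw [one_mul, mul_one]⟩) hx hw
  rwa [one_mul] at this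

lemma mul_mul_le_span {ι₁ ι₂ ι₃ : Type*} {f₁ : ι₁ → A} {f₂ : ι₂ → A} {f₃ : ι₃ → A}
    (h₁ : Subalgebra.toSubmodule B₁ ≤ Submodule.span 𝕜 (Set.range f₁))
    (h₂ : Subalgebra.toSubmodule B₂ ≤ Submodule.span 𝕜 (Set.range f₂))
    (h₃ : Subalgebra.toSubmodule B₃ ≤ Submodule.span 𝕜 (Set.range f₃)) :
    Subalgebra.toSubmodule B₁ * Subalgebra.toSubmodule B₂ * Subalgebra.toSubmodule B₃ ≤
      Submodule.span 𝕜 (Set.range fun p : ι₁ × ι₂ × ι₃ => f₁ p.1 * (f₂ p.2.1 * f₃ p.2.2)) := by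
  refine (mul_le_mul' (mul_le_mul' h₁ h₂) h₃).trans ?_
  rw [mul_assoc, Submodule.span_mul_span, Submodule.span_mul_span]
  refine Submodule.span_mono ?_
  rintro _ ⟨_, ⟨a, rfl⟩, _, ⟨_, ⟨c, rfl⟩, _, ⟨b, rfl⟩, rfl⟩, rfl⟩
  exact ⟨(a, c, b), rfl⟩

end Span

lemma mul_self_eq_of_quadratic {A : Type*} [Ring A] [Algebra K A] {a : A} {τ : K}
    (h : (a - 1) * (a + τ • 1) = 0) : a * a = (1 - τ) • a + τ • 1 := by
  rw [sub_mul, mul_add, one_mul, mul_smul_comm, mul_one, sub_eq_zero] at h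
  rw [sub_smul, one_smul, ← sub_eq_zero, ← sub_eq_zero.mpr h]
  abel

lemma prod_ofFn_eq_upProd {A : Type*} [Ring A] (z : ℕ → A) (n : ℕ) :
    (List.ofFn fun i : Fin n => z i).prod = upProd z 0 n := by
  induction n with
  | zero => simp
  | succ n ih => rw [upProd_succ, ← ih, List.ofFn_succ', List.concat_eq_append]; simp

/-! ### A spanning set of `ℋₖ⁺` -/

section PBW

/-- The element `T_i` of `ℋₖ`, set to `0` out of range. -/
def hT (k i : ℕ) : DAHA k := toDAHA k (FreeAlgebra.ι K (.T i))

/-- The element `X_i` of `ℋₖ`, set to `0` out of range. -/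
def hX (k i : ℕ) : DAHA k := toDAHA k (FreeAlgebra.ι K (.X i))

/-- The element `Y_i` of `ℋₖ`, set to `0` out of range. -/
def hY (k i : ℕ) : DAHA k := toDAHA k (FreeAlgebra.ι K (.Y i))

variable {k : ℕ}

lemma hT_of_le {i : ℕ} (h : k ≤ i + 1) : hT k i = 0 :=
  toDAHA_ι_of_not (x := .T i) (by simp only [genOfLevel]; omega)

lemma hT_comm (i j : ℕ) (h : i + 1 < j) : hT k i * hT k j = hT k j * hT k i := by
  rcases lt_or_ge (j + 1) k with hj | hj
  · rw [hT, hT, toDAHA_T (show i + 1 < k by omega), toDAHA_T hj, ← map_mul, ← map_mul]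
    exact mkAlgHom_eq (.T_comm i j _ _ h)
  · rw [hT_of_le hj]; simp

lemma hT_braid (i : ℕ) : hT k i * hT k (i + 1) * hT k i =
    hT k (i + 1) * hT k i * hT k (i + 1) := by
  rcases lt_or_ge (i + 1 + 1) k with hj | hj
  · rw [hT, hT, toDAHA_T (show i + 1 < k by omega), toDAHA_T hj]
    simp only [← map_mul]
    exact mkAlgHom_eq (.braid i _ _)
  · rw [hT_of_le hj]; simp

lemma hT_quadratic {i : ℕ} (h : i + 1 < k) : hT k i * hT k i = (1 - t) • hT k i + t • 1 := by
  have h1 := mkAlgHom_eq (.quadratic i h)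
  rw [map_mul, map_sub, map_add, map_one, AlgHom.commutes, map_zero, ← toDAHA_T h,
    Algebra.algebraMap_eq_smul_one] at h1
  exact mul_self_eq_of_quadratic (a := hT k i) (τ := t) (by exact h1)

lemma hX_succ {i : ℕ} (h : i + 1 < k) : hT k i * hX k (i + 1) * hT k i = t • hX k i := by
  rw [hT, hX, hX, toDAHA_T h, toDAHA_X h, toDAHA_X (show i < k by omega)]
  simp only [← map_mul, ← map_smul]
  exact mkAlgHom_eq (.X_succ i _ _)

lemma hT_hX {i j : ℕ} (hi : i + 1 < k) (hj : j < k) (h : j ≠ i) (h' : j ≠ i + 1) :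
    hT k i * hX k j = hX k j * hT k i := by
  rw [hT, hX, toDAHA_T hi, toDAHA_X hj, ← map_mul, ← map_mul]
  exact mkAlgHom_eq (.T_X i j _ _ h h')

lemma hX_comm {i j : ℕ} (hi : i < k) (hj : j < k) : hX k i * hX k j = hX k j * hX k i := by
  rw [hX, hX, toDAHA_X hi, toDAHA_X hj, ← map_mul, ← map_mul]
  exact mkAlgHom_eq (.X_comm i j _ _)

lemma hY_succ {i : ℕ} (h : i + 1 < k) : hY k (i + 1) = t⁻¹ • (hT k i * hY k i * hT k i) := by
  rw [hT, hY, hY, toDAHA_T h, toDAHA_Y h, toDAHA_Y (show i < k by omega)]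
  simp only [← map_mul, ← map_smul]
  exact (mkAlgHom_eq (.Y_succ i _ _)).symm

lemma hT_hY {i j : ℕ} (hi : i + 1 < k) (hj : j < k) (h : j ≠ i) (h' : j ≠ i + 1) :
    hT k i * hY k j = hY k j * hT k i := by
  rw [hT, hY, toDAHA_T hi, toDAHA_Y hj, ← map_mul, ← map_mul]
  exact mkAlgHom_eq (.T_Y i j _ _ h h')

lemma hY_comm {i j : ℕ} (hi : i < k) (hj : j < k) : hY k i * hY k j = hY k j * hY k i := by
  rw [hY, hY, toDAHA_Y hi, toDAHA_Y hj, ← map_mul, ← map_mul]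
  exact mkAlgHom_eq (.Y_comm i j _ _)

lemma h_cross (h : 1 < k) : hY k 0 * hT k 0 * hX k 0 = hX k 1 * hY k 0 * hT k 0 := by
  rw [hT, hY, hX, hX, toDAHA_T (show 0 + 1 < k from h), toDAHA_Y (show 0 < k by omega), toDAHA_X h,
    toDAHA_X (show 0 < k by omega)]
  simp only [← map_mul]
  exact mkAlgHom_eq (.cross (by omega) h)

lemma h_det (h : 0 < k) : hY k 0 * (List.ofFn fun i : Fin k => hX k i).prod =
    q • ((List.ofFn fun i : Fin k => hX k i).prod * hY k 0) := by
  have h1 := mkAlgHom_eq (.det h)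
  rw [map_mul, map_smul, map_mul, map_list_prod, List.map_ofFn] at h1
  have h2 : (fun i : Fin k => hX k i) = (RingQuot.mkAlgHom K (Rel k)) ∘
      fun i : Fin k => FreeAlgebra.ι K (Gen.X i.1 i.2) := funext fun i => toDAHA_X i.2
  rw [h2, hY, toDAHA_Y h]
  exact h1

lemma isUnit_hX {i : ℕ} (h : i < k) : IsUnit (hX k i) := by
  rw [hX, toDAHA_X h]
  refine ⟨⟨_, RingQuot.mkAlgHom K (Rel k) (FreeAlgebra.ι K (.Xinv i h)), ?_, ?_⟩, rfl⟩
  · rw [← map_mul, mkAlgHom_eq (.X_mul_Xinv i h), map_one]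
  · rw [← map_mul, mkAlgHom_eq (.Xinv_mul_X i h), map_one]

/-- The inverse of `T_i` in `ℋₖ`. -/
def hTinv (k i : ℕ) : DAHA k := t⁻¹ • (hT k i + (t - 1) • 1)

lemma hT_mul_hTinv {i : ℕ} (h : i + 1 < k) : hT k i * hTinv k i = 1 := by
  rw [hTinv, mul_smul_comm, mul_add, hT_quadratic h, mul_smul_comm, mul_one,
    inv_smul_eq_iff₀ t_ne_zero, add_right_comm, ← add_smul]
  simp

lemma hTinv_mul_hT {i : ℕ} (h : i + 1 < k) : hTinv k i * hT k i = 1 := by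
  rw [hTinv, smul_mul_assoc, add_mul, hT_quadratic h, smul_mul_assoc, one_mul,
    inv_smul_eq_iff₀ t_ne_zero, add_right_comm, ← add_smul]
  simp

/-- The subalgebra generated by the `T_i`. -/
def algT (k : ℕ) : Subalgebra K (DAHA k) := Algebra.adjoin K (hT k '' {i | i + 1 < k})

/-- The subalgebra generated by the `X_i`. -/
def algX (k : ℕ) : Subalgebra K (DAHA k) := Algebra.adjoin K (hX k '' {i | i < k})

/-- The subalgebra generated by the `Y_i`. -/
def algY (k : ℕ) : Subalgebra K (DAHA k) := Algebra.adjoin K (hY k '' {i | i < k})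

lemma hT_mem {i : ℕ} (h : i + 1 < k) : hT k i ∈ algT k := Algebra.subset_adjoin ⟨i, h, rfl⟩

lemma hX_mem {i : ℕ} (h : i < k) : hX k i ∈ algX k := Algebra.subset_adjoin ⟨i, h, rfl⟩

lemma hY_mem {i : ℕ} (h : i < k) : hY k i ∈ algY k := Algebra.subset_adjoin ⟨i, h, rfl⟩

lemma hTinv_mem {i : ℕ} (h : i + 1 < k) : hTinv k i ∈ algT k :=
  (algT k).smul_mem ((algT k).add_mem (hT_mem h) ((algT k).smul_mem (algT k).one_mem _)) _

/-- The Bernstein relation between `T_i` and `X_{i+1}`. -/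
lemma hT_hX_succ {i : ℕ} (h : i + 1 < k) :
    hT k i * hX k (i + 1) = hX k i * (t • hTinv k i) := by
  have h1 := congrArg (· * hTinv k i) (hX_succ h)
  simp only [mul_assoc, hT_mul_hTinv h, mul_one] at h1
  rw [h1, smul_mul_assoc, mul_smul_comm]

lemma hTinv_mul_smul_hX {i : ℕ} (h : i + 1 < k) :
    hTinv k i * (t • hX k i) = hX k (i + 1) * hT k i := by
  rw [← hX_succ h, ← mul_assoc, ← mul_assoc, hTinv_mul_hT h, one_mul]

lemma hT_hX_self {i : ℕ} (h : i + 1 < k) :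
    hT k i * hX k i = hX k (i + 1) * hT k i + hX k i * ((1 - t) • 1) := by
  have h1 := hTinv_mul_smul_hX h
  have h3 : t • hTinv k i = hT k i + (t - 1) • 1 := by
    rw [hTinv, smul_smul, mul_inv_cancel₀ t_ne_zero, one_smul]
  rw [mul_smul_comm, ← smul_mul_assoc, h3, add_mul, smul_mul_assoc, one_mul] at h1
  rw [← h1, mul_smul_comm, mul_one, add_assoc, ← add_smul]
  simp

/-- By the Bernstein relations, the `T_i` can be moved to the right of the `X_j`. -/
lemma algT_mul_algX_le : Subalgebra.toSubmodule (algT k) * Subalgebra.toSubmodule (algX k) ≤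
    Subalgebra.toSubmodule (algX k) * Subalgebra.toSubmodule (algT k) := by
  unfold algT algX
  refine adjoin_mul_adjoin_le (s := hT k '' {i | i + 1 < k}) (u := hX k '' {i | i < k}) ?_
  intro a ha x hx
  obtain ⟨i, hi, hia⟩ := ha
  obtain ⟨j, hj, hjx⟩ := hx
  rw [← hia, ← hjx]
  have hi' : i + 1 < k := hi
  have hs : ∀ l < k, hX k l ∈ Submodule.span K (hX k '' {i | i < k}) := fun l hl =>
    Submodule.subset_span ⟨l, hl, rfl⟩
  by_cases h0 : j = i
  · subst h0
    rw [hT_hX_self hi']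
    exact add_mem (Submodule.mul_mem_mul (hs _ hi') (hT_mem hi'))
      (Submodule.mul_mem_mul (hs _ hj) ((algT k).smul_mem (algT k).one_mem _))
  by_cases h1 : j = i + 1
  · subst h1
    rw [hT_hX_succ hi']
    exact Submodule.mul_mem_mul (hs _ (by omega)) ((algT k).smul_mem (hTinv_mem hi') _)
  · rw [hT_hX hi' hj h0 h1]
    exact Submodule.mul_mem_mul (hs _ hj) (hT_mem hi')

/-- The Bernstein relation between `Y_i` and `T_i`. -/
lemma hY_hT_self {i : ℕ} (h : i + 1 < k) :
    hY k i * hT k i = (hT k i + (t - 1) • 1) * hY k (i + 1) := by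
  have h3 : t • hTinv k i = hT k i + (t - 1) • 1 := by
    rw [hTinv, smul_smul, mul_inv_cancel₀ t_ne_zero, one_smul]
  rw [← h3, hY_succ h, mul_smul_comm, smul_mul_assoc, smul_smul, inv_mul_cancel₀ t_ne_zero,
    one_smul, ← mul_assoc, ← mul_assoc, hTinv_mul_hT h, one_mul]

lemma hY_succ_hT {i : ℕ} (h : i + 1 < k) :
    hY k (i + 1) * hT k i = hT k i * hY k i + (1 - t) • (1 * hY k (i + 1)) := by
  have h1 : hY k (i + 1) * (t • hTinv k i) = hT k i * hY k i := by
    rw [hY_succ h, mul_smul_comm, smul_mul_assoc, smul_smul, mul_inv_cancel₀ t_ne_zero, one_smul,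
      mul_assoc, hT_mul_hTinv h, mul_one]
  have h3 : t • hTinv k i = hT k i + (t - 1) • 1 := by
    rw [hTinv, smul_smul, mul_inv_cancel₀ t_ne_zero, one_smul]
  rw [h3, mul_add, mul_smul_comm, mul_one] at h1
  rw [← h1, one_mul, add_assoc, ← add_smul]
  simp

/-- By the Bernstein relations, the `Y_j` can be moved to the right of the `T_i`. -/
lemma algY_mul_algT_le : Subalgebra.toSubmodule (algY k) * Subalgebra.toSubmodule (algT k) ≤
    Subalgebra.toSubmodule (algT k) * Subalgebra.toSubmodule (algY k) := by
  have h1 : algT k = Algebra.adjoin K (insert 1 (hT k '' {i | i + 1 < k})) := by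
    refine le_antisymm (Algebra.adjoin_mono (Set.subset_insert _ _)) (Algebra.adjoin_le ?_)
    exact Set.insert_subset (algT k).one_mem Algebra.subset_adjoin
  rw [h1]
  unfold algY
  refine adjoin_mul_adjoin_le (s := hY k '' {i | i < k})
    (u := insert 1 (hT k '' {i | i + 1 < k})) ?_
  have hs1 : (1 : DAHA k) ∈ Submodule.span K (insert 1 (hT k '' {i | i + 1 < k})) :=
    Submodule.subset_span (Set.mem_insert _ _)
  have hs : ∀ l, l + 1 < k → hT k l ∈ Submodule.span K (insert 1 (hT k '' {i | i + 1 < k})) :=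
    fun l hl => Submodule.subset_span (Set.mem_insert_of_mem _ ⟨l, hl, rfl⟩)
  intro a ha x hx
  obtain ⟨j, hj, hja⟩ := ha
  rw [← hja]
  rcases hx with hx | ⟨i, hi, hix⟩
  · rw [hx, mul_one, ← one_mul (hY k j)]
    exact Submodule.mul_mem_mul hs1 (hY_mem hj)
  rw [← hix]
  have hi' : i + 1 < k := hi
  by_cases h0 : j = i
  · subst h0
    rw [hY_hT_self hi']
    exact Submodule.mul_mem_mul (add_mem (hs _ hi') (Submodule.smul_mem _ _ hs1)) (hY_mem hi')
  by_cases h1 : j = i + 1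
  · subst h1
    rw [hY_succ_hT hi']
    exact add_mem (Submodule.mul_mem_mul (hs _ hi') (hY_mem (by omega)))
      (Submodule.smul_mem _ _ (Submodule.mul_mem_mul hs1 (hY_mem hi')))
  · rw [← hT_hY hi' hj h0 h1]
    exact Submodule.mul_mem_mul (hs _ hi') (hY_mem hj)

/-- The element `Y_0 T_0 ⋯ T_{k-2}`, which acts by the rotation of the variables. -/
def hRot (k : ℕ) : DAHA k := hY k 0 * upProd (hT k) 0 (k - 1)

lemma hRot_hT {i : ℕ} (h : i + 2 < k) : hRot k * hT k i = hT k (i + 1) * hRot k := by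
  rw [hRot, mul_assoc, ← mul_upProd hT_comm hT_braid (by omega) (by omega), ← mul_assoc,
    ← hT_hY (show i + 1 + 1 < k by omega) (by omega) (by omega) (by omega), mul_assoc]

/-- The rotation shifts the `X_i`; the case `i = 0` is the cross relation. -/
lemma hRot_hX {i : ℕ} (h : i + 1 < k) : hRot k * hX k i = hX k (i + 1) * hRot k := by
  induction i with
  | zero =>
    have h1 : ∀ m, m + 1 < k → upProd (hT k) 1 m * hX k 0 = hX k 0 * upProd (hT k) 1 m := by
      intro m
      induction m with
      | zero => simp
      | succ m ih =>
        intro hm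
        rw [upProd_succ, mul_assoc, hT_hX (by omega) (by omega) (by omega) (by omega), ← mul_assoc,
          ih (by omega), mul_assoc]
    obtain ⟨m, hm⟩ : ∃ m, k - 1 = m + 1 := ⟨k - 2, by omega⟩
    rw [hRot, hm, upProd_succ', ← mul_assoc, mul_assoc, zero_add, h1 m (by omega), ← mul_assoc,
      h_cross (by omega)]
    simp only [mul_assoc]
  | succ i ih =>
    have h1 := ih (by omega)
    have h2 := hX_succ (k := k) (i := i) (by omega)
    have h3 := hX_succ (k := k) (i := i + 1) h
    have h4 := hRot_hT (k := k) (i := i) (by omega)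
    -- compare after multiplication by `T_{i+1}` on both sides
    have h5 : hT k (i + 1) * (hRot k * hX k (i + 1)) * hT k i =
        hT k (i + 1) * (hX k (i + 1 + 1) * hRot k) * hT k i := by
      calc hT k (i + 1) * (hRot k * hX k (i + 1)) * hT k i
          = hT k (i + 1) * hRot k * hX k (i + 1) * hT k i := by simp only [mul_assoc]
        _ = hRot k * (hT k i * hX k (i + 1) * hT k i) := by
          rw [← h4]; simp only [mul_assoc]
        _ = t • (hX k (i + 1) * hRot k) := by rw [h2, mul_smul_comm, h1]
        _ = hT k (i + 1) * hX k (i + 1 + 1) * (hT k (i + 1) * hRot k) := by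
          rw [← smul_mul_assoc, ← h3]; simp only [mul_assoc]
        _ = _ := by rw [← h4]; simp only [mul_assoc]
    have hu : ∀ j, j + 1 < k → IsUnit (hT k j) := fun j hj =>
      ⟨⟨_, _, hT_mul_hTinv hj, hTinv_mul_hT hj⟩, rfl⟩
    exact (hu _ h).mul_left_cancel ((hu i (by omega)).mul_right_cancel h5)

/-- The product `X_0 ⋯ X_{k-1}` commutes with the `T_i`. -/
lemma hT_mul_upProd_hX {i : ℕ} (h : i + 1 < k) :
    hT k i * upProd (hX k) 0 k = upProd (hX k) 0 k * hT k i := by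
  have h1 : ∀ m, m ≤ i → hT k i * upProd (hX k) 0 m = upProd (hX k) 0 m * hT k i := by
    intro m
    induction m with
    | zero => simp
    | succ m ih =>
      intro hm
      rw [upProd_succ, ← mul_assoc, ih (by omega), mul_assoc, zero_add,
        hT_hX h (by omega) (by omega) (by omega), mul_assoc]
  have hXX : hT k i * (hX k i * hX k (i + 1)) = hX k i * hX k (i + 1) * hT k i := by
    rw [hX_comm (show i < k by omega) h, ← mul_assoc, hT_hX_succ h, mul_assoc, smul_mul_assoc,
      ← mul_smul_comm, hTinv_mul_smul_hX h, ← mul_assoc, hX_comm (show i < k by omega) h]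
  have h2 : ∀ m, i + 2 ≤ m → m ≤ k → hT k i * upProd (hX k) 0 m = upProd (hX k) 0 m * hT k i := by
    intro m hm
    induction m, hm using Nat.le_induction with
    | base =>
      intro _
      rw [upProd_succ, upProd_succ, zero_add, zero_add, mul_assoc, ← mul_assoc, h1 i le_rfl,
        mul_assoc, hXX, ← mul_assoc]
    | succ m hm ih =>
      intro hm'
      rw [upProd_succ, ← mul_assoc, ih (by omega), mul_assoc, zero_add,
        hT_hX h (by omega) (by omega) (by omega), mul_assoc]
  exact h2 k h le_rfl

lemma hRot_mul_upProd_hX {m : ℕ} (h : m < k) :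
    hRot k * upProd (hX k) 0 m = upProd (hX k) 1 m * hRot k := by
  induction m with
  | zero => simp
  | succ m ih =>
    rw [upProd_succ, ← mul_assoc, ih (by omega), mul_assoc, zero_add, hRot_hX h, ← mul_assoc,
      upProd_succ, add_comm 1 m]

/-- The rotation moves the last `X_i` to the first one and multiplies it by `q`. This is the relation
`Y_0 X_0 ⋯ X_{k-1} = q X_0 ⋯ X_{k-1} Y_0`, from which the invertible `X_1 ⋯ X_{k-1}` cancels. -/
lemma hRot_hX_last (h : 0 < k) : hRot k * hX k (k - 1) = q • (hX k 0 * hRot k) := by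
  obtain ⟨m, rfl⟩ : ∃ m, k = m + 1 := ⟨k - 1, by omega⟩
  rw [Nat.add_sub_cancel]
  have hl : (List.ofFn fun i : Fin (m + 1) => hX (m + 1) i).prod =
      upProd (hX (m + 1)) 0 (m + 1) := prod_ofFn_eq_upProd (hX (m + 1)) (m + 1)
  have h1 := h_det h
  rw [hl] at h1
  have h2 : ∀ l, l < m + 1 → upProd (hT (m + 1)) 0 l * upProd (hX (m + 1)) 0 (m + 1) =
      upProd (hX (m + 1)) 0 (m + 1) * upProd (hT (m + 1)) 0 l := by
    intro l
    induction l with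
    | zero => simp
    | succ l ih =>
      intro hl
      rw [upProd_succ, mul_assoc, zero_add, hT_mul_upProd_hX (by omega), ← mul_assoc,
        ih (by omega), mul_assoc]
  have h3 : hRot (m + 1) * upProd (hX (m + 1)) 0 (m + 1) =
      q • (upProd (hX (m + 1)) 0 (m + 1) * hRot (m + 1)) := by
    rw [hRot, mul_assoc, h2 _ (by omega), ← mul_assoc, h1, smul_mul_assoc, mul_assoc]
  have hu : ∀ l, l < m + 1 → IsUnit (upProd (hX (m + 1)) 1 l) ∧
      hX (m + 1) 0 * upProd (hX (m + 1)) 1 l = upProd (hX (m + 1)) 1 l * hX (m + 1) 0 := by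
    intro l
    induction l with
    | zero => simp
    | succ l ih =>
      intro hl
      rw [upProd_succ]
      refine ⟨(ih (by omega)).1.mul (isUnit_hX (by omega)), ?_⟩
      rw [← mul_assoc, (ih (by omega)).2, mul_assoc, hX_comm (by omega) (by omega), mul_assoc]
  apply (hu m (by omega)).1.mul_left_cancel
  rw [← mul_assoc, ← hRot_mul_upProd_hX (by omega), mul_assoc]
  have h4 := upProd_succ (T := hX (m + 1)) 0 m
  rw [zero_add] at h4
  rw [← h4, h3, upProd_succ', (hu m (by omega)).2, mul_smul_comm, mul_assoc]

/-- The rotation normalizes the subalgebra generated by the `X_i`. -/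
lemma exists_hRot_mul (hk : 0 < k) {x : DAHA k} (hx : x ∈ algX k) :
    ∃ x' ∈ algX k, hRot k * x = x' * hRot k := by
  induction hx using Algebra.adjoin_induction with
  | mem x hx =>
    obtain ⟨i, hi, hix⟩ := hx
    have hi' : i < k := hi
    rw [← hix]
    rcases lt_or_ge (i + 1) k with h | h
    · exact ⟨_, hX_mem h, hRot_hX h⟩
    · obtain rfl : i = k - 1 := by omega
      exact ⟨_, (algX k).smul_mem (hX_mem hk) q, by rw [hRot_hX_last hk, smul_mul_assoc]⟩
  | algebraMap c => exact ⟨_, (algX k).algebraMap_mem c, (Algebra.commutes c _).symm⟩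
  | add a b _ _ ha hb =>
    obtain ⟨a', ha', h⟩ := ha
    obtain ⟨b', hb', h'⟩ := hb
    exact ⟨a' + b', (algX k).add_mem ha' hb', by rw [mul_add, h, h', add_mul]⟩
  | mul a b _ _ ha hb =>
    obtain ⟨a', ha', h⟩ := ha
    obtain ⟨b', hb', h'⟩ := hb
    exact ⟨a' * b', (algX k).mul_mem ha' hb', by rw [← mul_assoc, h, mul_assoc, h', mul_assoc]⟩

lemma upProd_hT_mem {m : ℕ} (h : m < k) : upProd (hT k) 0 m ∈ algT k ∧
    ∃ c ∈ algT k, upProd (hT k) 0 m * c = 1 := by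
  induction m with
  | zero => exact ⟨(algT k).one_mem, 1, (algT k).one_mem, mul_one _⟩
  | succ m ih =>
    obtain ⟨h1, c, hc, h2⟩ := ih (by omega)
    rw [upProd_succ, zero_add]
    refine ⟨(algT k).mul_mem h1 (hT_mem h), hTinv k m * c, (algT k).mul_mem (hTinv_mem h) hc, ?_⟩
    rw [mul_assoc, ← mul_assoc (hT k m), hT_mul_hTinv h, one_mul, h2]

/-- The product of the three subalgebras is stable under left multiplication by the generators. For
`Y_0` this is seen by writing it as the rotation times an element of the finite Hecke algebra. -/
lemma DAHAPlus_le_mul (hk : 0 < k) : Subalgebra.toSubmodule (DAHAPlus k) ≤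
    Subalgebra.toSubmodule (algX k) * Subalgebra.toSubmodule (algT k) *
      Subalgebra.toSubmodule (algY k) := by
  set S := Subalgebra.toSubmodule (algX k) * Subalgebra.toSubmodule (algT k) *
      Subalgebra.toSubmodule (algY k) with hS
  have hX' : ∀ x ∈ algX k, ∀ w ∈ S, x * w ∈ S := fun x hx w hw => left_mul_mem_mul_mul
    (B₁ := algX k) (B₂ := algT k) (B₃ := algY k) hx hw
  have hT' : ∀ x ∈ algT k, ∀ w ∈ S, x * w ∈ S := fun x hx w hw =>
    middle_mul_mem_mul_mul (B₁ := algX k) (B₂ := algT k) (B₃ := algY k) algT_mul_algX_le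
      algY_mul_algT_le hx hw
  have hY' : ∀ i < k, ∀ w ∈ S, hY k i * w ∈ S := by
    intro i
    induction i with
    | zero =>
      intro _ w hw
      obtain ⟨h1, c, hc, h2⟩ := upProd_hT_mem (k := k) (m := k - 1) (by omega)
      have h3 : hRot k * c = hY k 0 := by rw [hRot, mul_assoc, h2, mul_one]
      rw [← h3]
      exact mul_mem_mul_mul algT_mul_algX_le algY_mul_algT_le
        (Submodule.mul_mem_mul (hY_mem hk) h1) (fun x hx => exists_hRot_mul hk hx) hc hw
    | succ i ih =>
      intro hi w hw
      rw [hY_succ hi, smul_mul_assoc, mul_assoc, mul_assoc]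
      exact S.smul_mem _ (hT' _ (hT_mem hi) _ (ih (by omega) _ (hT' _ (hT_mem hi) _ hw)))
  refine adjoin_le_of_mul_mem (one_mem_mul_mul (B₁ := algX k) (B₂ := algT k) (B₃ := algY k)) ?_
  intro a ha w hw
  obtain ⟨x, hx, hxa⟩ := ha
  rw [hxa, ← toDAHA_ι hx]
  cases x with
  | T i => exact hT' _ (hT_mem hx) _ hw
  | X i => exact hX' _ (hX_mem hx) _ hw
  | Y i => exact hY' _ hx _ hw

/-- The elements `X^a T_w Y^b` span `ℋₖ⁺`. -/
lemma DAHAPlus_le_span (hk : 0 < k) : Subalgebra.toSubmodule (DAHAPlus k) ≤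
    Submodule.span K (Set.range fun p : Multiset (Fin k) × Code (k - 1) × Multiset (Fin k) =>
      mword (hX k) p.1 * (codeWord (hT k) (k - 1) p.2.1 * mword (hY k) p.2.2)) := by
  have h1 : Subalgebra.toSubmodule (algT k) ≤
      Submodule.span K (Set.range (codeWord (hT k) (k - 1))) := by
    refine adjoin_le_of_mul_mem_right (one_mem_span_codeWord _) ?_
    intro a ha w hw
    obtain ⟨i, hi, hia⟩ := ha
    have hi' : i + 1 < k := hi
    rw [← hia]
    exact codeWord_mul_mem hT_comm hT_braid (fun i hi => hT_quadratic (by omega)) (by omega) hw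
  exact (DAHAPlus_le_mul hk).trans (mul_mul_le_span
    (B₁ := algX k) (B₂ := algT k) (B₃ := algY k)
    (adjoin_le_span_mword fun i hi j hj => hX_comm hi hj) h1
    (adjoin_le_span_mword fun i hi j hj => hY_comm hi hj))

end PBW

/-! ### Reduction at `t = 1` -/

section Reduction

/-- The specialization `t = 1`. -/
def specR : R →+* R :=
  (MvPolynomial.aeval fun i : Fin 2 => if i = 0 then (1 : R) else MvPolynomial.X 1).toRingHom

lemma specR_X0 : specR (MvPolynomial.X 0) = 1 := by simp [specR]

lemma specR_X1 : specR (MvPolynomial.X 1) = MvPolynomial.X 1 := by simp [specR]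

lemma dvd_of_specR_eq_zero {r : R} (h : specR r = 0) : (MvPolynomial.X 0 - 1 : R) ∣ r := by
  have h1 : (MvPolynomial.X 0 - 1 : R) ∣ RingHom.id R r - specR r := by
    refine dvd_map_sub_map (fun c => ?_) (fun i => ?_) r
    · simp [specR]
    · fin_cases i
      · simp [specR_X0]
      · simp [specR_X1]
  simpa [h] using h1

variable {k : ℕ}

/-- The polynomials in `k` variables over `ℚ[t, q]`. -/
abbrev PZ (k : ℕ) : Type := MvPolynomial (Fin k) R

/-- The inclusion of the polynomials over `ℚ[t, q]` into those over `ℚ(t, q)`. -/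
def inclP (k : ℕ) : PZ k →+* P k := MvPolynomial.map (algebraMap R K)

lemma inclP_injective : Function.Injective (inclP k) :=
  MvPolynomial.map_injective _ (FaithfulSMul.algebraMap_injective R K)

lemma inclP_C (r : R) : inclP k (C r) = C (algebraMap R K r) := MvPolynomial.map_C _ r

lemma inclP_X (i : Fin k) : inclP k (MvPolynomial.X i) = MvPolynomial.X i := MvPolynomial.map_X _ i

/-- The specialization `t = 1` of polynomials. -/
def specP (k : ℕ) : PZ k →+* PZ k := MvPolynomial.map specR

lemma specP_C (r : R) : specP k (C r) = C (specR r) := MvPolynomial.map_C _ r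

lemma specP_X (i : Fin k) : specP k (MvPolynomial.X i) = MvPolynomial.X i := MvPolynomial.map_X _ i

lemma dvd_of_specP_eq_zero {F : PZ k} (h : specP k F = 0) :
    (C (MvPolynomial.X 0 - 1) : PZ k) ∣ F := by
  rw [MvPolynomial.C_dvd_iff_dvd_coeff]
  intro m
  apply dvd_of_specR_eq_zero
  rw [← MvPolynomial.coeff_map]
  change MvPolynomial.coeff m (specP k F) = 0
  rw [h, MvPolynomial.coeff_zero]

lemma specP_C_X0 : specP k (C (MvPolynomial.X 0)) = 1 := by rw [specP_C, specR_X0, map_one]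

/-- The variable with index `i`, set to `0` for `i ≥ k`. -/
def varZ (k i : ℕ) : PZ k := if h : i < k then MvPolynomial.X ⟨i, h⟩ else 0

lemma varZ_of_lt {i : ℕ} (h : i < k) : varZ k i = MvPolynomial.X ⟨i, h⟩ := dif_pos h

lemma inclP_varZ (i : ℕ) : inclP k (varZ k i) = var k i := by
  unfold varZ var
  split_ifs
  · exact inclP_X _
  · exact map_zero _

lemma specP_varZ (i : ℕ) : specP k (varZ k i) = varZ k i := by
  unfold varZ
  split_ifs
  · exact specP_X _
  · exact map_zero _

/-- The substitution `x_i ↦ q^(e i) x_(σ i)`. -/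
def qsubst (k : ℕ) (σ e : ℕ → ℕ) : PZ k →ₐ[R] PZ k :=
  MvPolynomial.aeval fun i : Fin k => C (MvPolynomial.X 1 ^ e i) * varZ k (σ i)

lemma qsubst_X (σ e : ℕ → ℕ) (i : Fin k) :
    qsubst k σ e (MvPolynomial.X i) = C (MvPolynomial.X 1 ^ e i) * varZ k (σ i) :=
  MvPolynomial.aeval_X _ i

lemma qsubst_varZ (σ e : ℕ → ℕ) {i : ℕ} (h : i < k) :
    qsubst k σ e (varZ k i) = C (MvPolynomial.X 1 ^ e i) * varZ k (σ i) := by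
  rw [varZ_of_lt h, qsubst_X]

lemma qsubst_C (σ e : ℕ → ℕ) (r : R) : qsubst k σ e (C r) = C r := (qsubst k σ e).commutes r

lemma qsubst_congr {σ e σ' e' : ℕ → ℕ} (hσ : ∀ i < k, σ i = σ' i) (he : ∀ i < k, e i = e' i) :
    qsubst k σ e = qsubst k σ' e' := by
  refine MvPolynomial.algHom_ext fun i => ?_
  rw [qsubst_X, qsubst_X, hσ i i.2, he i i.2]

lemma qsubst_qsubst {σ e σ' e' : ℕ → ℕ} (h : ∀ i < k, σ' i < k) (F : PZ k) :
    qsubst k σ e (qsubst k σ' e' F) =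
      qsubst k (fun i => σ (σ' i)) (fun i => e' i + e (σ' i)) F := by
  have : (qsubst k σ e).comp (qsubst k σ' e') =
      qsubst k (fun i => σ (σ' i)) (fun i => e' i + e (σ' i)) := by
    refine MvPolynomial.algHom_ext fun i => ?_
    rw [AlgHom.comp_apply, qsubst_X, qsubst_X, map_mul, qsubst_C, qsubst_varZ _ _ (h i i.2),
      ← mul_assoc, ← map_mul, pow_add]
  exact DFunLike.congr_fun this F

lemma specP_qsubst (σ e : ℕ → ℕ) (F : PZ k) :
    specP k (qsubst k σ e F) = qsubst k σ e (specP k F) := by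
  have : (specP k).comp (qsubst k σ e).toRingHom = (qsubst k σ e).toRingHom.comp (specP k) := by
    refine MvPolynomial.ringHom_ext (fun r => ?_) fun i => ?_
    · change specP k (qsubst k σ e (C r)) = qsubst k σ e (specP k (C r))
      rw [qsubst_C, specP_C, qsubst_C]
    · change specP k (qsubst k σ e (MvPolynomial.X i)) =
        qsubst k σ e (specP k (MvPolynomial.X i))
      rw [qsubst_X, specP_X, qsubst_X, map_mul, specP_C, map_pow, specR_X1, specP_varZ]
  exact DFunLike.congr_fun this F

lemma qsubst_id (F : PZ k) : qsubst k id (fun _ => 0) F = F := by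
  have : qsubst k id (fun _ => 0) = AlgHom.id R (PZ k) := by
    refine MvPolynomial.algHom_ext fun i => ?_
    rw [qsubst_X, pow_zero, map_one, one_mul]
    exact varZ_of_lt i.2
  rw [this]; rfl

/-- Up to a power of `t`, the operator `θ` is defined over `ℚ[t, q]`, and for `t = 1` it is the
substitution `x_i ↦ q^(e i) x_(σ i)`. -/
def ReducesTo (θ : Module.End K (P k)) (σ e : ℕ → ℕ) : Prop :=
  ∃ N : ℕ, ∀ F : PZ k, ∃ F' : PZ k, t ^ N • θ (inclP k F) = inclP k F' ∧
    specP k F' = qsubst k σ e (specP k F)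

lemma ReducesTo.congr {θ : Module.End K (P k)} {σ e σ' e' : ℕ → ℕ} (h : ReducesTo θ σ e)
    (hσ : ∀ i < k, σ i = σ' i) (he : ∀ i < k, e i = e' i) : ReducesTo θ σ' e' := by
  rw [ReducesTo, ← qsubst_congr hσ he]
  exact h

lemma ReducesTo.mul {θ θ' : Module.End K (P k)} {σ e σ' e' : ℕ → ℕ} (h : ReducesTo θ σ e)
    (h' : ReducesTo θ' σ' e') (hσ' : ∀ i < k, σ' i < k) :
    ReducesTo (θ * θ') (fun i => σ (σ' i)) (fun i => e' i + e (σ' i)) := by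
  obtain ⟨N, h⟩ := h
  obtain ⟨N', h'⟩ := h'
  refine ⟨N + N', fun F => ?_⟩
  obtain ⟨F', h1, h2⟩ := h' F
  obtain ⟨F'', h3, h4⟩ := h F'
  refine ⟨F'', ?_, ?_⟩
  · rw [← h3, ← h1, map_smul, smul_smul, pow_add]; rfl
  · rw [h4, h2, qsubst_qsubst hσ']

lemma reducesTo_one : ReducesTo (1 : Module.End K (P k)) id (fun _ => 0) :=
  ⟨0, fun F => ⟨F, by rw [pow_zero, one_smul]; rfl, (qsubst_id _).symm⟩⟩

lemma inclP_C_X0_pow_mul (n : ℕ) (F : PZ k) :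
    inclP k (C (MvPolynomial.X 0) ^ n * F) = t ^ n • inclP k F := by
  rw [map_mul, map_pow, inclP_C, MvPolynomial.smul_eq_C_mul, map_pow]; rfl

lemma specP_C_X0_pow_mul (n : ℕ) (F : PZ k) :
    specP k (C (MvPolynomial.X 0) ^ n * F) = specP k F := by
  rw [map_mul, map_pow, specP_C_X0, one_pow, one_mul]

lemma ReducesTo.t_pow_smul {θ : Module.End K (P k)} {σ e : ℕ → ℕ} (h : ReducesTo θ σ e) (n : ℕ) :
    ReducesTo (t ^ n • θ) σ e := by
  obtain ⟨N, h⟩ := h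
  refine ⟨N, fun F => ?_⟩
  obtain ⟨F', h1, h2⟩ := h F
  refine ⟨C (MvPolynomial.X 0) ^ n * F', ?_, by rw [specP_C_X0_pow_mul, h2]⟩
  rw [inclP_C_X0_pow_mul, ← h1, LinearMap.smul_apply, smul_comm]

lemma ReducesTo.t_inv_smul {θ : Module.End K (P k)} {σ e : ℕ → ℕ} (h : ReducesTo θ σ e) :
    ReducesTo (t⁻¹ • θ) σ e := by
  obtain ⟨N, h⟩ := h
  refine ⟨N + 1, fun F => ?_⟩
  obtain ⟨F', h1, h2⟩ := h F
  refine ⟨F', ?_, h2⟩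
  rw [← h1, LinearMap.smul_apply, smul_smul, pow_succ, mul_assoc, mul_inv_cancel₀ t_ne_zero,
    mul_one]

lemma swap_lt {j i : ℕ} (h : j + 1 < k) (hi : i < k) : Equiv.swap j (j + 1) i < k := by
  rw [Equiv.swap_apply_def]; split_ifs <;> omega

lemma inclP_qsubst_swap {j : ℕ} (h : j + 1 < k) (F : PZ k) :
    inclP k (qsubst k (Equiv.swap j (j + 1)) (fun _ => 0) F) =
      simpleRefl k j h (inclP k F) := by
  have : (inclP k).comp (qsubst k (Equiv.swap j (j + 1)) (fun _ => 0)).toRingHom =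
      (simpleRefl k j h).toRingHom.comp (inclP k) := by
    refine MvPolynomial.ringHom_ext (fun r => ?_) fun i => ?_
    · change inclP k (qsubst k _ _ (C r)) = simpleRefl k j h (inclP k (C r))
      rw [qsubst_C, inclP_C]
      exact ((simpleRefl k j h).commutes _).symm
    · change inclP k (qsubst k _ _ (MvPolynomial.X i)) =
        simpleRefl k j h (inclP k (MvPolynomial.X i))
      rw [qsubst_X, pow_zero, map_one, one_mul, inclP_X, inclP_varZ, ← var_fin, simpleRefl_var]
  exact DFunLike.congr_fun this F

/-- The Demazure-Lusztig operator is defined over `ℚ[t, q]` and becomes a transposition for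
`t = 1`. -/
lemma exists_opT_inclP {j : ℕ} (h : j + 1 < k) (F : PZ k) :
    ∃ F' : PZ k, opT k j (inclP k F) = inclP k F' ∧
      specP k F' = qsubst k (Equiv.swap j (j + 1)) (fun _ => 0) (specP k F) := by
  set s := qsubst k (Equiv.swap j (j + 1)) (fun _ => 0) with hs
  have h1 : varZ k j - varZ k (j + 1) ∣ (AlgHom.id R (PZ k)).toRingHom F - s.toRingHom F := by
    refine dvd_map_sub_map (fun c => ?_) (fun i => ?_) F
    · change _ ∣ C c - s (C c)
      rw [hs, qsubst_C, sub_self]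
      exact dvd_zero _
    · change _ ∣ MvPolynomial.X i - s (MvPolynomial.X i)
      rw [hs, qsubst_X, pow_zero, map_one, one_mul, ← varZ_of_lt i.2]
      rw [Equiv.swap_apply_def]
      split_ifs with h0 h1
      · rw [h0]
      · rw [h1]
        exact ⟨-1, by ring⟩
      · simp
  obtain ⟨G, hG⟩ := h1
  change F - s F = _ at hG
  refine ⟨s F + C (1 - MvPolynomial.X 0) * (varZ k j * G), ?_, ?_⟩
  · have hG' := congrArg (inclP k) hG
    rw [map_sub, map_mul, map_sub, inclP_qsubst_swap h, inclP_varZ, inclP_varZ] at hG'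
    apply opT_eq_of_spec h
    rw [map_add, map_mul, map_mul, inclP_qsubst_swap h, inclP_varZ, inclP_C,
      map_sub (algebraMap R K), map_one, algebraMap_X0]
    simp only [map_sub, map_one]
    linear_combination (-(1 - C t) * var k j) * hG'
  · rw [map_add, map_mul, specP_C, map_sub, map_one, specR_X0, sub_self, map_zero, zero_mul,
      add_zero, specP_qsubst]

lemma reducesTo_opT {j : ℕ} (h : j + 1 < k) :
    ReducesTo (opT k j) (Equiv.swap j (j + 1)) (fun _ => 0) := by
  refine ⟨0, fun F => ?_⟩
  obtain ⟨F', h1, h2⟩ := exists_opT_inclP h F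
  exact ⟨F', by rw [pow_zero, one_smul, h1], h2⟩

lemma reducesTo_opTinv {j : ℕ} (h : j + 1 < k) :
    ReducesTo (opTinv k j) (Equiv.swap j (j + 1)) (fun _ => 0) := by
  refine ⟨1, fun F => ?_⟩
  obtain ⟨F', h1, h2⟩ := exists_opT_inclP h F
  refine ⟨F' + C (MvPolynomial.X 0 - 1) * F, ?_, ?_⟩
  · have h3 : opTinv k j (inclP k F) = t⁻¹ • (opT k j (inclP k F) + (t - 1) • inclP k F) := rfl
    rw [h3, pow_one, smul_smul, mul_inv_cancel₀ t_ne_zero, one_smul, h1, map_add, map_mul, inclP_C,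
      MvPolynomial.smul_eq_C_mul, map_sub (algebraMap R K), map_one, algebraMap_X0]
  · rw [map_add, map_mul, specP_C, map_sub, map_one, specR_X0, sub_self, map_zero, zero_mul,
      add_zero, h2]

lemma reducesTo_rotate : ReducesTo (rotate k).toLinearMap
    (fun i => if i + 1 < k then i + 1 else 0) (fun i => if i + 1 < k then 0 else 1) := by
  refine ⟨0, fun F => ⟨qsubst k _ _ F, ?_, specP_qsubst _ _ F⟩⟩
  rw [pow_zero, one_smul]
  set s := qsubst k (fun i => if i + 1 < k then i + 1 else 0) (fun i => if i + 1 < k then 0 else 1)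
    with hs
  have : (rotate k).toRingHom.comp (inclP k) = (inclP k).comp s.toRingHom := by
    refine MvPolynomial.ringHom_ext (fun r => ?_) fun i => ?_
    · change rotate k (inclP k (C r)) = inclP k (s (C r))
      rw [hs, qsubst_C, inclP_C]
      exact (rotate k).commutes _
    · change rotate k (inclP k (MvPolynomial.X i)) = inclP k (s (MvPolynomial.X i))
      rw [hs, qsubst_X, inclP_X, map_mul, inclP_C, inclP_varZ, rotate_eq_subst, subst_X]
      split_ifs
      · simp
      · simp only [pow_one]; rfl
  exact DFunLike.congr_fun this F

lemma reducesTo_downInv {n : ℕ} (h : n < k) :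
    ReducesTo (downInv k n) (fun i => if i = 0 then n else if i ≤ n then i - 1 else i)
      (fun _ => 0) := by
  induction n with
  | zero =>
    refine reducesTo_one.congr (fun i _ => ?_) fun _ _ => rfl
    simp only [id]
    split_ifs <;> omega
  | succ n ih =>
    have h1 : downInv k (n + 1) = opTinv k n * downInv k n := LinearMap.ext fun f => downInv_succ n f
    rw [h1]
    refine ((reducesTo_opTinv h).mul (ih (by omega)) fun i hi => ?_).congr (fun i hi => ?_)
      fun _ _ => rfl
    · split_ifs <;> omega
    · simp only [Equiv.swap_apply_def]
      split_ifs <;> omega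

/-- The Cherednik operators become dilations of the variables for `t = 1`. -/
lemma reducesTo_opY {j : ℕ} (h : j < k) :
    ReducesTo (opY k j) id (fun i => if i = j then 1 else 0) := by
  induction j with
  | zero =>
    have h1 : opY k 0 = t ^ k • ((rotate k).toLinearMap * downInv k (k - 1)) :=
      LinearMap.ext fun f => opY_zero f
    rw [h1]
    refine ((reducesTo_rotate.mul (reducesTo_downInv (by omega)) fun i hi => ?_).congr
      (fun i hi => ?_) fun i hi => ?_).t_pow_smul k
    · split_ifs <;> omega
    · simp only [id]
      split_ifs <;> omega
    · split_ifs <;> omega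
  | succ j ih =>
    rw [opY_succ h]
    refine (((reducesTo_opT h).mul (ih (by omega)) fun i hi => hi).mul (reducesTo_opT h)
      fun i hi => swap_lt h hi).t_inv_smul.congr (fun i hi => ?_) fun i hi => ?_
    · simp only [id, Equiv.swap_apply_self]
    · simp only [Equiv.swap_apply_def]
      split_ifs <;> omega

end Reduction

/-! ### Independence of operators with different reductions -/

section Independence
variable {k : ℕ}

/-- The product of the variables. -/
def prodVar (k : ℕ) : P k := ∏ i : Fin k, MvPolynomial.X i

/-- The product of the variables over `ℚ[t, q]`. -/
def prodVarZ (k : ℕ) : PZ k := ∏ i : Fin k, MvPolynomial.X i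

lemma inclP_prodVarZ : inclP k (prodVarZ k) = prodVar k := by
  rw [prodVarZ, map_prod]
  exact Finset.prod_congr rfl fun i _ => inclP_X i

lemma specP_prodVarZ : specP k (prodVarZ k) = prodVarZ k := by
  rw [prodVarZ, map_prod]
  exact Finset.prod_congr rfl fun i _ => specP_X i

lemma qsubst_prodVarZ_ne_zero {σ e : ℕ → ℕ} (hσ : ∀ i < k, σ i < k) :
    qsubst k σ e (prodVarZ k) ≠ 0 := by
  rw [prodVarZ, map_prod, Finset.prod_ne_zero_iff]
  intro i _
  rw [qsubst_X, varZ_of_lt (hσ i i.2)]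
  exact mul_ne_zero (by simp) (MvPolynomial.X_ne_zero _)

/-- The monoid morphism `F ↦ F(t = 1)` followed by the substitution `x_i ↦ q^(e i) x_(σ i)`. -/
def character (k : ℕ) (σ e : ℕ → ℕ) : PZ k →* PZ k :=
  ((qsubst k σ e).toRingHom.comp (specP k)).toMonoidHom

lemma character_apply (σ e : ℕ → ℕ) (F : PZ k) :
    character k σ e F = qsubst k σ e (specP k F) := rfl

lemma eq_of_character_eq {σ e σ' e' : ℕ → ℕ} (hσ : ∀ i < k, σ i < k) (hσ' : ∀ i < k, σ' i < k)
    (h : character k σ e = character k σ' e') {i : ℕ} (hi : i < k) : σ i = σ' i ∧ e i = e' i := by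
  have h1 := DFunLike.congr_fun h (varZ k i)
  rw [character_apply, character_apply, specP_varZ, qsubst_varZ _ _ hi, qsubst_varZ _ _ hi,
    varZ_of_lt (hσ i hi), varZ_of_lt (hσ' i hi), MvPolynomial.C_mul_X_eq_monomial,
    MvPolynomial.C_mul_X_eq_monomial, MvPolynomial.monomial_eq_monomial_iff] at h1
  have h0 : (MvPolynomial.X 1 : R) ^ e i ≠ 0 := pow_ne_zero _ (MvPolynomial.X_ne_zero 1)
  obtain ⟨h2, h3⟩ := h1.resolve_right fun h => h0 h.1
  rw [Finsupp.single_left_inj one_ne_zero, Fin.mk.injEq] at h2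
  rw [MvPolynomial.X_pow_eq_monomial, MvPolynomial.X_pow_eq_monomial,
    MvPolynomial.monomial_left_inj one_ne_zero] at h3
  exact ⟨h2, Finsupp.single_injective _ h3⟩

lemma not_isUnit_C_X0_sub_one : ¬ IsUnit (C (MvPolynomial.X 0 - 1) : PZ k) := by
  intro h
  have h1 := h.map (specP k)
  rw [specP_C, map_sub, map_one, specR_X0, sub_self, map_zero] at h1
  exact not_isUnit_zero h1

/-- Operators over `ℚ[t, q]` whose reductions at `t = 1` are different substitutions are linearly
independent over the polynomials: a relation can be reduced at `t = 1`, where Dedekind's theorem on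
the independence of characters shows that all coefficients vanish, so that the relation can be
divided by `t - 1`, arbitrarily often. -/
lemma eq_zero_of_sum_mul_eq_zero {ι : Type*} {s : Finset ι} {σ e : ι → ℕ → ℕ}
    (hσ : ∀ j ∈ s, ∀ i < k, σ j i < k)
    (hinj : ∀ j ∈ s, ∀ j' ∈ s, (∀ i < k, σ j i = σ j' i ∧ e j i = e j' i) → j = j')
    {Φ : ι → PZ k → PZ k} (hΦ : ∀ j ∈ s, ∀ F, specP k (Φ j F) = character k (σ j) (e j) F)
    {G : ι → PZ k} (hG : ∀ F, ∑ j ∈ s, G j * Φ j (prodVarZ k * F) = 0) {j : ι} (hj : j ∈ s) :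
    G j = 0 := by
  -- the coefficients of every relation are divisible by `t - 1`
  have hdvd : ∀ G : ι → PZ k, (∀ F, ∑ j ∈ s, G j * Φ j (prodVarZ k * F) = 0) →
      ∀ j ∈ s, (C (MvPolynomial.X 0 - 1) : PZ k) ∣ G j := by
    intro G hG j hj
    apply dvd_of_specP_eq_zero
    have hli := linearIndependent_monoidHom (PZ k) (PZ k)
    have hinj' : Function.Injective fun j : s => character k (σ j) (e j) := fun a b hab =>
      Subtype.ext (hinj a a.2 b b.2 fun i hi =>
        eq_of_character_eq (hσ a a.2) (hσ b b.2) hab hi)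
    have h1 := Fintype.linearIndependent_iff.mp (hli.comp _ hinj')
      (fun j => specP k (G j) * character k (σ j) (e j) (prodVarZ k)) ?_ ⟨j, hj⟩
    · refine (mul_eq_zero.mp h1).resolve_right ?_
      rw [character_apply, specP_prodVarZ]
      exact qsubst_prodVarZ_ne_zero (hσ j hj)
    · funext F
      have h2 := congrArg (specP k) (hG F)
      rw [map_sum, map_zero, ← Finset.sum_coe_sort] at h2
      rw [Finset.sum_apply]
      refine (Finset.sum_congr rfl fun j _ => ?_).trans h2
      rw [map_mul, hΦ j j.2, map_mul, ← mul_assoc]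
      rfl
  have hne : (C (MvPolynomial.X 0 - 1) : PZ k) ≠ 0 := by
    rw [ne_eq, MvPolynomial.C_eq_zero]
    intro h
    simpa using congrArg (MvPolynomial.eval 0) h
  have hpow : ∀ n : ℕ, ∀ G : ι → PZ k, (∀ F, ∑ j ∈ s, G j * Φ j (prodVarZ k * F) = 0) →
      ∀ j ∈ s, (C (MvPolynomial.X 0 - 1) : PZ k) ^ n ∣ G j := by
    intro n
    induction n with
    | zero => intro G _ j _; rw [pow_zero]; exact one_dvd _
    | succ n ih =>
      intro G hG j hj
      have h1 : ∀ j, ∃ G', j ∈ s → G j = C (MvPolynomial.X 0 - 1) * G' := by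
        intro j
        by_cases hj : j ∈ s
        · obtain ⟨G', h⟩ := hdvd G hG j hj
          exact ⟨G', fun _ => h⟩
        · exact ⟨0, fun h => absurd h hj⟩
      choose G' hG' using h1
      rw [hG' j hj, pow_succ']
      refine mul_dvd_mul_left _ (ih G' (fun F => ?_) j hj)
      apply mul_left_cancel₀ hne
      rw [mul_zero, ← hG F, Finset.mul_sum]
      exact Finset.sum_congr rfl fun j hj => by rw [hG' j hj, mul_assoc]
  by_contra h0
  obtain ⟨n, hn⟩ := FiniteMultiplicity.of_not_isUnit not_isUnit_C_X0_sub_one h0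
  exact hn (hpow _ G hG j hj)

/-- The version of `eq_zero_of_sum_mul_eq_zero` for operators over `ℚ(t, q)`. -/
lemma coeff_eq_zero_of_sum_mul_eq_zero {ι : Type*} {s : Finset ι} {σ e : ι → ℕ → ℕ}
    (hσ : ∀ j ∈ s, ∀ i < k, σ j i < k)
    (hinj : ∀ j ∈ s, ∀ j' ∈ s, (∀ i < k, σ j i = σ j' i ∧ e j i = e j' i) → j = j')
    {θ : ι → Module.End K (P k)} (hθ : ∀ j, ReducesTo (θ j) (σ j) (e j))
    {p : ι → P k} (hp : ∀ f, ∑ j ∈ s, p j * θ j (prodVar k * f) = 0) {j : ι} (hj : j ∈ s) :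
    p j = 0 := by
  choose N Φ hΦ hΦ' using hθ
  -- clear the denominators of the coefficients `t^(-N j) p j`
  obtain ⟨D, hD, G, hG⟩ : ∃ D : R, D ≠ 0 ∧ ∃ G : ι → PZ k, ∀ j ∈ s,
      algebraMap R K D • (t ^ N j)⁻¹ • p j = inclP k (G j) := by
    let : Algebra (PZ k) (P k) := (inclP k).toAlgebra
    have : IsLocalization ((nonZeroDivisors R).map (C : R →+* PZ k)) (P k) :=
      MvPolynomial.isLocalization (nonZeroDivisors R) K
    obtain ⟨⟨_, D, hD, rfl⟩, h⟩ := IsLocalization.exist_integer_multiples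
      ((nonZeroDivisors R).map (C : R →+* PZ k)) s fun j => (t ^ N j)⁻¹ • p j
    choose! G hG using h
    refine ⟨D, nonZeroDivisors.ne_zero hD, G, fun j hj => ?_⟩
    refine Eq.trans ?_ (hG j hj).symm
    rw [MvPolynomial.smul_eq_C_mul, ← inclP_C]
    rfl
  have hD' : algebraMap R K D ≠ 0 := by simpa using hD
  have h1 := eq_zero_of_sum_mul_eq_zero hσ hinj (Φ := Φ) (fun j _ F => hΦ' j F) (G := G)
    (fun F => ?_) hj
  · have h2 := hG j hj
    rw [h1, map_zero, smul_eq_zero_iff_right hD',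
      smul_eq_zero_iff_right (inv_ne_zero (pow_ne_zero _ t_ne_zero))] at h2
    exact h2
  · apply inclP_injective
    rw [map_sum, map_zero]
    have h3 := congrArg (algebraMap R K D • ·) (hp (inclP k F))
    simp only [smul_zero, Finset.smul_sum] at h3
    refine (Finset.sum_congr rfl fun j hj => ?_).trans h3
    rw [map_mul, ← hG j hj, ← hΦ, map_mul, inclP_prodVarZ, smul_mul_assoc, smul_mul_assoc,
      mul_smul_comm, smul_smul (t ^ N j)⁻¹, inv_mul_cancel₀ (pow_ne_zero _ t_ne_zero), one_smul]

end Independence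

/-! ### Faithfulness on the multiples of the product of the variables -/

section Words

lemma map_desc {M N : Type*} [Monoid M] [Monoid N] (φ : M →* N) (T : ℕ → M) (n l : ℕ) :
    φ (desc T n l) = desc (fun i => φ (T i)) n l := by
  induction l with
  | zero => exact map_one φ
  | succ l ih => rw [desc, map_mul, ih]; rfl

lemma map_codeWord {M N : Type*} [Monoid M] [Monoid N] (φ : M →* N) (T : ℕ → M) (n : ℕ)
    (c : Code n) : φ (codeWord T n c) = codeWord (fun i => φ (T i)) n c := by
  induction n with
  | zero => exact map_one φ
  | succ n ih => rw [codeWord, map_mul, ih, map_desc]; rfl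

lemma map_mword {A B : Type*} [Semiring A] [Algebra K A] [Semiring B] [Algebra K B]
    {n : ℕ} (φ : A →ₐ[K] B)
    (z : ℕ → A) (s : Multiset (Fin n)) : φ (mword z s) = mword (fun i => φ (z i)) s := by
  rw [mword, map_list_prod, List.map_map]; rfl

/-- The transposition of `i` and `i + 1`. -/
def swapSucc (i : ℕ) : Equiv.Perm ℕ := Equiv.swap i (i + 1)

lemma desc_swapSucc_of_gt {n l i : ℕ} (h : n + 1 < i) : desc swapSucc n l i = i := by
  induction l with
  | zero => rfl
  | succ l ih =>
    rw [desc, Equiv.Perm.mul_apply, swapSucc,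
      Equiv.swap_apply_of_ne_of_ne (by omega) (by omega), ih]

lemma desc_swapSucc {n l : ℕ} (h : l ≤ n + 1) : desc swapSucc n l (n + 1 - l) = n + 1 := by
  induction l with
  | zero => rfl
  | succ l ih =>
    rw [desc, Equiv.Perm.mul_apply, swapSucc, show n + 1 - (l + 1) = n - l by omega,
      Equiv.swap_apply_left, show n - l + 1 = n + 1 - l by omega, ih (by omega)]

lemma codeWord_swapSucc_of_gt {n i : ℕ} (c : Code n) (h : n < i) : codeWord swapSucc n c i = i := by
  induction n with
  | zero => rfl
  | succ n ih =>
    rw [codeWord, Equiv.Perm.mul_apply, desc_swapSucc_of_gt h, ih _ (by omega)]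

/-- Different codes give different permutations. -/
lemma codeWord_swapSucc_injective (n : ℕ) : Function.Injective (codeWord swapSucc n) := by
  induction n with
  | zero => exact fun _ _ _ => rfl
  | succ n ih =>
    rintro ⟨c, l, hl⟩ ⟨c', l', hl'⟩ h
    change codeWord swapSucc n c * desc swapSucc n l = codeWord swapSucc n c' * desc swapSucc n l'
      at h
    -- the preimage of the last letter determines the last factor
    have h1 : ∀ (c : Code n) (l : ℕ), l < n + 2 →
        (codeWord swapSucc n c * desc swapSucc n l) (n + 1 - l) = n + 1 := by
      intro c l hl
      rw [Equiv.Perm.mul_apply, desc_swapSucc (by omega), codeWord_swapSucc_of_gt c (by omega)]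
    have h2 : n + 1 - l = n + 1 - l' := by
      apply (codeWord swapSucc n c * desc swapSucc n l).injective
      rw [h1 c l hl, h, h1 c' l' hl']
    obtain rfl : l = l' := by omega
    rw [ih (mul_right_cancel h)]

variable {k : ℕ}

lemma desc_swapSucc_lt {n l i : ℕ} (h : n + 1 < k) (hi : i < k) : desc swapSucc n l i < k := by
  induction l generalizing i with
  | zero => exact hi
  | succ l ih =>
    rw [desc, Equiv.Perm.mul_apply]
    exact ih (swap_lt (by omega) hi)

lemma codeWord_swapSucc_lt {n i : ℕ} (c : Code n) (h : n < k) (hi : i < k) :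
    codeWord swapSucc n c i < k := by
  induction n generalizing i with
  | zero => exact hi
  | succ n ih =>
    rw [codeWord, Equiv.Perm.mul_apply]
    exact ih _ (by omega) (desc_swapSucc_lt h hi)

lemma genP_T {i : ℕ} (h : i + 1 < k) : genP k (.T i) = opT k i := if_pos h

lemma genP_Y {i : ℕ} (h : i < k) : genP k (.Y i) = opY k i := if_pos h

lemma reducesTo_desc {n l : ℕ} (h : n + 1 < k) :
    ReducesTo (desc (fun i => genP k (.T i)) n l) ⇑(desc swapSucc n l) (fun _ => 0) := by
  induction l with
  | zero => exact reducesTo_one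
  | succ l ih =>
    rw [desc, genP_T (show n - l + 1 < k by omega)]
    exact ih.mul (reducesTo_opT (by omega)) fun i hi => swap_lt (by omega) hi

/-- The operator `T_w` becomes the permutation `w` for `t = 1`. -/
lemma reducesTo_codeWord {n : ℕ} (h : n < k) (c : Code n) :
    ReducesTo (codeWord (fun i => genP k (.T i)) n c) ⇑(codeWord swapSucc n c) (fun _ => 0) := by
  induction n with
  | zero => exact reducesTo_one
  | succ n ih =>
    rw [codeWord]
    exact (ih (by omega) c.1).mul (reducesTo_desc h) fun i hi => desc_swapSucc_lt h hi

/-- A monomial in the `Y_i` becomes the corresponding dilation of the variables for `t = 1`. -/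
lemma reducesTo_mword (b : Multiset (Fin k)) :
    ReducesTo (mword (fun i => genP k (.Y i)) b) id
      (fun i => (b.map fun j : Fin k => (j : ℕ)).count i) := by
  have h : ∀ l : List (Fin k), ReducesTo (l.map fun i : Fin k => genP k (.Y i)).prod id
      (fun i => ((l : Multiset (Fin k)).map fun j : Fin k => (j : ℕ)).count i) := by
    intro l
    induction l with
    | nil => exact reducesTo_one
    | cons a l ih =>
      rw [List.map_cons, List.prod_cons, genP_Y a.2]
      refine ((reducesTo_opY a.2).mul ih fun i hi => hi).congr (fun i hi => rfl) fun i hi => ?_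
      rw [← Multiset.cons_coe, Multiset.map_cons, Multiset.count_cons]
      rfl
  have := h b.toList
  rwa [Multiset.coe_toList] at this

lemma mword_genP_X (a : Multiset (Fin k)) (f : P k) :
    mword (fun i => genP k (.X i)) a f =
      MvPolynomial.monomial (Multiset.toFinsupp a) (1 : K) * f := by
  have h : ∀ l : List (Fin k), (l.map fun i : Fin k => genP k (.X i)).prod f =
      MvPolynomial.monomial (Multiset.toFinsupp (l : Multiset (Fin k))) (1 : K) * f := by
    intro l
    induction l with
    | nil =>
      rw [List.map_nil, List.prod_nil, Multiset.coe_nil, map_zero]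
      exact (one_mul f).symm
    | cons a l ih =>
      rw [List.map_cons, List.prod_cons, Module.End.mul_apply, ih, genP, opX_apply, var_fin,
        ← Multiset.cons_coe, ← Multiset.singleton_add, map_add, Multiset.toFinsupp_singleton,
        ← mul_assoc, MvPolynomial.X, MvPolynomial.monomial_mul, one_mul]
  have := h a.toList
  rwa [Multiset.coe_toList] at this

/-- The element `X^a T_w Y^b` of the free algebra. -/
def stdWord (k : ℕ) (p : Multiset (Fin k) × Code (k - 1) × Multiset (Fin k)) :
    FreeAlgebra K StableGen :=
  mword (fun i => FreeAlgebra.ι K (.X i)) p.1 *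
    (codeWord (fun i => FreeAlgebra.ι K (.T i)) (k - 1) p.2.1 *
      mword (fun i => FreeAlgebra.ι K (.Y i)) p.2.2)

lemma toDAHA_stdWord (p : Multiset (Fin k) × Code (k - 1) × Multiset (Fin k)) :
    toDAHA k (stdWord k p) =
      mword (hX k) p.1 * (codeWord (hT k) (k - 1) p.2.1 * mword (hY k) p.2.2) := by
  rw [stdWord, map_mul, map_mul]
  have h1 := map_codeWord (toDAHA k : FreeAlgebra K StableGen →* DAHA k)
    (fun i => FreeAlgebra.ι K (.T i)) (k - 1) p.2.1
  have h2 := map_mword (toDAHA k) (fun i => FreeAlgebra.ι K (.X i)) p.1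
  have h3 := map_mword (toDAHA k) (fun i => FreeAlgebra.ι K (.Y i)) p.2.2
  refine congrArg₂ (· * ·) h2 (congrArg₂ (· * ·) h1 h3)

lemma actP_stdWord (p : Multiset (Fin k) × Code (k - 1) × Multiset (Fin k)) (f : P k) :
    actP k (stdWord k p) f = MvPolynomial.monomial (Multiset.toFinsupp p.1) (1 : K) *
      (codeWord (fun i => genP k (.T i)) (k - 1) p.2.1 *
        mword (fun i => genP k (.Y i)) p.2.2) f := by
  have h0 : ∀ x, actP k (FreeAlgebra.ι K x) = genP k x := fun x => FreeAlgebra.lift_ι_apply _ _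
  have h1 := map_codeWord (actP k : FreeAlgebra K StableGen →* Module.End K (P k))
    (fun i => FreeAlgebra.ι K (.T i)) (k - 1) p.2.1
  have h2 := map_mword (actP k) (fun i => FreeAlgebra.ι K (.X i)) p.1
  have h3 := map_mword (actP k) (fun i => FreeAlgebra.ι K (.Y i)) p.2.2
  simp only [MonoidHom.coe_coe, h0] at h1 h2 h3
  rw [stdWord, map_mul, map_mul, h1, h2, h3, Module.End.mul_apply, mword_genP_X]

/-- The words `X^a T_w Y^b` act on the multiples of the product of the variables by linearly
independent operators. -/
lemma eq_zero_of_actP_sum_eq_zero (hk : 0 < k)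
    {c : Multiset (Fin k) × Code (k - 1) × Multiset (Fin k) →₀ K}
    (hc : ∀ f, actP k (c.sum fun p a => a • stdWord k p) (prodVar k * f) = 0) : c = 0 := by
  classical
  set J := c.support.image Prod.snd with hJ
  -- the coefficient of `T_w Y^b`, a polynomial in the `X_i`
  set P' : Code (k - 1) × Multiset (Fin k) → P k := fun j =>
    ∑ p ∈ c.support with p.2 = j, MvPolynomial.monomial (Multiset.toFinsupp p.1) (c p) with hP
  have hPz : ∀ j ∈ J, P' j = 0 := by
    intro j hj
    refine coeff_eq_zero_of_sum_mul_eq_zero (s := J)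
      (σ := fun j => ⇑(codeWord swapSucc (k - 1) j.1))
      (e := fun j i => (j.2.map fun l : Fin k => (l : ℕ)).count i)
      (θ := fun j => codeWord (fun i => genP k (.T i)) (k - 1) j.1 *
        mword (fun i => genP k (.Y i)) j.2)
      (fun j _ i hi => codeWord_swapSucc_lt _ (by omega) hi) ?_ ?_ (fun f => ?_) hj
    · intro j _ j' _ h
      have h1 : j.1 = j'.1 := by
        apply codeWord_swapSucc_injective
        refine Equiv.ext fun i => ?_
        rcases lt_or_ge i k with hi | hi
        · exact (h i hi).1
        · rw [codeWord_swapSucc_of_gt _ (by omega), codeWord_swapSucc_of_gt _ (by omega)]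
      have h2 : j.2 = j'.2 := by
        refine Multiset.map_injective Fin.val_injective (Multiset.ext.mpr fun i => ?_)
        rcases lt_or_ge i k with hi | hi
        · exact (h i hi).2
        · have h3 : ∀ b : Multiset (Fin k), (b.map Fin.val).count i = 0 := by
            intro b
            rw [Multiset.count_eq_zero, Multiset.mem_map]
            rintro ⟨l, _, hl⟩
            omega
          rw [h3, h3]
      exact Prod.ext h1 h2
    · intro j
      refine ((reducesTo_codeWord (by omega) j.1).mul (reducesTo_mword j.2)
        fun i hi => hi).congr (fun i _ => rfl) fun i _ => rfl
    · rw [← hc f, Finsupp.sum, map_sum, LinearMap.sum_apply,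
        ← Finset.sum_fiberwise_of_maps_to (t := J) (g := Prod.snd)
          fun p hp => Finset.mem_image_of_mem _ hp]
      refine Finset.sum_congr rfl fun j _ => ?_
      rw [hP, Finset.sum_mul]
      refine Finset.sum_congr rfl fun p hp => ?_
      rw [← (Finset.mem_filter.mp hp).2, map_smul, LinearMap.smul_apply, actP_stdWord,
        ← smul_mul_assoc, MvPolynomial.smul_monomial, smul_eq_mul, mul_one]
  refine Finsupp.ext fun p => ?_
  by_contra hp
  have hp' : p ∈ c.support := Finsupp.mem_support_iff.mpr hp
  have h1 := congrArg (MvPolynomial.coeff (Multiset.toFinsupp p.1))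
    (hPz p.2 (Finset.mem_image_of_mem _ hp'))
  rw [hP, MvPolynomial.coeff_sum, MvPolynomial.coeff_zero,
    Finset.sum_eq_single p, MvPolynomial.coeff_monomial, if_pos rfl] at h1
  · exact hp h1
  · intro p' hp'' hne
    rw [MvPolynomial.coeff_monomial, if_neg]
    intro h
    exact hne (Prod.ext (Multiset.toFinsupp.injective h) (Finset.mem_filter.mp hp'').2)
  · exact fun h => (h (Finset.mem_filter.mpr ⟨hp', rfl⟩)).elim

/-- An element of `ℋₖ⁺` that acts by zero on the multiples of the product of the variables is
zero. -/
lemma toDAHA_eq_zero_of_actP {H : FreeAlgebra K StableGen} (hk : 0 < k)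
    (hH : toDAHA k H ∈ DAHAPlus k) (h0 : ∀ f, actP k H (prodVar k * f) = 0) : toDAHA k H = 0 := by
  have h1 := DAHAPlus_le_span hk hH
  rw [← funext toDAHA_stdWord, Finsupp.mem_span_range_iff_exists_finsupp] at h1
  obtain ⟨c, hc⟩ := h1
  have h2 : toDAHA k (c.sum fun p a => a • stdWord k p) = toDAHA k H := by
    rw [← hc, Finsupp.sum, Finsupp.sum, map_sum]
    exact Finset.sum_congr rfl fun p _ => map_smul (toDAHA k) _ _
  have h3 : c = 0 := eq_zero_of_actP_sum_eq_zero hk fun f => by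
    rw [actP_eq_of_toDAHA_eq h2, h0]
  rw [← h2, h3, Finsupp.sum_zero_index, map_zero]

end Words

/-! ### The canonical morphisms -/

section Canonical
variable {k : ℕ}

lemma toDAHA_mem {H : FreeAlgebra K StableGen} (hH : H ∈ freeLevel k) :
    toDAHA k H ∈ DAHAPlus k := by
  have h1 : (freeLevel k).map (toDAHA k) ≤ DAHAPlus k := by
    rw [freeLevel, AlgHom.map_adjoin, Algebra.adjoin_le_iff]
    rintro _ ⟨_, ⟨x, hx, rfl⟩, rfl⟩
    rw [toDAHA_ι hx]
    exact Algebra.subset_adjoin ⟨x, hx, rfl⟩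
  exact h1 ⟨H, hH, rfl⟩

/-- Nonzero scalars act by nonzero operators on the almost symmetric module. -/
lemma eq_zero_of_actInf_algebraMap {c : K} (h : actInf (algebraMap K _ c) = 0) : c = 0 := by
  have hmem : (fun n => (1 : P n)) ∈ Plevel 0 :=
    ⟨⟨fun n => map_one _, 0, fun n => by rw [MvPolynomial.totalDegree_one]⟩,
      fun j _ n h => map_one _⟩
  rw [AlgHom.commutes] at h
  have h1 := congrArg (fun F : Pas => F.1 0)
    (LinearMap.congr_fun h ⟨_, Plevel_le_Pas 0 hmem⟩)
  have h2 : c • (1 : P 0) = 0 := h1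
  rwa [smul_eq_zero_iff_left one_ne_zero] at h2

/-- Elements of level `k` that act by zero on the almost symmetric module vanish in `ℋₖ`. -/
lemma toDAHA_eq_zero {H : FreeAlgebra K StableGen} (hH : H ∈ freeLevel k) (h0 : actInf H = 0) :
    toDAHA k H = 0 := by
  rcases Nat.eq_zero_or_pos k with rfl | hk
  -- level `0` consists of scalars
  · have h1 : freeLevel 0 = ⊥ := by
      rw [freeLevel, eq_bot_iff, Algebra.adjoin_le_iff]
      rintro _ ⟨x, hx, rfl⟩
      cases x <;> exact absurd hx (Nat.not_lt_zero _)
    rw [h1, Algebra.mem_bot] at hH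
    obtain ⟨c, rfl⟩ := hH
    rw [eq_zero_of_actInf_algebraMap h0, map_zero, map_zero]
  · refine toDAHA_eq_zero_of_actP hk (toDAHA_mem hH) fun f => actP_eq_zero hH h0 fun i hi => ?_
    rw [var_of_lt hi]
    exact (Finset.dvd_prod_of_mem _ (Finset.mem_univ _)).mul_right f

lemma exists_lift {H : StableDAHA} (hH : H ∈ level k) :
    ∃ H' ∈ freeLevel k, RingQuot.mkAlgHom K StableRel H' = H := by
  have h1 : level k = (freeLevel k).map (RingQuot.mkAlgHom K StableRel) := by
    rw [freeLevel, AlgHom.map_adjoin, Set.image_image]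
    rfl
  rw [h1] at hH
  exact hH

/-- Two lifts of level `k` of an element of `ℋ⁺` have the same image in `ℋₖ`, as their difference
acts by zero on the almost symmetric module. -/
lemma toDAHA_eq_of_mk_eq {H H' : FreeAlgebra K StableGen} (hH : H ∈ freeLevel k)
    (hH' : H' ∈ freeLevel k)
    (h : RingQuot.mkAlgHom K StableRel H = RingQuot.mkAlgHom K StableRel H') :
    toDAHA k H = toDAHA k H' := by
  have h1 : actInf (H - H') = 0 := by
    have h2 : actInf H = actInf (H - H') + actInf H' := by rw [← map_add, sub_add_cancel]
    have h3 : actInf H = actInf H' := by rw [← stdRep_mk, ← stdRep_mk, h]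
    refine LinearMap.ext fun F => ?_
    have h4 := LinearMap.congr_fun h2 F
    rw [h3, LinearMap.add_apply] at h4
    exact right_eq_add.mp h4
  have h2 := toDAHA_eq_zero ((freeLevel k).sub_mem hH hH') h1
  rw [map_sub (toDAHA k)] at h2
  exact sub_eq_zero.mp h2

/-- A lift to the free algebra of an element of level `k`. -/
def liftFree (H : level k) : FreeAlgebra K StableGen := (exists_lift H.2).choose

lemma liftFree_mem (H : level k) : liftFree H ∈ freeLevel k := (exists_lift H.2).choose_spec.1

lemma mk_liftFree (H : level k) : RingQuot.mkAlgHom K StableRel (liftFree H) = H.1 :=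
  (exists_lift H.2).choose_spec.2

/-- The canonical morphism `ℋ(k)⁺ → ℋₖ⁺`. It is well defined because the action of `ℋ⁺` on the
almost symmetric module determines the image in `ℋₖ`. -/
def canonical (k : ℕ) : level k →ₐ[K] DAHAPlus k where
  toFun H := ⟨toDAHA k (liftFree H), toDAHA_mem (liftFree_mem H)⟩
  map_one' := Subtype.ext <| (toDAHA_eq_of_mk_eq (liftFree_mem 1) (freeLevel k).one_mem (by
    rw [mk_liftFree, map_one]; rfl)).trans (map_one _)
  map_mul' a b := Subtype.ext <| (toDAHA_eq_of_mk_eq (liftFree_mem _)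
    ((freeLevel k).mul_mem (liftFree_mem a) (liftFree_mem b)) (by
    rw [mk_liftFree, map_mul, mk_liftFree, mk_liftFree]; rfl)).trans (map_mul _ _ _)
  map_zero' := Subtype.ext <| (toDAHA_eq_of_mk_eq (liftFree_mem 0) (freeLevel k).zero_mem (by
    rw [mk_liftFree, map_zero]; rfl)).trans (map_zero _)
  map_add' a b := Subtype.ext <| (toDAHA_eq_of_mk_eq (liftFree_mem _)
    ((freeLevel k).add_mem (liftFree_mem a) (liftFree_mem b)) (by
    rw [mk_liftFree, map_add, mk_liftFree, mk_liftFree]; rfl)).trans (map_add _ _ _)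
  commutes' c := Subtype.ext <| (toDAHA_eq_of_mk_eq (liftFree_mem _)
    ((freeLevel k).algebraMap_mem c) (by
    rw [mk_liftFree, AlgHom.commutes]; rfl)).trans (AlgHom.commutes _ _)

lemma canonical_apply {H : level k} {H' : FreeAlgebra K StableGen} (hH' : H' ∈ freeLevel k)
    (h : RingQuot.mkAlgHom K StableRel H' = H.1) : (canonical k H : DAHA k) = toDAHA k H' :=
  toDAHA_eq_of_mk_eq (liftFree_mem H) hH' ((mk_liftFree H).trans h.symm)

lemma ι_mem_freeLevel {x : StableGen} (h : genOfLevel k x) : FreeAlgebra.ι K x ∈ freeLevel k :=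
  Algebra.subset_adjoin ⟨x, h, rfl⟩

lemma freeLevel_mono {r : ℕ} (h : r ≤ k) : freeLevel r ≤ freeLevel k := by
  refine Algebra.adjoin_mono (Set.image_mono fun x hx => ?_)
  cases x <;> exact lt_of_lt_of_le hx h

lemma isCanonicalMorphism_canonical : IsCanonicalMorphism k (canonical k) := fun _ h =>
  (canonical_apply (ι_mem_freeLevel h) rfl).trans (toDAHA_ι h)

lemma IsCanonicalMorphism.eq {φ ψ : level k →ₐ[K] DAHAPlus k} (h : IsCanonicalMorphism k φ)
    (h' : IsCanonicalMorphism k ψ) : φ = ψ := by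
  refine AlgHom.adjoin_ext ?_
  rintro _ ⟨x, hx, rfl⟩
  exact Subtype.ext ((h x hx).trans (h' x hx).symm)

end Canonical

end StableLimit

end

theorem mainTheorem4 :
    ∃ (ρ : StableLimit.StableDAHA →ₐ[StableLimit.K]
          Module.End StableLimit.K StableLimit.Pas)
      (φ : ∀ k : ℕ, StableLimit.level k →ₐ[StableLimit.K] StableLimit.DAHAPlus k),
      -- `ρ` is the standard representation of `ℋ⁺` on `𝒫_as⁺`
      StableLimit.IsStandardRep ρ ∧ (∀ ρ', StableLimit.IsStandardRep ρ' → ρ' = ρ) ∧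
      -- `φ k` is the canonical morphism `ℋ(k)⁺ → ℋₖ⁺`
      (∀ k, 1 ≤ k → StableLimit.IsCanonicalMorphism k (φ k) ∧
        ∀ φ', StableLimit.IsCanonicalMorphism k φ' → φ' = φ k) ∧
      -- the description of the kernel
      ∀ (r : ℕ), 1 ≤ r → ∀ (H : StableLimit.StableDAHA) (hH : H ∈ StableLimit.level r),
        (ρ H = 0 ↔
          ∀ (k : ℕ) (hk : r ≤ k), φ k ⟨H, StableLimit.level_mono hk hH⟩ = 0) ∧
        (ρ H = 0 ↔
          ∃ k₀ : ℕ, ∀ (k : ℕ) (hk : r ≤ k), k₀ ≤ k →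
            φ k ⟨H, StableLimit.level_mono hk hH⟩ = 0) := by
  refine ⟨StableLimit.stdRep, StableLimit.canonical, StableLimit.isStandardRep_stdRep,
    fun ρ' h => h.eq StableLimit.isStandardRep_stdRep,
    fun k _ => ⟨StableLimit.isCanonicalMorphism_canonical,
      fun φ' h => h.eq StableLimit.isCanonicalMorphism_canonical⟩, fun r _ H hH => ?_⟩
  obtain ⟨H', hH', rfl⟩ := StableLimit.exists_lift hH
  have hφ : ∀ (k : ℕ) (hk : r ≤ k), (StableLimit.canonical k
      ⟨_, StableLimit.level_mono hk hH⟩ : StableLimit.DAHA k) = StableLimit.toDAHA k H' :=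
    fun k hk => StableLimit.canonical_apply (StableLimit.freeLevel_mono hk hH') rfl
  rw [StableLimit.stdRep_mk]
  have h12 : StableLimit.actInf H' = 0 → ∀ (k : ℕ) (hk : r ≤ k), StableLimit.canonical k
      ⟨_, StableLimit.level_mono hk hH⟩ = 0 := fun h0 k hk => Subtype.ext <|
    (hφ k hk).trans (StableLimit.toDAHA_eq_zero (StableLimit.freeLevel_mono hk hH') h0)
  have h31 : (∃ k₀ : ℕ, ∀ (k : ℕ) (hk : r ≤ k), k₀ ≤ k → StableLimit.canonical k
      ⟨_, StableLimit.level_mono hk hH⟩ = 0) → StableLimit.actInf H' = 0 := by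
    rintro ⟨k₀, h⟩
    rw [← map_zero StableLimit.actInf]
    apply StableLimit.actInf_eq_of_eventually
    filter_upwards [eventually_ge_atTop k₀, eventually_ge_atTop r] with k hk₀ hk
    rw [← hφ k hk, h k hk hk₀, map_zero]
    rfl
  exact ⟨⟨h12, fun h => h31 ⟨0, fun k hk _ => h k hk⟩⟩,
    fun h => ⟨0, fun k hk _ => h12 h k hk⟩, h31⟩
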